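/- Let $\Omega=\mathbb R^3$ or $\Omega=\mathbb T^3$, and consider the incompressible Navier–Stokes equations on $\Omega$ with viscosity $1$, $$\partial_t u+(u\cdot\nabla)u-\Delta u=-\nabla \pi,\qquad \nabla\cdot u=0 .$$ A Leray–Hopf weak solution on $[0,S]$ is a weakly continuous, divergence-free $u\in L^\infty(0,S;L^2)\cap L^2(0,S;H^1)$ which solves the equations in the weak sense and satisfies $$\|u(t)\|_2^2+2\int_{t_0}^t\|\nabla u(s)\|_2^2\,ds\le\|u(t_0)\|_2^2$$ for all $t\in[0,S]$ and for almost every $t_0\in[0,t]$, including $t_0=0$. It is regular on $(T',T)$ if $u(t)\in H^1$ for every $t\in(T',T)$ and $t\mapsto\|u(t)\|_{H^1}$ is continuous on $(T',T)$. Let $\lambda_q=2^q$. Fix a smooth $\chi:\mathbb R\to\mathbb R$ with $\chi(r)=1$ for $r\le 3/4$ and $\chi(r)=0$ for $r\ge1$, let $\varphi(r)=\chi(r/2)-\chi(r)$, and let $u=\sum_{q\ge-1}u_q$ be the corresponding Littlewood–Paley decomposition: $u_{-1}$ is given by the Fourier multiplier $\chi(|\xi|)$, and $u_q$, $q\ge0$,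 by the Fourier multiplier $\varphi(\lambda_q^{-1}|\xi|)$. Put $u_{\le p}=\sum_{-1\le q\le p}u_q$ and $u_{\ge p}=\sum_{q\ge p}u_q$. For a time $T$ and $q\in\mathbb Z$ let $I_q=[T-\lambda_q^{-2},T)$, and for $p\in\mathbb N$ let $$E_p=\sup_{t\in I_p}\|u_{\ge p}(t)\|_2^2,\qquad D_p=\int_{I_p}\|\nabla u_{\ge p}(t)\|_2^2\,dt .$$ **Lemma.** There is an absolute constant $C>0$ (depending at most on the fixed function $\chi$) such that for every $0<\alpha<2$ there exist $\delta_\alpha>0$ and $b=b(\alpha)\in\mathbb N$ with the following property. Let $0\le T'<T\le S$ and let $u$ be a Leray–Hopf weak solution on $[0,S]$ that is regular on $(T',T)$ and satisfies $$\limsup_{p\to\infty}\int_{I_{p-b}}\|\nabla u_{\le p}(t)\|_\infty\,dt\le\delta_\alpha .$$ Then there exists $p_0\in\mathbb N$, which may depend on $u$, such that for all $p\ge p_0$ $$\max\{D_p,E_p\}\le C\,\lambda_p^{-\alpha}.$$ -/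

import Mathlib

open MeasureTheory Filter Topology
open scoped NNReal ENNReal ContDiff FourierTransform

noncomputable section

namespace NSE

/-- Three-dimensional Euclidean space; velocities take values here as well. -/
abbrev E3 := EuclideanSpace ℝ (Fin 3)

/-- Values of a gradient `(∂₁ f, ∂₂ f, ∂₃ f)`; the norm is the Frobenius norm. -/
abbrev GradVec := PiLp 2 (fun _ : Fin 3 => E3)

/-- The standard basis vectors. -/
def e (j : Fin 3) : E3 := EuclideanSpace.single j 1

/-- The spatial domain: `ℝ³`, or the torus `𝕋³ = ℝ³ / ℤ³`. Functions on the torus are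
represented by `ℤ³`-periodic functions on `ℝ³`. -/
inductive Dom where
  | whole : Dom
  | torus : Dom

/-- A fundamental domain. -/
def Dom.cell : Dom → Set E3
  | .whole => Set.univ
  | .torus => {x | ∀ j, x j ∈ Set.Ico (0 : ℝ) 1}

/-- Lebesgue measure of the domain. -/
def Dom.measure (Ω : Dom) : Measure E3 := volume.restrict Ω.cell

/-- `f` is a function on the domain: on the torus, it is periodic. -/
def Dom.IsFunOn {F : Type*} : Dom → (E3 → F) → Prop
  | .whole, _ => True
  | .torus, f => ∀ (j : Fin 3) (x : E3), f (x + e j) = f x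

/-- Divergence of a differentiable vector field. -/
def divergence (f : E3 → E3) (x : E3) : ℝ := ∑ j : Fin 3, (fderiv ℝ f x (e j)) j

/-- Classical gradient. -/
def grad (f : E3 → E3) (x : E3) : GradVec := WithLp.toLp 2 fun j => fderiv ℝ f x (e j)

/-- Divergence-free space-time test fields: smooth, with compact support in the case of `ℝ³`,
periodic in space in the case of the torus. -/
structure Dom.IsTest (Ω : Dom) (φ : ℝ → E3 → E3) : Prop where
  smooth : ContDiff ℝ ∞ (fun z : ℝ × E3 => φ z.1 z.2)
  div_free : ∀ t x, divergence (φ t) x = 0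
  isFunOn : ∀ t, Ω.IsFunOn (φ t)
  compact : Ω = Dom.whole → HasCompactSupport (fun z : ℝ × E3 => φ z.1 z.2)

/-- `G` is a weak (distributional) gradient of `f`. For periodic `f`, this is the gradient on the
torus. -/
structure IsWeakGrad (f : E3 → E3) (G : E3 → GradVec) : Prop where
  locInt : LocallyIntegrable f volume
  locInt_grad : LocallyIntegrable G volume
  eq : ∀ φ : E3 → ℝ, ContDiff ℝ ∞ φ → HasCompactSupport φ → ∀ j : Fin 3,
    ∫ x, fderiv ℝ φ x (e j) • f x = - ∫ x, φ x • G x j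

/-- `‖f‖₂²` on the domain. -/
def Dom.normSq (Ω : Dom) (f : E3 → E3) : ℝ≥0∞ := eLpNorm f 2 Ω.measure ^ 2

/-- `‖∇ f‖₂²` on the domain for the weak gradient (which is unique almost everywhere, so that
the infimum is over equal numbers); it is `∞` if there is no weak gradient. -/
def Dom.gradNormSq (Ω : Dom) (f : E3 → E3) : ℝ≥0∞ :=
  ⨅ (G : E3 → GradVec) (_ : IsWeakGrad f G), eLpNorm G 2 Ω.measure ^ 2

/-- `u` is a Leray–Hopf weak solution on the time interval `[0, S]` of the incompressible
Navier–Stokes equations with viscosity one, with initial datum `u 0`. -/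
structure IsLerayHopf (Ω : Dom) (S : ℝ) (u : ℝ → E3 → E3) : Prop where
  measurable : AEStronglyMeasurable (fun z : ℝ × E3 => u z.1 z.2)
    (volume.restrict (Set.Icc 0 S ×ˢ Set.univ))
  isFunOn : ∀ t ∈ Set.Icc 0 S, Ω.IsFunOn (u t)
  memLp : ∀ t ∈ Set.Icc 0 S, MemLp (u t) 2 Ω.measure
  /-- `u ∈ L^∞ L²` -/
  energy_bounded : ∃ M : ℝ≥0, ∀ t ∈ Set.Icc 0 S, Ω.normSq (u t) ≤ M
  /-- `∇ u ∈ L² L²` -/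
  dissipation_finite : ∫⁻ t in Set.Icc 0 S, Ω.gradNormSq (u t) < ⊤
  /-- `∇ · u = 0` in the sense of distributions -/
  div_free : ∀ t ∈ Set.Icc 0 S, ∀ φ : E3 → ℝ, ContDiff ℝ ∞ φ → HasCompactSupport φ →
    ∫ x, fderiv ℝ φ x (u t x) = 0
  /-- weak continuity in time with values in `L²` -/
  weak_continuous : ∀ w : E3 → E3, MemLp w 2 Ω.measure →
    ContinuousOn (fun t => ∫ x, inner ℝ (u t x) (w x) ∂Ω.measure) (Set.Icc 0 S)
  /-- the weak form of `∂ₜ u + (u · ∇) u - Δ u = - ∇ p` -/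
  weak_form : ∀ φ : ℝ → E3 → E3, Ω.IsTest φ → ∀ t ∈ Set.Icc 0 S,
    ∫ x, inner ℝ (u t x) (φ t x) ∂Ω.measure =
      ∫ x, inner ℝ (u 0 x) (φ 0 x) ∂Ω.measure +
      ∫ s in (0 : ℝ)..t, ∫ x, (inner ℝ (u s x) (deriv (fun r => φ r x) s) +
        inner ℝ (u s x) (fderiv ℝ (φ s) x (u s x)) +
        inner ℝ (u s x) (Laplacian.laplacian (φ s) x)) ∂Ω.measure
  /-- the energy inequality starting from the initial time -/
  energy_zero : ∀ t ∈ Set.Icc 0 S,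
    Ω.normSq (u t) + 2 * ∫⁻ s in Set.Icc 0 t, Ω.gradNormSq (u s) ≤ Ω.normSq (u 0)
  /-- the energy inequality starting from almost every time -/
  energy_ae : ∀ t ∈ Set.Icc 0 S, ∀ᵐ t₀ ∂(volume.restrict (Set.Icc 0 t)),
    Ω.normSq (u t) + 2 * ∫⁻ s in Set.Icc t₀ t, Ω.gradNormSq (u s) ≤ Ω.normSq (u t₀)

/-- `u` is regular on the time interval `(T', T)`: `t ↦ ‖u(t)‖_{H¹}` is finite and continuous
there. -/
structure IsRegularOn (Ω : Dom) (u : ℝ → E3 → E3) (T' T : ℝ) : Prop where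
  finite : ∀ t ∈ Set.Ioo T' T, Ω.normSq (u t) + Ω.gradNormSq (u t) < ⊤
  continuousOn : ContinuousOn (fun t => Ω.normSq (u t) + Ω.gradNormSq (u t)) (Set.Ioo T' T)

/-- The profile `χ` of a Littlewood–Paley decomposition. -/
structure IsLPProfile (χ : ℝ → ℝ) : Prop where
  smooth : ContDiff ℝ ∞ χ
  eq_one : ∀ r ≤ 3 / 4, χ r = 1
  eq_zero : ∀ r ≥ 1, χ r = 0

/-- The dyadic number `λ_q = 2^q`. -/
def lam (q : ℤ) : ℝ := (2 : ℝ) ^ q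

/-- Radial symbol of the Littlewood–Paley projection `Δ_q`, `q ≥ 0`: this is
`φ (λ_q⁻¹ r)` with `φ r = χ (r / 2) - χ r`. -/
def blockSymbol (χ : ℝ → ℝ) (q : ℕ) (r : ℝ) : ℝ :=
  χ (r / lam q / 2) - χ (r / lam q)

/-- Radial symbol of the sum of all Littlewood–Paley projections `Δ_q`, `-1 ≤ q < p`; the symbol
of `Δ_{-1}` is `χ`. -/
def belowSymbol (χ : ℝ → ℝ) (p : ℕ) (r : ℝ) : ℝ :=
  χ r + ∑ q ∈ Finset.range p, blockSymbol χ q r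

theorem belowSymbol_eq (χ : ℝ → ℝ) (p : ℕ) (r : ℝ) : belowSymbol χ p r = χ (r / lam p) := by
  induction p with
  | zero => simp [belowSymbol, lam]
  | succ n ih =>
    have h : r / lam (n + 1 : ℕ) = r / lam n / 2 := by
      rw [div_div, lam, lam, zpow_natCast, zpow_natCast, pow_succ]
    unfold belowSymbol at ih ⊢
    rw [Finset.sum_range_succ, ← add_assoc, ih, h, blockSymbol]
    ring

/-- Convolution kernel with the Fourier multiplier `belowSymbol χ p |ξ|`; the Fourier transform
is normalized with `exp (- 2 π i x · ξ)`. It is real since the symbol is even. -/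
def belowKernel (χ : ℝ → ℝ) (p : ℕ) (x : E3) : ℝ :=
  ((𝓕⁻ (fun ξ : E3 => (belowSymbol χ p ‖ξ‖ : ℂ))) x).re

/-- The low-frequency part `f_{< p}`, the sum of `f_q` over `-1 ≤ q < p`. -/
def below (χ : ℝ → ℝ) (p : ℕ) (f : E3 → E3) (x : E3) : E3 :=
  ∫ y, belowKernel χ p y • f (x - y)

/-- `f_{≤ p}`. -/
def upTo (χ : ℝ → ℝ) (p : ℕ) (f : E3 → E3) : E3 → E3 := below χ (p + 1) f

/-- The high-frequency part `f_{≥ p} = f - f_{< p}`. -/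
def above (χ : ℝ → ℝ) (p : ℕ) (f : E3 → E3) (x : E3) : E3 := f x - below χ p f x

/-- The time interval `I_q(T) = [T - λ_q⁻², T)`. -/
def timeI (T : ℝ) (q : ℤ) : Set ℝ := Set.Ico (T - (lam q ^ 2)⁻¹) T

/-- The cutoff energy `E_p(T)`. -/
def cutoffEnergy (χ : ℝ → ℝ) (Ω : Dom) (u : ℝ → E3 → E3) (T : ℝ) (p : ℕ) : ℝ≥0∞ :=
  ⨆ t ∈ timeI T p, Ω.normSq (above χ p (u t))

/-- The cutoff dissipation `D_p(T)`. -/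
def cutoffDissipation (χ : ℝ → ℝ) (Ω : Dom) (u : ℝ → E3 → E3) (T : ℝ) (p : ℕ) : ℝ≥0∞ :=
  ∫⁻ t in timeI T p, Ω.gradNormSq (above χ p (u t))

end NSE

end

/-! Put X_p = max(D_p, E_p). Everything rests on a one-step inequality X_{q+b} ≤ (A·4^{-b} +
2K·w)·X_q for b ≥ 3 and large q, where w is the integral of ‖∇u_{≤q+b}‖_∞ over I_q and A, K depend
only on χ (`cutoffMax_le`). Fix β strictly between α and 2. For b large the first coefficient is at
most ½·2^{-βb}, and for δ small the second one is too. Iteration gives X_p = O(2^{-βp}) with a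
constant depending on u; since β > α, that constant is absorbed for large p, so that C = 1 is
possible.

The step is an energy inequality for high frequencies (`energy_above`). If m is the multiplier of
u_{<p}, then (1-m)² = 1-(2m-m²), and 2m-m² is again a multiplier with an admissible profile,
`sqProfile χ`. Calling it M, one has ‖u_{≥p}‖² = ‖u‖² - ⟨u, Mu⟩, and likewise for gradients. The
low-frequency quantity ⟨u, Mu⟩ obeys an exact balance (`energy_below`). Subtracting this balance
from the Leray energy inequality leaves the energy and dissipation of u_{≥p}, with the flux ∫
(u·∇)Mu·u as the only error.

For the flux (`abs_flux_le`), split u = l + h with l = u_{<p-2}. By incompressibility and the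
location of frequencies, the terms with at most one factor h vanish or cancel. The others have two
factors h and a gradient of low frequencies; the term (l·∇)Mh·h reaches this form only through a
commutator estimate (`abs_tri_commutator_le`). Hence the flux is bounded by a constant times
‖∇u_{≤p}‖_∞ ‖u_{≥p-2}‖².

The initial energy ‖u_{≥p}(t₀)‖² is averaged over t₀ in I_q∖I_p, whose length is comparable to
λ_q^{-2}; almost every t₀ is enough. A Poincaré inequality bounds it by λ_p^{-2}‖∇u_{≥q}(t₀)‖², so
the average is of order (λ_q/λ_p)² D_q (`energy_dissipation_le`).

The rest is infrastructure. Periodic functions are convolved with Schwartz kernels over all of ℝ³,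
so both domains are treated alike. The weak formulation has to be extended from test fields to
low-frequency fields; on ℝ³ this uses density of compactly supported solenoidal fields
(`exists_test_seq`). -/

noncomputable section

namespace NSE

open scoped LineDeriv SchwartzMap

/-! ### Fundamental domains, periodicity and translation invariance -/

section Domain

/-- The standard basis of `E3`. -/
def stdBasis : Module.Basis (Fin 3) ℝ E3 := (EuclideanSpace.basisFun (Fin 3) ℝ).toBasis

theorem stdBasis_apply (j : Fin 3) : stdBasis j = e j := by
  simp [stdBasis, e]

theorem cell_torus_eq : Dom.torus.cell = ZSpan.fundamentalDomain stdBasis := by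
  ext x
  simp [Dom.cell, ZSpan.mem_fundamentalDomain, stdBasis]

theorem measurableSet_cell (Ω : Dom) : MeasurableSet Ω.cell := by
  cases Ω with
  | whole => exact MeasurableSet.univ
  | torus => rw [cell_torus_eq]; exact ZSpan.fundamentalDomain_measurableSet _

/-- The integer lattice in `E3`. -/
abbrev lattice : Submodule ℤ E3 := Submodule.span ℤ (Set.range stdBasis)

instance : Countable lattice.toAddSubgroup :=
  inferInstanceAs (Countable (Submodule.span ℤ (Set.range stdBasis)))

theorem isAddFundamentalDomain_cell :
    IsAddFundamentalDomain lattice.toAddSubgroup Dom.torus.cell volume := by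
  rw [cell_torus_eq]
  exact ZSpan.isAddFundamentalDomain' _ _

theorem periodic_of_mem_lattice {F : Type*} {f : E3 → F} (hf : Dom.torus.IsFunOn f) {g : E3}
    (hg : g ∈ lattice) : ∀ x, f (g + x) = f x := by
  refine Submodule.span_induction (p := fun g _ => ∀ x, f (g + x) = f x) ?_ ?_ ?_ ?_ hg
  · rintro _ ⟨j, rfl⟩ x
    rw [stdBasis_apply, add_comm]
    exact hf j x
  · simp
  · intro a b _ _ ha hb x
    rw [add_assoc, ha, hb]
  · intro n a _ ha x
    have hnat : ∀ (m : ℕ) x, f ((m : ℤ) • a + x) = f x := by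
      intro m
      induction m with
      | zero => simp
      | succ m ih =>
        intro x
        have : (((m + 1 : ℕ) : ℤ) • a + x) = (m : ℤ) • a + (a + x) := by
          push_cast; rw [add_smul, one_smul, add_assoc]
        rw [this, ih, ha]
    obtain ⟨m, rfl | rfl⟩ := n.eq_nat_or_neg
    · exact hnat m x
    · have := hnat m ((-(m : ℤ)) • a + x)
      rw [← add_assoc, ← add_smul, add_neg_cancel, zero_smul, zero_add] at this
      exact this.symm

theorem vadd_lattice {F : Type*} {f : E3 → F} (hf : Dom.torus.IsFunOn f)
    (g : lattice.toAddSubgroup) (x : E3) : f (g +ᵥ x) = f x := by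
  exact periodic_of_mem_lattice hf g.2 x

open scoped Pointwise in
theorem isAddFundamentalDomain_translate (y : E3) :
    IsAddFundamentalDomain lattice.toAddSubgroup ((fun x => x - y) ⁻¹' Dom.torus.cell) volume := by
  have h : (fun x => x - y) ⁻¹' Dom.torus.cell = y +ᵥ Dom.torus.cell := by
    ext x
    simp [Set.mem_vadd_set_iff_neg_vadd_mem, sub_eq_neg_add]
  rw [h]
  exact isAddFundamentalDomain_cell.vadd_of_comm y

theorem Dom.IsFunOn.comp {Ω : Dom} {F G : Type*} {f : E3 → F} (hf : Ω.IsFunOn f) (g : F → G) :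
    Ω.IsFunOn (fun x => g (f x)) := by
  cases Ω with
  | whole => trivial
  | torus => intro j x; simp only [hf j x]

theorem Dom.IsFunOn.comp₂ {Ω : Dom} {F G H : Type*} {f : E3 → F} {f' : E3 → G} (hf : Ω.IsFunOn f)
    (hf' : Ω.IsFunOn f') (g : F → G → H) : Ω.IsFunOn (fun x => g (f x) (f' x)) := by
  cases Ω with
  | whole => trivial
  | torus => intro j x; simp only [hf j x, hf' j x]

theorem Dom.IsFunOn.sub_right {Ω : Dom} {F : Type*} {f : E3 → F} (hf : Ω.IsFunOn f) (y : E3) :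
    Ω.IsFunOn (fun x => f (x - y)) := by
  cases Ω with
  | whole => trivial
  | torus => intro j x; simp only [add_sub_right_comm]; exact hf j _

theorem Dom.isFunOn_const (Ω : Dom) {F : Type*} (c : F) : Ω.IsFunOn (fun _ => c) := by
  cases Ω with
  | whole => trivial
  | torus => intro j x; rfl

/-- On the torus, the cell and its translate are both fundamental domains of the lattice, and a
periodic function has the same integral over either. This invariance lets ℝ³ and 𝕋³ share the later
proofs. -/
theorem lintegral_comp_sub {Ω : Dom} {f : E3 → ℝ≥0∞} (hf : Ω.IsFunOn f) (y : E3) :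
    ∫⁻ x, f (x - y) ∂Ω.measure = ∫⁻ x, f x ∂Ω.measure := by
  cases Ω with
  | whole => simpa [Dom.measure, Dom.cell] using lintegral_sub_right_eq_self f y
  | torus =>
    have h1 := (measurePreserving_sub_right (volume : Measure E3) y).setLIntegral_comp_preimage_emb
      (measurableEmbedding_subRight y) f Dom.torus.cell
    rw [Dom.measure, ← h1]
    exact isAddFundamentalDomain_cell.setLIntegral_eq (isAddFundamentalDomain_translate y) _
      (fun g x => vadd_lattice (hf.sub_right y) g x)

theorem integral_comp_sub {Ω : Dom} {F : Type*} [NormedAddCommGroup F] [NormedSpace ℝ F]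
    {f : E3 → F} (hf : Ω.IsFunOn f) (y : E3) :
    ∫ x, f (x - y) ∂Ω.measure = ∫ x, f x ∂Ω.measure := by
  cases Ω with
  | whole => simpa [Dom.measure, Dom.cell] using integral_sub_right_eq_self f y
  | torus =>
    have h1 := (measurePreserving_sub_right (volume : Measure E3) y).setIntegral_preimage_emb
      (measurableEmbedding_subRight y) f Dom.torus.cell
    rw [Dom.measure, ← h1]
    exact isAddFundamentalDomain_cell.setIntegral_eq (isAddFundamentalDomain_translate y)
      (fun g x => vadd_lattice (hf.sub_right y) g x)

theorem iUnion_translate_cell :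
    ⋃ g : lattice.toAddSubgroup, ((fun x : E3 => (g : E3) + x) ⁻¹' Dom.torus.cell) = Set.univ := by
  refine Set.eq_univ_of_forall fun x => ?_
  rw [cell_torus_eq]
  obtain ⟨g, hg, -⟩ := ZSpan.exist_unique_vadd_mem_fundamentalDomain stdBasis x
  exact Set.mem_iUnion.2 ⟨⟨g.1, g.2⟩, hg⟩

/-- A property that holds a.e. on the cell holds a.e. on the whole space if it is periodic. -/
theorem ae_of_ae_measure {Ω : Dom} {P : E3 → Prop} (hP : Ω.IsFunOn P)
    (h : ∀ᵐ x ∂Ω.measure, P x) : ∀ᵐ x, P x := by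
  cases Ω with
  | whole => simpa [Dom.measure, Dom.cell] using h
  | torus =>
    rw [← Measure.restrict_univ (μ := volume), ← iUnion_translate_cell, ae_restrict_iUnion_eq,
      eventually_iSup]
    intro g
    have hmp := (measurePreserving_add_left (volume : Measure E3) (g : E3)).restrict_preimage
      (measurableSet_cell .torus)
    filter_upwards [hmp.quasiMeasurePreserving.ae h] with x hx
    rwa [periodic_of_mem_lattice hP g.2] at hx

/-- Countably many lattice translates of the cell cover the space. The passage is needed because
kernels integrate over all of ℝ³ while norms see one cell only. -/
theorem aestronglyMeasurable_volume {Ω : Dom} {F : Type*} [TopologicalSpace F]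
    [TopologicalSpace.PseudoMetrizableSpace F]
    {f : E3 → F} (hf : Ω.IsFunOn f) (h : AEStronglyMeasurable f Ω.measure) :
    AEStronglyMeasurable f volume := by
  cases Ω with
  | whole => simpa [Dom.measure, Dom.cell] using h
  | torus =>
    rw [← Measure.restrict_univ (μ := volume), ← iUnion_translate_cell,
      aestronglyMeasurable_iUnion_iff]
    intro g
    have hmp := (measurePreserving_add_left (volume : Measure E3) (g : E3)).restrict_preimage
      (measurableSet_cell .torus)
    refine (h.comp_quasiMeasurePreserving hmp.quasiMeasurePreserving).congr ?_
    exact Eventually.of_forall fun x => periodic_of_mem_lattice hf g.2 x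

theorem measure_ne_zero (Ω : Dom) : Ω.measure ≠ 0 := by
  cases Ω with
  | whole => simpa [Dom.measure, Dom.cell] using NeZero.ne (volume : Measure E3)
  | torus =>
    intro h
    have h1 : ∀ᵐ x ∂Dom.torus.measure, False := by simp [h]
    have h2 := ae_of_ae_measure (Dom.isFunOn_const _ False) h1
    exact h2.exists.elim fun _ h => h

instance (Ω : Dom) : SigmaFinite Ω.measure := by unfold Dom.measure; infer_instance

theorem measure_absolutelyContinuous (Ω : Dom) : Ω.measure ≪ volume :=
  Measure.restrict_le_self.absolutelyContinuous

end Domain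

/-! ### Square integrable functions on the domain -/

/-- Square integrable functions on the domain. -/
structure L2On {F : Type*} [NormedAddCommGroup F] (Ω : Dom) (f : E3 → F) : Prop where
  isFunOn : Ω.IsFunOn f
  memLp : MemLp f 2 Ω.measure

section L2

variable {Ω : Dom} {F G : Type*} [NormedAddCommGroup F] [NormedAddCommGroup G]

theorem L2On.aestronglyMeasurable {f : E3 → F} (hf : L2On Ω f) : AEStronglyMeasurable f volume :=
  aestronglyMeasurable_volume hf.isFunOn hf.memLp.1

theorem L2On.add {f g : E3 → F} (hf : L2On Ω f) (hg : L2On Ω g) : L2On Ω (fun x => f x + g x) :=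
  ⟨hf.isFunOn.comp₂ hg.isFunOn _, hf.memLp.add hg.memLp⟩

theorem L2On.sub {f g : E3 → F} (hf : L2On Ω f) (hg : L2On Ω g) : L2On Ω (fun x => f x - g x) :=
  ⟨hf.isFunOn.comp₂ hg.isFunOn _, hf.memLp.sub hg.memLp⟩

theorem L2On.zero : L2On Ω (fun _ => (0 : F)) := ⟨Ω.isFunOn_const _, MemLp.zero⟩

theorem L2On.sum {ι : Type*} {s : Finset ι} {f : ι → E3 → F} (hf : ∀ i, L2On Ω (f i)) :
    L2On Ω (fun x => ∑ i ∈ s, f i x) := by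
  classical
  induction s using Finset.induction_on with
  | empty => simpa using L2On.zero
  | insert a s ha ih => simpa [Finset.sum_insert ha] using (hf a).add ih

theorem L2On.norm {f : E3 → F} (hf : L2On Ω f) : L2On Ω (fun x => ‖f x‖) :=
  ⟨hf.isFunOn.comp _, hf.memLp.norm⟩

theorem L2On.sub_right {f : E3 → F} (hf : L2On Ω f) (y : E3) : L2On Ω (fun x => f (x - y)) := by
  refine ⟨hf.isFunOn.sub_right y, ?_, ?_⟩
  · have := hf.aestronglyMeasurable.comp_measurePreserving
      (measurePreserving_sub_right (volume : Measure E3) y)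
    exact this.mono_ac (measure_absolutelyContinuous Ω)
  · have h2 := hf.memLp.2
    rw [eLpNorm_lt_top_iff_lintegral_rpow_enorm_lt_top two_ne_zero ENNReal.ofNat_ne_top] at h2 ⊢
    rwa [lintegral_comp_sub (f := fun x => ‖f x‖ₑ ^ (2 : ℝ≥0∞).toReal) (hf.isFunOn.comp fun z => ‖z‖ₑ ^ (2 : ℝ≥0∞).toReal)]

/-- The squared norm as a lower integral. -/
theorem eLpNorm_two_sq {α : Type*} [MeasurableSpace α] (μ : Measure α) (f : α → F) :
    eLpNorm f 2 μ ^ 2 = ∫⁻ x, ‖f x‖ₑ ^ 2 ∂μ := by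
  have := eLpNorm_nnreal_pow_eq_lintegral (μ := μ) (f := f) (p := 2) two_ne_zero
  simpa using this

/-- The norm of `L²` of the domain, as a real number. -/
def l2 (Ω : Dom) (f : E3 → F) : ℝ := (eLpNorm f 2 Ω.measure).toReal

theorem l2_nonneg (f : E3 → F) : 0 ≤ l2 Ω f := ENNReal.toReal_nonneg

theorem L2On.ofReal_l2 {f : E3 → F} (hf : L2On Ω f) :
    ENNReal.ofReal (l2 Ω f) = eLpNorm f 2 Ω.measure := ENNReal.ofReal_toReal hf.memLp.2.ne

theorem L2On.integrable_sq {f : E3 → F} (hf : L2On Ω f) :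
    Integrable (fun x => ‖f x‖ ^ 2) Ω.measure := hf.memLp.norm.integrable_sq

theorem L2On.l2_sq {f : E3 → F} (hf : L2On Ω f) : l2 Ω f ^ 2 = ∫ x, ‖f x‖ ^ 2 ∂Ω.measure := by
  rw [l2, ← ENNReal.toReal_pow, eLpNorm_two_sq, integral_eq_lintegral_of_nonneg_ae]
  · congr 1
    refine lintegral_congr fun x => ?_
    rw [← ofReal_norm, ENNReal.ofReal_pow (norm_nonneg _)]
  · exact Eventually.of_forall fun x => by positivity
  · exact hf.integrable_sq.1

theorem L2On.integrable_mul {f : E3 → F} {g : E3 → G} (hf : L2On Ω f) (hg : L2On Ω g) :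
    Integrable (fun x => ‖f x‖ * ‖g x‖) Ω.measure :=
  hf.memLp.norm.integrable_mul hg.memLp.norm

theorem L2On.integral_mul_le {f : E3 → F} {g : E3 → G} (hf : L2On Ω f) (hg : L2On Ω g) :
    ∫ x, ‖f x‖ * ‖g x‖ ∂Ω.measure ≤ l2 Ω f * l2 Ω g := by
  have h := integral_mul_norm_le_Lp_mul_Lq (μ := Ω.measure) (f := fun x => ‖f x‖)
    (g := fun x => ‖g x‖) (p := 2) (q := 2) Real.HolderConjugate.two_two
    (by simpa using hf.memLp.norm) (by simpa using hg.memLp.norm)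
  simp only [norm_norm] at h
  refine h.trans (le_of_eq ?_)
  have h1 : ∀ {H : Type _} [NormedAddCommGroup H] {k : E3 → H}, L2On Ω k →
      (∫ x, ‖k x‖ ^ (2 : ℝ) ∂Ω.measure) ^ (1 / 2 : ℝ) = l2 Ω k := by
    intro H _ k hk
    simp only [Real.rpow_two]
    rw [← hk.l2_sq, ← Real.sqrt_eq_rpow, Real.sqrt_sq (l2_nonneg _)]
  rw [h1 hf, ← Real.sqrt_eq_rpow]
  simp only [Real.rpow_two]
  rw [← hg.l2_sq, Real.sqrt_sq (l2_nonneg _)]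

theorem L2On.l2_add_le {f g : E3 → F} (hf : L2On Ω f) (hg : L2On Ω g) :
    l2 Ω (fun x => f x + g x) ≤ l2 Ω f + l2 Ω g := by
  rw [l2, l2, l2, ← ENNReal.toReal_add hf.memLp.2.ne hg.memLp.2.ne]
  exact ENNReal.toReal_mono (ENNReal.add_ne_top.2 ⟨hf.memLp.2.ne, hg.memLp.2.ne⟩)
    (eLpNorm_add_le hf.memLp.1 hg.memLp.1 (by norm_num))

theorem L2On.l2_sub_le {f g : E3 → F} (hf : L2On Ω f) (hg : L2On Ω g) :
    l2 Ω (fun x => f x - g x) ≤ l2 Ω f + l2 Ω g := by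
  rw [l2, l2, l2, ← ENNReal.toReal_add hf.memLp.2.ne hg.memLp.2.ne]
  exact ENNReal.toReal_mono (ENNReal.add_ne_top.2 ⟨hf.memLp.2.ne, hg.memLp.2.ne⟩)
    (eLpNorm_sub_le hf.memLp.1 hg.memLp.1 (by norm_num))

theorem L2On.l2_sum_le {ι : Type*} {s : Finset ι} {f : ι → E3 → F} (hf : ∀ i, L2On Ω (f i)) :
    l2 Ω (fun x => ∑ i ∈ s, f i x) ≤ ∑ i ∈ s, l2 Ω (f i) := by
  classical
  induction s using Finset.induction_on with
  | empty => simp [l2, eLpNorm_zero']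
  | insert a s ha ih =>
    simp only [Finset.sum_insert ha]
    exact ((hf a).l2_add_le (L2On.sum hf)).trans (by gcongr)

theorem L2On.of_le {f : E3 → F} {g : E3 → G} (hg : L2On Ω g) (hf : Ω.IsFunOn f)
    (hm : AEStronglyMeasurable f Ω.measure) {C : ℝ} (h : ∀ x, ‖f x‖ ≤ C * ‖g x‖) :
    L2On Ω f :=
  ⟨hf, hg.memLp.of_le_mul hm (Eventually.of_forall h)⟩

theorem L2On.l2_norm (f : E3 → F) : l2 Ω (fun x => ‖f x‖) = l2 Ω f := by
  rw [l2, l2, eLpNorm_norm]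

theorem L2On.l2_sub_right {f : E3 → F} (hf : L2On Ω f) (y : E3) :
    l2 Ω (fun x => f (x - y)) = l2 Ω f := by
  rw [← sq_eq_sq₀ (l2_nonneg _) (l2_nonneg _), hf.l2_sq, (hf.sub_right y).l2_sq]
  exact integral_comp_sub (f := fun x => ‖f x‖ ^ 2) (hf.isFunOn.comp fun z => ‖z‖ ^ 2) y

theorem L2On.integrable_inner [InnerProductSpace ℝ F] {f g : E3 → F} (hf : L2On Ω f)
    (hg : L2On Ω g) : Integrable (fun x => inner ℝ (f x) (g x)) Ω.measure := by
  refine (hf.integrable_mul hg).mono' (hf.memLp.1.inner hg.memLp.1) ?_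
  exact Eventually.of_forall fun x => norm_inner_le_norm _ _

theorem L2On.abs_integral_inner_le [InnerProductSpace ℝ F] {f g : E3 → F} (hf : L2On Ω f)
    (hg : L2On Ω g) : |∫ x, inner ℝ (f x) (g x) ∂Ω.measure| ≤ l2 Ω f * l2 Ω g := by
  refine le_trans ?_ (hf.integral_mul_le hg)
  rw [← Real.norm_eq_abs]
  refine norm_integral_le_of_norm_le (hf.integrable_mul hg) ?_
  exact Eventually.of_forall fun x => norm_inner_le_norm _ _

end L2

/-! ### A polynomial weight dominating Schwartz kernels -/

section Weight

/-- An integrable polynomial weight. -/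
def wt (y : E3) : ℝ := ((1 + ‖y‖) ^ 4)⁻¹

theorem wt_pos (y : E3) : 0 < wt y := by unfold wt; positivity

theorem continuous_wt : Continuous wt := by
  unfold wt
  exact Continuous.inv₀ (by fun_prop) fun x => by positivity

theorem integrable_wt : Integrable wt := by
  -- The exponent 4 exceeds the dimension 3.
  have h := integrable_one_add_norm (E := E3) (μ := volume) (r := 4) (by simp; norm_num)
  refine h.congr (Eventually.of_forall fun x => ?_)
  simp only [wt]
  rw [Real.rpow_neg (by positivity)]
  norm_cast

/-- A Peetre-type inequality: moving the centre of the weight costs a polynomial factor in the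
displacement. It yields one dominating function for all centres in a unit ball and carries
integrability from one centre to any other. -/
theorem wt_sub_le (x x' y : E3) : wt (x - y) ≤ (1 + ‖x - x'‖) ^ 4 * wt (x' - y) := by
  unfold wt
  rw [← div_eq_mul_inv, ← one_div, div_le_div_iff₀ (by positivity) (by positivity), one_mul,
    ← mul_pow]
  gcongr
  have h : ‖x' - y‖ ≤ ‖x - x'‖ + ‖x - y‖ := by
    have := norm_sub_le (x - y) (x - x')
    rw [show x - y - (x - x') = x' - y by abel] at this
    linarith
  nlinarith [norm_nonneg (x - x'), norm_nonneg (x - y)]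

/-- Continuous functions with a fast decay. -/
structure Rapid (k : E3 → ℝ) : Prop where
  continuous : Continuous k
  bound : ∃ C, 0 ≤ C ∧ ∀ y, ‖k y‖ ≤ C * wt y

theorem rapid_wt : Rapid wt :=
  ⟨continuous_wt, 1, zero_le_one, fun y => by
    rw [one_mul, Real.norm_of_nonneg (wt_pos y).le]⟩

variable {k : E3 → ℝ}

theorem Rapid.integrable (hk : Rapid k) : Integrable k := by
  obtain ⟨C, -, h⟩ := hk.bound
  exact (integrable_wt.const_mul C).mono' hk.continuous.aestronglyMeasurable
    (Eventually.of_forall h)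

theorem Rapid.norm (hk : Rapid k) : Rapid (fun y => ‖k y‖) := by
  obtain ⟨C, h0, h⟩ := hk.bound
  exact ⟨hk.continuous.norm, C, h0, fun y => by simpa using h y⟩

theorem Rapid.comp_neg (hk : Rapid k) : Rapid (fun y => k (-y)) := by
  obtain ⟨C, h0, h⟩ := hk.bound
  exact ⟨hk.continuous.comp continuous_neg, C, h0, fun y => by simpa [wt] using h (-y)⟩

theorem schwartz_exists_le_wt {V : Type*} [NormedAddCommGroup V] [NormedSpace ℝ V]
    (k : 𝓢(E3, V)) : ∃ C, 0 ≤ C ∧ ∀ y, ‖k y‖ ≤ C * wt y := by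
  refine ⟨2 ^ 4 * ((Finset.Iic (4, 0)).sup fun m => SchwartzMap.seminorm ℝ m.1 m.2) k,
    by positivity, fun y => ?_⟩
  have h := SchwartzMap.one_add_le_sup_seminorm_apply (𝕜 := ℝ) (m := (4, 0)) (k := 4) (n := 0)
    le_rfl le_rfl k y
  rw [norm_iteratedFDeriv_zero] at h
  rw [wt, ← div_eq_mul_inv, le_div_iff₀ (by positivity), mul_comm]
  exact h

theorem rapid_schwartz (k : 𝓢(E3, ℝ)) : Rapid k := ⟨k.continuous, schwartz_exists_le_wt k⟩

end Weight

/-! ### Convolution of rapidly decaying kernels with L² functions -/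

section Conv

variable {Ω : Dom} {F : Type*} [NormedAddCommGroup F] [NormedSpace ℝ F] {k k₁ k₂ : E3 → ℝ}
  {f g : E3 → F}

theorem aestronglyMeasurable_sub {G : Type*} [TopologicalSpace G]
    [TopologicalSpace.PseudoMetrizableSpace G] {f : E3 → G} (hf : AEStronglyMeasurable f volume)
    (Ω : Dom) : AEStronglyMeasurable (fun p : E3 × E3 => f (p.1 - p.2)) (Ω.measure.prod volume) :=
  (hf.comp_quasiMeasurePreserving
    (quasiMeasurePreserving_sub (volume : Measure E3) (volume : Measure E3))).mono_ac
    ((measure_absolutelyContinuous Ω).prod Measure.AbsolutelyContinuous.rfl)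

-- On the torus `f` is not in L² of ℝ³, so Cauchy–Schwarz over ℝ³ is not available. Instead, Tonelli
-- and translation invariance show that the weighted integral of |f|² is finite for almost every
-- centre; one such centre is chosen, |f| is dominated by 1 + |f|², and `wt_sub_le` moves the centre
-- to `x`.
omit [NormedSpace ℝ F] in
theorem L2On.integrable_wt_sub {f : E3 → F} (hf : L2On Ω f) (x : E3) :
    Integrable (fun y => wt (x - y) * ‖f y‖) := by
  have hm0 : AEMeasurable (fun p : E3 × E3 => ENNReal.ofReal (wt p.2) * ‖f (p.1 - p.2)‖ₑ ^ 2)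
      (Ω.measure.prod volume) :=
    AEMeasurable.mul
      (f := fun p : E3 × E3 => ENNReal.ofReal (wt p.2)) (g := fun p => ‖f (p.1 - p.2)‖ₑ ^ 2)
      ((continuous_wt.comp continuous_snd).measurable.ennreal_ofReal).aemeasurable
      ((aestronglyMeasurable_sub hf.aestronglyMeasurable Ω).enorm.pow_const 2)
  have hfin : ∫⁻ x, (∫⁻ y, ENNReal.ofReal (wt y) * ‖f (x - y)‖ₑ ^ 2) ∂Ω.measure < ⊤ := by
    rw [lintegral_lintegral_swap]
    · have h1 : ∀ y, ∫⁻ x, ENNReal.ofReal (wt y) * ‖f (x - y)‖ₑ ^ 2 ∂Ω.measure =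
          ENNReal.ofReal (wt y) * eLpNorm f 2 Ω.measure ^ 2 := by
        intro y
        rw [lintegral_const_mul' _ _ ENNReal.ofReal_ne_top, eLpNorm_two_sq,
          lintegral_comp_sub (f := fun x => ‖f x‖ₑ ^ 2) (hf.isFunOn.comp fun z => ‖z‖ₑ ^ 2)]
      simp only [h1]
      rw [lintegral_mul_const' _ _ (ENNReal.pow_ne_top hf.memLp.2.ne)]
      refine ENNReal.mul_lt_top ?_ (ENNReal.pow_lt_top hf.memLp.2)
      exact integrable_wt.lintegral_lt_top
    · exact hm0
  have hae : ∀ᵐ x ∂Ω.measure, ∫⁻ y, ENNReal.ofReal (wt y) * ‖f (x - y)‖ₑ ^ 2 < ⊤ := by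
    refine ae_lt_top' ?_ hfin.ne
    exact hm0.lintegral_prod_right'
  have : NeZero Ω.measure := ⟨measure_ne_zero Ω⟩
  obtain ⟨x₀, hx₀⟩ := hae.exists
  have hm : ∀ x : E3, AEStronglyMeasurable (fun y => f (x - y)) volume := fun x =>
    hf.aestronglyMeasurable.comp_measurePreserving (Measure.measurePreserving_sub_left volume x)
  have h1 : Integrable (fun y => wt y * ‖f (x₀ - y)‖ ^ 2) := by
    refine ⟨continuous_wt.aestronglyMeasurable.mul ((hm x₀).norm.pow 2), ?_⟩
    rw [hasFiniteIntegral_iff_enorm]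
    refine lt_of_le_of_lt (lintegral_mono fun y => ?_) hx₀
    rw [enorm_mul, Real.enorm_of_nonneg (wt_pos y).le, enorm_pow, enorm_norm]
  have h2 : Integrable (fun y => wt y * ‖f (x₀ - y)‖) := by
    refine (integrable_wt.add h1).mono' (continuous_wt.aestronglyMeasurable.mul (hm x₀).norm)
      (Eventually.of_forall fun y => ?_)
    have hw := wt_pos y
    rw [Real.norm_of_nonneg (by positivity)]
    simp only [Pi.add_apply]
    nlinarith [sq_nonneg (‖f (x₀ - y)‖ - 1), mul_nonneg hw.le (sq_nonneg (‖f (x₀ - y)‖ - 1)),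
      mul_nonneg hw.le (sq_nonneg (‖f (x₀ - y)‖))]
  have h3 : Integrable (fun y => wt (x₀ - y) * ‖f y‖) := by
    simpa using h2.comp_sub_left x₀
  refine (h3.const_mul ((1 + ‖x - x₀‖) ^ 4)).mono'
    (((continuous_wt.comp (continuous_const.sub continuous_id)).aestronglyMeasurable).mul
      hf.aestronglyMeasurable.norm) (Eventually.of_forall fun y => ?_)
  have hw := wt_pos (x - y)
  rw [Real.norm_of_nonneg (by positivity), ← mul_assoc]
  exact mul_le_mul_of_nonneg_right (wt_sub_le x x₀ y) (norm_nonneg _)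

omit [NormedSpace ℝ F] in
theorem L2On.integrable_smul_of_le {V W : Type*} [NormedAddCommGroup V] [NormedAddCommGroup W]
    (hf : L2On Ω f) (x : E3) {K : E3 → V} {B : E3 → W} {C : ℝ} (hK : ∀ y, ‖K y‖ ≤ C * wt y)
    (hm : AEStronglyMeasurable B volume) (hB : ∀ y, ‖B y‖ ≤ ‖K (x - y)‖ * ‖f y‖) :
    Integrable B := by
  refine ((hf.integrable_wt_sub x).const_mul C).mono' hm (Eventually.of_forall fun y => ?_)
  refine (hB y).trans ?_
  rw [← mul_assoc]
  exact mul_le_mul_of_nonneg_right (hK _) (norm_nonneg _)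

theorem L2On.integrable_rapid_sub (hf : L2On Ω f) (hk : Rapid k) (x : E3) :
    Integrable (fun y => k (x - y) • f y) := by
  obtain ⟨C, -, h⟩ := hk.bound
  refine hf.integrable_smul_of_le x h
    (((hk.continuous.comp (continuous_const.sub continuous_id)).aestronglyMeasurable).smul
      hf.aestronglyMeasurable) fun y => (norm_smul _ _).le

theorem L2On.integrable_rapid (hf : L2On Ω f) (hk : Rapid k) (x : E3) :
    Integrable (fun y => k y • f (x - y)) := by
  simpa using (hf.integrable_rapid_sub hk x).comp_sub_left x

/-- Convolution with a kernel. -/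
def conv (k : E3 → ℝ) (f : E3 → F) (x : E3) : F := ∫ y, k y • f (x - y)

theorem conv_eq (k : E3 → ℝ) (f : E3 → F) (x : E3) : conv k f x = ∫ y, k (x - y) • f y := by
  have := integral_sub_left_eq_self (fun y => k (x - y) • f y) volume x
  simpa [conv] using this

theorem conv_isFunOn (hf : Ω.IsFunOn f) : Ω.IsFunOn (conv k f) := by
  cases Ω with
  | whole => trivial
  | torus =>
    intro j x
    simp only [conv]
    congr 1
    ext y
    rw [add_sub_right_comm, hf j]

theorem continuous_conv (hk : Rapid k) (hf : L2On Ω f) : Continuous (conv k f) := by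
  rw [continuous_iff_continuousAt]
  intro x₀
  obtain ⟨C, hC, h⟩ := hk.bound
  rw [show conv k f = fun x => ∫ y, k (x - y) • f y from funext (conv_eq k f)]
  refine continuousAt_of_dominated (bound := fun y => C * (2 ^ 4 * (wt (x₀ - y) * ‖f y‖))) ?_ ?_
    (((hf.integrable_wt_sub x₀).const_mul _).const_mul _) ?_
  · exact Eventually.of_forall fun x => (hf.integrable_rapid_sub hk x).1
  · filter_upwards [Metric.ball_mem_nhds x₀ one_pos] with x hx
    refine Eventually.of_forall fun y => ?_
    rw [norm_smul, ← mul_assoc (2 ^ 4), ← mul_assoc C]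
    refine mul_le_mul_of_nonneg_right ((h _).trans ?_) (norm_nonneg _)
    refine mul_le_mul_of_nonneg_left ((wt_sub_le x x₀ y).trans ?_) hC
    refine mul_le_mul_of_nonneg_right ?_ (wt_pos _).le
    have := (mem_ball_iff_norm.1 hx).le
    gcongr
    linarith
  · refine Eventually.of_forall fun y => ContinuousAt.smul ?_ continuousAt_const
    exact (hk.continuous.comp (continuous_id.sub continuous_const)).continuousAt

/-- Minkowski's inequality for a weighted family of functions. -/
theorem lintegral_sq_lintegral_le {α β : Type*} [MeasurableSpace α] [MeasurableSpace β]
    {μ : Measure α} {ν : Measure β} [SFinite μ] [SFinite ν] {a : β → ℝ≥0∞} {Φ : α × β → ℝ≥0∞}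
    {c : ℝ≥0∞} (ha : AEMeasurable a ν) (hm : AEMeasurable Φ (μ.prod ν))
    (hΦ : ∀ y, ∫⁻ x, Φ (x, y) ^ 2 ∂μ ≤ c) :
    ∫⁻ x, (∫⁻ y, a y * Φ (x, y) ∂ν) ^ 2 ∂μ ≤ (∫⁻ y, a y ∂ν) ^ 2 * c := by
  -- Cauchy–Schwarz, with the weight split as a = √a·√a.
  have key : ∀ᵐ x ∂μ, (∫⁻ y, a y * Φ (x, y) ∂ν) ^ 2 ≤
      (∫⁻ y, a y ∂ν) * ∫⁻ y, a y * Φ (x, y) ^ 2 ∂ν := by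
    filter_upwards [hm.aestronglyMeasurable.prodMk_left] with x hx
    have hH := ENNReal.lintegral_mul_le_Lp_mul_Lq ν Real.HolderConjugate.two_two
      (f := fun y => a y ^ (1 / 2 : ℝ)) (g := fun y => a y ^ (1 / 2 : ℝ) * Φ (x, y))
      (ha.pow_const _) ((ha.pow_const _).mul hx.aemeasurable)
    have e1 : ∀ z : ℝ≥0∞, (z ^ (1 / 2 : ℝ)) ^ 2 = z := fun z => by
      rw [← ENNReal.rpow_natCast, ← ENNReal.rpow_mul]; norm_num
    have e2 : ∀ z : ℝ≥0∞, z ^ (1 / 2 : ℝ) * z ^ (1 / 2 : ℝ) = z := fun z => by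
      rw [← sq, e1]
    simp only [Pi.mul_apply, ← mul_assoc, e2, ENNReal.rpow_two, e1, mul_pow] at hH
    calc _ ≤ _ := pow_le_pow_left' hH 2
      _ = _ := by rw [mul_pow, e1, e1]
  refine (lintegral_mono_ae key).trans ?_
  have hma : AEMeasurable (fun p : α × β => a p.2 * Φ p ^ 2) (μ.prod ν) :=
    (ha.comp_quasiMeasurePreserving Measure.quasiMeasurePreserving_snd).mul (hm.pow_const 2)
  rw [lintegral_const_mul'' _ hma.lintegral_prod_right', sq, mul_assoc]
  gcongr
  rw [lintegral_lintegral_swap hma]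
  rw [← lintegral_mul_const'' c ha]
  refine lintegral_mono_ae ?_
  filter_upwards [hm.aestronglyMeasurable.prod_swap.prodMk_left] with y hy
  have hy' : AEMeasurable (fun x => Φ (x, y)) μ := hy.aemeasurable
  rw [lintegral_const_mul'' _ (hy'.pow_const 2)]
  gcongr
  exact hΦ y

/-- Young's inequality for L¹ and L²: Minkowski in the kernel variable, all translates of `f` having
the same norm. The kernel stays on ℝ³ also for the torus, so no periodization is needed. -/
theorem L2On.conv (hf : L2On Ω f) (hk : Rapid k) : L2On Ω (conv k f) ∧
    l2 Ω (conv k f) ≤ (∫ y, ‖k y‖) * l2 Ω f := by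
  have hm : AEMeasurable (fun p : E3 × E3 => ‖f (p.1 - p.2)‖ₑ) (Ω.measure.prod volume) :=
    (aestronglyMeasurable_sub hf.aestronglyMeasurable Ω).enorm
  have h1 : eLpNorm (NSE.conv k f) 2 Ω.measure ^ 2 ≤
      (∫⁻ y, ‖k y‖ₑ) ^ 2 * eLpNorm f 2 Ω.measure ^ 2 := by
    rw [eLpNorm_two_sq]
    refine le_trans (lintegral_mono fun x => ?_) (lintegral_sq_lintegral_le (c :=
      eLpNorm f 2 Ω.measure ^ 2) hk.continuous.measurable.enorm.aemeasurable hm fun y => ?_)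
    · refine pow_le_pow_left' ?_ 2
      refine (enorm_integral_le_lintegral_enorm _).trans (lintegral_mono fun y => ?_)
      rw [enorm_smul]
    · rw [eLpNorm_two_sq, lintegral_comp_sub (f := fun x => ‖f x‖ₑ ^ 2)
        (hf.isFunOn.comp fun z => ‖z‖ₑ ^ 2)]
  have h2 : eLpNorm (NSE.conv k f) 2 Ω.measure ≤ (∫⁻ y, ‖k y‖ₑ) * eLpNorm f 2 Ω.measure := by
    rw [← mul_pow] at h1
    exact (ENNReal.pow_le_pow_left_iff two_ne_zero).1 h1
  have hfin : (∫⁻ y, ‖k y‖ₑ) * eLpNorm f 2 Ω.measure < ⊤ :=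
    ENNReal.mul_lt_top hk.integrable.2 hf.memLp.2
  refine ⟨⟨conv_isFunOn hf.isFunOn, (continuous_conv hk hf).aestronglyMeasurable,
    h2.trans_lt hfin⟩, ?_⟩
  rw [integral_norm_eq_lintegral_enorm hk.integrable.1, l2, l2, ← ENNReal.toReal_mul]
  exact ENNReal.toReal_mono hfin.ne h2

theorem norm_conv_le_of_bound (hk : Rapid k) {C : ℝ} (hC : ∀ x, ‖f x‖ ≤ C) (x : E3) :
    ‖conv k f x‖ ≤ (∫ y, ‖k y‖) * C := by
  rw [← integral_mul_const]
  refine norm_integral_le_of_norm_le (hk.norm.integrable.mul_const C)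
    (Eventually.of_forall fun y => ?_)
  rw [norm_smul]
  exact mul_le_mul_of_nonneg_left (hC _) (norm_nonneg _)

theorem conv_sub (hk : Rapid k) (hf : L2On Ω f) (hg : L2On Ω g) (x : E3) :
    conv k (fun y => f y - g y) x = conv k f x - conv k g x := by
  simp only [conv, smul_sub]
  exact integral_sub (hf.integrable_rapid hk x) (hg.integrable_rapid hk x)

theorem conv_sum {ι : Type*} {s : Finset ι} {f : ι → E3 → F} (hk : Rapid k)
    (hf : ∀ i, L2On Ω (f i)) (x : E3) :
    conv k (fun y => ∑ i ∈ s, f i y) x = ∑ i ∈ s, conv k (f i) x := by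
  simp only [conv, Finset.smul_sum]
  exact integral_finsetSum _ fun i _ => (hf i).integrable_rapid hk x

theorem conv_clm [CompleteSpace F] {G : Type*} [NormedAddCommGroup G] [NormedSpace ℝ G]
    [CompleteSpace G] (hk : Rapid k) (hf : L2On Ω f)
    (A : F →L[ℝ] G) (x : E3) : conv k (fun y => A (f y)) x = A (conv k f x) := by
  simp only [conv]
  rw [← A.integral_comp_comm (hf.integrable_rapid hk x)]
  simp

theorem conv_comm_kernel (k₁ k₂ : E3 → ℝ) : conv k₁ k₂ = conv k₂ k₁ := by
  ext x
  rw [conv_eq, conv]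
  simp [mul_comm]

/-- Fubini, whose hypothesis follows from the L² theory applied to the norms of the kernel and of
the field. -/
theorem conv_conv [CompleteSpace F] (h₁ : Rapid k₁) (h₂ : Rapid k₂) (hf : L2On Ω f) :
    conv k₁ (conv k₂ f) = conv (conv k₁ k₂) f := by
  ext x
  have e1 : ∀ y, conv k₂ f (x - y) = ∫ z, k₂ (z - y) • f (x - z) := by
    intro y
    have := integral_sub_right_eq_self (fun z => k₂ z • f (x - y - z)) (μ := volume) y
    rw [conv, ← this]
    simp
  have hfm : AEStronglyMeasurable (fun z => f (x - z)) volume :=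
    hf.aestronglyMeasurable.comp_measurePreserving (Measure.measurePreserving_sub_left volume x)
  have hint : Integrable (fun p : E3 × E3 => k₁ p.1 • k₂ (p.2 - p.1) • f (x - p.2))
      (volume.prod volume) := by
    have hm : AEStronglyMeasurable (fun p : E3 × E3 => k₁ p.1 • k₂ (p.2 - p.1) • f (x - p.2))
        (volume.prod volume) :=
      ((h₁.continuous.comp continuous_fst).aestronglyMeasurable).smul
        (((h₂.continuous.comp (continuous_snd.sub continuous_fst)).aestronglyMeasurable).smul
          (hfm.comp_snd))
    rw [integrable_prod_iff hm]
    constructor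
    · refine Eventually.of_forall fun y => ?_
      have := ((hf.integrable_rapid h₂ (x - y)).comp_sub_right y).smul (k₁ y)
      simpa [Pi.smul_def] using this
    · have := (hf.norm.conv h₂.norm).1.integrable_rapid h₁.norm x
      refine this.congr (Eventually.of_forall fun y => ?_)
      simp only [norm_smul, integral_const_mul, smul_eq_mul]
      congr 1
      have := integral_sub_right_eq_self (fun z => ‖k₂ z‖ • ‖f (x - y - z)‖) (μ := volume) y
      rw [conv, ← this]
      simp
  calc conv k₁ (conv k₂ f) x = ∫ y, ∫ z, k₁ y • k₂ (z - y) • f (x - z) := by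
        rw [conv]
        congr 1; ext y
        rw [e1, integral_smul]
    _ = ∫ z, ∫ y, k₁ y • k₂ (z - y) • f (x - z) := integral_integral_swap hint
    _ = _ := by
        simp only [conv, smul_smul, integral_smul_const]
        rfl

theorem conv_conv_comm [CompleteSpace F] (h₁ : Rapid k₁) (h₂ : Rapid k₂) (hf : L2On Ω f) :
    conv k₁ (conv k₂ f) = conv k₂ (conv k₁ f) := by
  rw [conv_conv h₁ h₂ hf, conv_conv h₂ h₁ hf, conv_comm_kernel]

/-- The common Fubini hypothesis for pairings with a shifted function: as the kernel is integrable,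
it suffices to bound the `x`-integrals uniformly in the shift. -/
theorem integrable_kernel_prod (hk : Rapid k) {Φ : E3 × E3 → ℝ} {B : ℝ}
    (hm : AEStronglyMeasurable Φ (Ω.measure.prod volume))
    (hΦ : ∀ y, Integrable (fun x => Φ (x, y)) Ω.measure)
    (hB : ∀ y, ∫ x, ‖Φ (x, y)‖ ∂Ω.measure ≤ B) :
    Integrable (fun p : E3 × E3 => k p.2 * Φ p) (Ω.measure.prod volume) := by
  have hm' : AEStronglyMeasurable (fun p : E3 × E3 => k p.2 * Φ p) (Ω.measure.prod volume) :=
    ((hk.continuous.comp continuous_snd).aestronglyMeasurable).mul hm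
  rw [integrable_prod_iff' hm']
  refine ⟨Eventually.of_forall fun y => (hΦ y).const_mul (k y), ?_⟩
  refine (hk.norm.integrable.mul_const B).mono' hm'.norm.prod_swap.integral_prod_right' ?_
  refine Eventually.of_forall fun y => ?_
  rw [Real.norm_of_nonneg (integral_nonneg fun x => norm_nonneg _)]
  simp only [norm_mul, integral_const_mul]
  exact mul_le_mul_of_nonneg_left (hB y) (norm_nonneg _)

end Conv

/-! ### The adjoint of a convolution -/

section Adjoint

variable {Ω : Dom} {F : Type*} [NormedAddCommGroup F] [InnerProductSpace ℝ F] [CompleteSpace F]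
  {k : E3 → ℝ} {f g : E3 → F}

/-- Translation invariance moves the shift to the other factor with the opposite sign. Even kernels
thus act self-adjointly; their partial derivatives, being odd, act skew-adjointly. -/
theorem integral_inner_conv (hk : Rapid k) (hf : L2On Ω f) (hg : L2On Ω g) :
    ∫ x, inner ℝ (conv k f x) (g x) ∂Ω.measure =
      ∫ x, inner ℝ (f x) (conv (fun y => k (-y)) g x) ∂Ω.measure := by
  have hint : Integrable (fun p : E3 × E3 => k p.2 * inner ℝ (f (p.1 - p.2)) (g p.1))
      (Ω.measure.prod volume) := by
    refine integrable_kernel_prod (B := l2 Ω f * l2 Ω g) hk ?_ ?_ ?_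
    · exact (aestronglyMeasurable_sub hf.aestronglyMeasurable Ω).inner hg.memLp.1.comp_fst
    · exact fun y => (hf.sub_right y).integrable_inner hg
    · intro y
      have h := (hf.sub_right y).integral_mul_le hg
      rw [hf.l2_sub_right] at h
      refine le_trans (integral_mono_of_nonneg (Eventually.of_forall fun x => norm_nonneg _)
        ((hf.sub_right y).integrable_mul hg) (Eventually.of_forall fun x => ?_)) h
      exact norm_inner_le_norm _ _
  calc _ = ∫ x, (∫ y, k y * inner ℝ (f (x - y)) (g x)) ∂Ω.measure := by
        congr 1; ext x
        rw [real_inner_comm, conv, ← integral_inner (hf.integrable_rapid hk x)]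
        congr 1; ext y
        rw [inner_smul_right, real_inner_comm]
    _ = ∫ y, (∫ x, k y * inner ℝ (f (x - y)) (g x) ∂Ω.measure) := integral_integral_swap hint
    _ = ∫ y, k y * ∫ x, inner ℝ (f x) (g (x + y)) ∂Ω.measure := by
        congr 1; ext y
        rw [integral_const_mul]
        congr 1
        have := integral_comp_sub (Ω := Ω) (f := fun x => inner ℝ (f x) (g (x + y)))
          (hf.isFunOn.comp₂ (by simpa using hg.isFunOn.sub_right (-y)) _) y
        rw [← this]
        simp
    _ = ∫ y, k (-y) * ∫ x, inner ℝ (f x) (g (x - y)) ∂Ω.measure := by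
        rw [← integral_neg_eq_self]
        simp [sub_eq_add_neg]
    _ = ∫ y, ∫ x, k (-y) * inner ℝ (f x) (g (x - y)) ∂Ω.measure := by
        simp only [integral_const_mul]
    _ = ∫ x, (∫ y, k (-y) * inner ℝ (f x) (g (x - y))) ∂Ω.measure := by
        refine (integral_integral_swap ?_).symm
        refine integrable_kernel_prod (B := l2 Ω f * l2 Ω g) (k := fun y => k (-y))
          (Φ := fun p => inner ℝ (f p.1) (g (p.1 - p.2))) hk.comp_neg ?_ ?_ ?_
        · exact hf.memLp.1.comp_fst.inner (aestronglyMeasurable_sub hg.aestronglyMeasurable Ω)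
        · exact fun y => hf.integrable_inner (hg.sub_right y)
        · intro y
          have h := hf.integral_mul_le (hg.sub_right y)
          rw [hg.l2_sub_right] at h
          refine le_trans (integral_mono_of_nonneg (Eventually.of_forall fun x => norm_nonneg _)
            (hf.integrable_mul (hg.sub_right y)) (Eventually.of_forall fun x => ?_)) h
          exact norm_inner_le_norm _ _
    _ = _ := by
        congr 1; ext x
        rw [conv, ← integral_inner (hg.integrable_rapid hk.comp_neg x)]
        congr 1; ext y
        rw [inner_smul_right]

end Adjoint

/-! ### Smoothness of convolutions -/

section Deriv

variable {Ω : Dom} {F : Type*} [NormedAddCommGroup F] [NormedSpace ℝ F]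
  {f : E3 → F}

theorem hasFDerivAt_conv (k : 𝓢(E3, ℝ)) (hf : L2On Ω f) (x : E3) :
    HasFDerivAt (conv k f) (∫ y, (fderiv ℝ k (x - y)).smulRight (f y)) x := by
  obtain ⟨C, hC, h⟩ := schwartz_exists_le_wt (SchwartzMap.fderivCLM ℝ E3 ℝ k)
  simp only [SchwartzMap.fderivCLM_apply] at h
  rw [show conv k f = fun x => ∫ y, k (x - y) • f y from funext (conv_eq k f)]
  have hcont : Continuous (fderiv ℝ k) := (SchwartzMap.fderivCLM ℝ E3 ℝ k).continuous
  have hF' : AEStronglyMeasurable (fun y => (fderiv ℝ k (x - y)).smulRight (f y)) volume := by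
    have h1 : AEStronglyMeasurable (fun y => fderiv ℝ k (x - y)) volume :=
      (hcont.comp (continuous_const.sub continuous_id)).aestronglyMeasurable
    exact (ContinuousLinearMap.smulRightL ℝ E3 F).aestronglyMeasurable_comp₂ h1
      hf.aestronglyMeasurable
  refine hasFDerivAt_integral_of_dominated_of_fderiv_le (s := Metric.ball x 1)
    (F := fun x y => k (x - y) • f y)
    (F' := fun x y => (fderiv ℝ k (x - y)).smulRight (f y))
    (bound := fun y => C * (2 ^ 4 * (wt (x - y) * ‖f y‖))) (Metric.ball_mem_nhds x one_pos)
    (Eventually.of_forall fun x' => (hf.integrable_rapid_sub (rapid_schwartz k) x').1)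
    (hf.integrable_rapid_sub (rapid_schwartz k) x) hF' ?_
    (((hf.integrable_wt_sub x).const_mul _).const_mul _) ?_
  · refine Eventually.of_forall fun y x' hx' => ?_
    rw [ContinuousLinearMap.norm_smulRight_apply, ← mul_assoc (2 ^ 4), ← mul_assoc C]
    refine mul_le_mul_of_nonneg_right ((h _).trans ?_) (norm_nonneg _)
    refine mul_le_mul_of_nonneg_left ((wt_sub_le x' x y).trans ?_) hC
    refine mul_le_mul_of_nonneg_right ?_ (wt_pos _).le
    have := (mem_ball_iff_norm.1 hx').le
    gcongr
    linarith
  · refine Eventually.of_forall fun y x' _ => ?_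
    have h1 : HasFDerivAt (fun x => k (x - y)) (fderiv ℝ k (x' - y)) x' := by
      have := (k.hasFDerivAt (x' - y)).comp x' ((hasFDerivAt_id x').sub_const y)
      exact this
    exact h1.smul_const (f y)

theorem differentiable_conv (k : 𝓢(E3, ℝ)) (hf : L2On Ω f) : Differentiable ℝ (conv k f) :=
  fun x => (hasFDerivAt_conv k hf x).differentiableAt

theorem fderiv_conv_apply (k : 𝓢(E3, ℝ)) (hf : L2On Ω f) (x v : E3) :
    fderiv ℝ (conv k f) x v = conv (∂_{v} k : 𝓢(E3, ℝ)) f x := by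
  obtain ⟨C, hC, h⟩ := schwartz_exists_le_wt (SchwartzMap.fderivCLM ℝ E3 ℝ k)
  simp only [SchwartzMap.fderivCLM_apply] at h
  have hcont : Continuous (fderiv ℝ k) := (SchwartzMap.fderivCLM ℝ E3 ℝ k).continuous
  have hF' : AEStronglyMeasurable (fun y => (fderiv ℝ k (x - y)).smulRight (f y)) volume := by
    have h1 : AEStronglyMeasurable (fun y => fderiv ℝ k (x - y)) volume :=
      (hcont.comp (continuous_const.sub continuous_id)).aestronglyMeasurable
    exact (ContinuousLinearMap.smulRightL ℝ E3 F).aestronglyMeasurable_comp₂ h1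
      hf.aestronglyMeasurable
  have hint : Integrable (fun y => (fderiv ℝ k (x - y)).smulRight (f y)) :=
    hf.integrable_smul_of_le x h hF' fun y => by rw [ContinuousLinearMap.norm_smulRight_apply]
  rw [(hasFDerivAt_conv k hf x).fderiv, ContinuousLinearMap.integral_apply hint, conv_eq]
  simp only [ContinuousLinearMap.smulRight_apply, SchwartzMap.lineDerivOp_apply_eq_fderiv]

theorem clm_eq_sum (A : E3 →L[ℝ] F) :
    A = ∑ j : Fin 3, (EuclideanSpace.proj j : E3 →L[ℝ] ℝ).smulRight (A (e j)) := by
  ext x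
  conv_lhs => rw [← (EuclideanSpace.basisFun (Fin 3) ℝ).sum_repr x]
  simp [e]

/-- A partial derivative of a convolution is the convolution with the differentiated kernel, so the
induction must run over all Schwartz kernels at once. -/
theorem contDiff_conv (k : 𝓢(E3, ℝ)) (hf : L2On Ω f) : ContDiff ℝ ∞ (conv k f) := by
  rw [contDiff_infty]
  intro n
  induction n generalizing k with
  | zero => exact contDiff_zero.2 (continuous_conv (rapid_schwartz k) hf)
  | succ n ih =>
    rw [show ((n + 1 : ℕ) : WithTop ℕ∞) = (n : WithTop ℕ∞) + 1 by simp,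
      contDiff_succ_iff_fderiv]
    refine ⟨differentiable_conv k hf, by simp, ?_⟩
    have : fderiv ℝ (conv k f) = fun x => ∑ j : Fin 3,
        (EuclideanSpace.proj j : E3 →L[ℝ] ℝ).smulRight (conv (∂_{e j} k : 𝓢(E3, ℝ)) f x) := by
      ext1 x
      rw [clm_eq_sum (fderiv ℝ (conv k f) x)]
      simp only [fderiv_conv_apply k hf]
    rw [this]
    refine ContDiff.sum fun j _ => ?_
    exact (ContinuousLinearMap.smulRightL ℝ E3 F
      (EuclideanSpace.proj j : E3 →L[ℝ] ℝ)).contDiff.comp (ih (∂_{e j} k))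

end Deriv

/-! ### Pointwise bounds and products of band-limited functions -/

section Sup

variable {F : Type*} [NormedAddCommGroup F] [NormedSpace ℝ F]

/-- By the Peetre inequality, the value of the nonnegative function `conv wt f` at `x` is controlled
by its value at every point of the ball of radius n around `x`. Squaring and integrating over a ball
of positive measure bounds that value by the L² norm. -/
theorem exists_conv_wt_le (Ω : Dom) : ∃ C, 0 ≤ C ∧ ∀ (f : E3 → ℝ), L2On Ω f → (∀ x, 0 ≤ f x) →
    ∀ x, conv wt f x ≤ C * l2 Ω f := by
  obtain ⟨n, hn⟩ : ∃ n : ℕ, Ω.measure (Metric.ball 0 n) ≠ 0 := by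
    by_contra! h
    refine measure_ne_zero Ω (Measure.measure_univ_eq_zero.1 ?_)
    rw [← Metric.iUnion_ball_nat (0 : E3)]
    exact measure_iUnion_null h
  set A := Metric.ball (0 : E3) n with hA
  have hfin : Ω.measure A ≠ ⊤ :=
    ((Measure.restrict_apply_le _ _).trans_lt measure_ball_lt_top).ne
  have hpos : 0 < Ω.measure.real A := ENNReal.toReal_pos hn hfin
  refine ⟨(1 + n) ^ 4 / √(Ω.measure.real A) * ∫ y, ‖wt y‖, by positivity, fun f hf h0 x => ?_⟩
  set φ := conv wt f with hφ
  have hφ2 := hf.conv rapid_wt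
  have hφ0 : ∀ x, 0 ≤ φ x := fun x =>
    integral_nonneg fun y => smul_nonneg (wt_pos y).le (h0 _)
  have hcmp : ∀ z ∈ A, φ x ≤ (1 + n) ^ 4 * φ (z - (-x)) := by
    intro z hz
    rw [hφ, conv_eq, conv_eq, ← integral_const_mul]
    refine integral_mono (hf.integrable_rapid_sub rapid_wt x)
      ((hf.integrable_rapid_sub rapid_wt _).const_mul _) fun y => ?_
    simp only [smul_eq_mul, ← mul_assoc]
    refine mul_le_mul_of_nonneg_right ((wt_sub_le x (z - (-x)) y).trans ?_) (h0 _)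
    refine mul_le_mul_of_nonneg_right ?_ (wt_pos _).le
    have hz' : ‖z‖ < n := by simpa [hA] using hz
    have : ‖x - (z - -x)‖ = ‖z‖ := by rw [← norm_neg z]; congr 1; abel
    rw [this]
    gcongr
  have h1 : Ω.measure.real A * (φ x / (1 + n) ^ 4) ^ 2 ≤ l2 Ω φ ^ 2 := by
    rw [← hφ2.1.l2_sub_right (-x), (hφ2.1.sub_right (-x)).l2_sq]
    calc Ω.measure.real A * (φ x / (1 + n) ^ 4) ^ 2
        = ∫ z in A, (φ x / (1 + n) ^ 4) ^ 2 ∂Ω.measure := by simp [Measure.real]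
      _ ≤ ∫ z in A, ‖φ (z - (-x))‖ ^ 2 ∂Ω.measure := by
          refine setIntegral_mono_on (integrableOn_const hfin)
            (hφ2.1.sub_right (-x)).integrable_sq.integrableOn measurableSet_ball fun z hz => ?_
          rw [Real.norm_of_nonneg (hφ0 _)]
          have := hcmp z hz
          have h3 : φ x / (1 + n) ^ 4 ≤ φ (z - (-x)) := by
            rw [div_le_iff₀ (by positivity)]; linarith
          have h4 : 0 ≤ φ x / (1 + n) ^ 4 := div_nonneg (hφ0 x) (by positivity)
          gcongr
      _ ≤ _ := setIntegral_le_integral (hφ2.1.sub_right (-x)).integrable_sq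
          (Eventually.of_forall fun z => by positivity)
  have h2 : √(Ω.measure.real A) * (φ x / (1 + n) ^ 4) ≤ l2 Ω φ := by
    have h4 : 0 ≤ φ x / (1 + n) ^ 4 := div_nonneg (hφ0 x) (by positivity)
    refine (sq_le_sq₀ (by positivity) (l2_nonneg _)).1 ?_
    rwa [mul_pow, Real.sq_sqrt hpos.le]
  have h3 := h2.trans hφ2.2
  have hs : 0 < √(Ω.measure.real A) := Real.sqrt_pos.2 hpos
  calc φ x = (1 + n) ^ 4 / √(Ω.measure.real A) *
        (√(Ω.measure.real A) * (φ x / (1 + n) ^ 4)) := by field_simp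
    _ ≤ _ := by rw [mul_assoc]; gcongr

theorem exists_norm_conv_le (Ω : Dom) {k : E3 → ℝ} (hk : Rapid k) : ∃ C, 0 ≤ C ∧
    ∀ (f : E3 → F), L2On Ω f → ∀ x, ‖conv k f x‖ ≤ C * l2 Ω f := by
  obtain ⟨C, hC, h⟩ := exists_conv_wt_le Ω
  obtain ⟨B, hB, hk'⟩ := hk.bound
  refine ⟨B * C, by positivity, fun f hf x => ?_⟩
  have h1 := h _ hf.norm (fun x => norm_nonneg _) x
  rw [L2On.l2_norm] at h1
  rw [mul_assoc]
  refine le_trans ?_ (mul_le_mul_of_nonneg_left h1 hB)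
  rw [NSE.conv, NSE.conv, ← integral_const_mul]
  refine norm_integral_le_of_norm_le ((hf.norm.integrable_rapid rapid_wt x).const_mul B)
    (Eventually.of_forall fun y => ?_)
  rw [norm_smul, smul_eq_mul, ← mul_assoc]
  exact mul_le_mul_of_nonneg_right (hk' y) (norm_nonneg _)

/-- A kernel that reproduces products of convolutions. -/
theorem conv_mul_of_reproducing {Ω : Dom} {K k₁ k₂ : E3 → ℝ} (hK : Rapid K) (h₁ : Rapid k₁)
    (h₂ : Rapid k₂) (h : ∀ a b, ∫ z, K z * (k₁ (a - z) * k₂ (b - z)) = k₁ a * k₂ b)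
    {f g : E3 → ℝ} (hf : L2On Ω f) (hg : L2On Ω g) (x : E3) :
    conv K (fun x => conv k₁ f x * conv k₂ g x) x = conv k₁ f x * conv k₂ g x := by
  have hfg : ∀ x, conv k₁ f x * conv k₂ g x =
      ∫ p : E3 × E3, (k₁ (x - p.1) * f p.1) * (k₂ (x - p.2) * g p.2) := by
    intro x
    rw [conv_eq, conv_eq]
    exact (integral_prod_mul (fun y => k₁ (x - y) * f y) (fun y => k₂ (x - y) * g y)).symm
  -- One factor is bounded, so the product of the convolved absolute values is again in L²; this is
  -- what makes the triple integral below absolutely convergent.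
  obtain ⟨C, hC, hb⟩ := exists_norm_conv_le (F := ℝ) Ω h₂.norm
  have hprod : L2On Ω (fun x => conv (fun y => ‖k₁ y‖) (fun y => ‖f y‖) x *
      conv (fun y => ‖k₂ y‖) (fun y => ‖g y‖) x) := by
    refine (hf.norm.conv h₁.norm).1.of_le (C := C * l2 Ω (fun y => ‖g y‖))
      ((conv_isFunOn hf.norm.isFunOn).comp₂ (conv_isFunOn hg.norm.isFunOn) _) ?_ fun x => ?_
    · exact ((continuous_conv h₁.norm hf.norm).mul
        (continuous_conv h₂.norm hg.norm)).aestronglyMeasurable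
    · rw [norm_mul, mul_comm]
      exact mul_le_mul_of_nonneg_right (hb _ hg.norm x) (norm_nonneg _)
  have hint : Integrable (fun q : E3 × (E3 × E3) => K q.1 *
      ((k₁ (x - q.1 - q.2.1) * f q.2.1) * (k₂ (x - q.1 - q.2.2) * g q.2.2)))
      (volume.prod volume) := by
    have hm : AEStronglyMeasurable (fun q : E3 × (E3 × E3) => K q.1 *
      ((k₁ (x - q.1 - q.2.1) * f q.2.1) * (k₂ (x - q.1 - q.2.2) * g q.2.2)))
      (volume.prod volume) := by
      have c1 : Continuous (fun q : E3 × (E3 × E3) => k₁ (x - q.1 - q.2.1)) :=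
        h₁.continuous.comp (by fun_prop)
      have c2 : Continuous (fun q : E3 × (E3 × E3) => k₂ (x - q.1 - q.2.2)) :=
        h₂.continuous.comp (by fun_prop)
      have m1 : AEStronglyMeasurable (fun q : E3 × (E3 × E3) => f q.2.1)
          (volume.prod (volume.prod volume)) := hf.aestronglyMeasurable.comp_fst.comp_snd
      have m2 : AEStronglyMeasurable (fun q : E3 × (E3 × E3) => g q.2.2)
          (volume.prod (volume.prod volume)) := hg.aestronglyMeasurable.comp_snd.comp_snd
      exact ((hK.continuous.comp continuous_fst).aestronglyMeasurable).mul
        ((c1.aestronglyMeasurable.mul m1).mul (c2.aestronglyMeasurable.mul m2))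
    rw [integrable_prod_iff hm]
    constructor
    · refine Eventually.of_forall fun z => Integrable.const_mul ?_ (K z)
      exact (hf.integrable_rapid_sub h₁ (x - z)).mul_prod (hg.integrable_rapid_sub h₂ (x - z))
    · refine (hprod.integrable_rapid hK.norm x).congr (Eventually.of_forall fun z => ?_)
      simp only [norm_mul, smul_eq_mul, integral_const_mul]
      congr 1
      rw [conv_eq, conv_eq]
      exact (integral_prod_mul (fun y => ‖k₁ (x - z - y)‖ * ‖f y‖)
        (fun y => ‖k₂ (x - z - y)‖ * ‖g y‖)).symm
  calc conv K (fun x => conv k₁ f x * conv k₂ g x) x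
      = ∫ z, ∫ p : E3 × E3, K z * ((k₁ (x - z - p.1) * f p.1) * (k₂ (x - z - p.2) * g p.2)) := by
        rw [NSE.conv]
        congr 1; ext z
        rw [hfg, smul_eq_mul, integral_const_mul]
    _ = ∫ p : E3 × E3, ∫ z, K z *
          ((k₁ (x - z - p.1) * f p.1) * (k₂ (x - z - p.2) * g p.2)) :=
        integral_integral_swap hint
    _ = ∫ p : E3 × E3, (k₁ (x - p.1) * f p.1) * (k₂ (x - p.2) * g p.2) := by
        congr 1; ext p
        calc _ = ∫ z, (f p.1 * g p.2) *
              (K z * (k₁ (x - p.1 - z) * k₂ (x - p.2 - z))) := by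
              congr 1; ext z
              rw [sub_right_comm x z, sub_right_comm x z]
              ring
          _ = _ := by rw [integral_const_mul, h]; ring
    _ = _ := (hfg x).symm

end Sup

/-! ### Fourier inversion integrals tested with kernels -/

section Fourier

/-- The exponential `exp (2 π i θ)`. -/
def expI (θ : ℝ) : ℂ := Complex.exp ((2 * Real.pi * θ : ℝ) * Complex.I)

theorem expI_add (a b : ℝ) : expI (a + b) = expI a * expI b := by
  rw [expI, expI, expI, ← Complex.exp_add]
  push_cast; ring_nf

theorem norm_expI (a : ℝ) : ‖expI a‖ = 1 := by
  rw [expI, Complex.norm_exp_ofReal_mul_I]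

theorem continuous_expI : Continuous expI := by unfold expI; fun_prop

theorem fourierInv_eq_expI (σ : E3 → ℂ) (x : E3) : 𝓕⁻ σ x = ∫ ξ, expI (inner ℝ ξ x) * σ ξ := by
  rw [Real.fourierInv_eq']; rfl

theorem fourier_eq_expI (σ : E3 → ℂ) (x : E3) : 𝓕 σ x = ∫ ξ, expI (-inner ℝ ξ x) * σ ξ := by
  rw [Real.fourier_eq']
  congr 1; ext ξ
  rw [expI, smul_eq_mul]
  congr 4
  ring

/-- A superposition of plane waves with frequencies θ, tested with `K`, sees only the Fourier
transform of `K` at these frequencies. The abstract index space covers both a single function (θ =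
ξ) and a product of two (θ = ξ + η). -/
theorem integral_mul_phase {X : Type*} [MeasurableSpace X] {ν : Measure X} [SFinite ν]
    {θ : X → E3} (hθ : Measurable θ) {s : X → ℂ} (hs : Integrable s ν) {K : E3 → ℂ}
    (hK : Integrable K) :
    ∫ z, K z * ∫ x, expI (-inner ℝ z (θ x)) * s x ∂ν = ∫ x, s x * 𝓕 K (θ x) ∂ν := by
  have hint : Integrable (fun p : E3 × X => expI (-inner ℝ p.1 (θ p.2)) * (K p.1 * s p.2))
      (volume.prod ν) := by
    refine (hK.mul_prod hs).bdd_mul (c := 1) ?_ (Eventually.of_forall fun p => (norm_expI _).le)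
    refine Measurable.aestronglyMeasurable ?_
    exact continuous_expI.measurable.comp
      ((measurable_fst.inner (hθ.comp measurable_snd)).neg)
  calc _ = ∫ z, ∫ x, expI (-inner ℝ z (θ x)) * (K z * s x) ∂ν := by
        congr 1; ext z
        rw [← integral_const_mul]
        congr 1; ext x; ring
    _ = ∫ x, (∫ z, expI (-inner ℝ z (θ x)) * (K z * s x)) ∂ν := integral_integral_swap hint
    _ = _ := by
        congr 1; ext x
        rw [fourier_eq_expI, ← integral_const_mul]
        congr 1; ext z; ring

theorem integral_mul_fourierInv {σ : E3 → ℂ} (hσ : Integrable σ) {K : E3 → ℂ}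
    (hK : Integrable K) (a : E3) : ∫ z, K z * 𝓕⁻ σ (a - z) = 𝓕⁻ (fun ξ => σ ξ * 𝓕 K ξ) a := by
  have hs : Integrable (fun ξ => expI (inner ℝ ξ a) * σ ξ) := by
    refine hσ.bdd_mul (c := 1) ?_ (Eventually.of_forall fun p => (norm_expI _).le)
    exact (continuous_expI.comp (by fun_prop)).aestronglyMeasurable
  have h := integral_mul_phase measurable_id hs hK
  rw [fourierInv_eq_expI]
  simp only [fourierInv_eq_expI, id] at h ⊢
  rw [show (fun ξ => expI (inner ℝ ξ a) * (σ ξ * 𝓕 K ξ)) =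
    fun ξ => expI (inner ℝ ξ a) * σ ξ * 𝓕 K ξ from funext fun ξ => by ring, ← h]
  congr 1; ext z
  congr 2; ext ξ
  rw [← mul_assoc, ← expI_add, inner_sub_right, real_inner_comm z]
  congr 2; ring

/-- The product consists of frequencies ξ + η with ξ and η in the two supports; on all of these the
transform of `K` equals one, so `K` acts as the identity. -/
theorem integral_mul_fourierInv_mul_fourierInv {σ₁ σ₂ : E3 → ℂ} (h₁ : Integrable σ₁)
    (h₂ : Integrable σ₂) {K : E3 → ℂ} (hK : Integrable K)
    (h : ∀ ξ η, σ₁ ξ ≠ 0 → σ₂ η ≠ 0 → 𝓕 K (ξ + η) = 1) (a b : E3) :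
    ∫ z, K z * (𝓕⁻ σ₁ (a - z) * 𝓕⁻ σ₂ (b - z)) = 𝓕⁻ σ₁ a * 𝓕⁻ σ₂ b := by
  have hm : ∀ {σ : E3 → ℂ} (a : E3), Integrable σ → Integrable (fun ξ => expI (inner ℝ ξ a) * σ ξ) := by
    intro σ a hσ
    refine hσ.bdd_mul (c := 1) ?_ (Eventually.of_forall fun p => (norm_expI _).le)
    exact (continuous_expI.comp (by fun_prop)).aestronglyMeasurable
  have key := integral_mul_phase (θ := fun p : E3 × E3 => p.1 + p.2)
    (measurable_fst.add measurable_snd) ((hm a h₁).mul_prod (hm b h₂)) hK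
  have e1 : ∀ z, 𝓕⁻ σ₁ (a - z) * 𝓕⁻ σ₂ (b - z) = ∫ p : E3 × E3, expI (-inner ℝ z (p.1 + p.2)) *
      ((expI (inner ℝ p.1 a) * σ₁ p.1) * (expI (inner ℝ p.2 b) * σ₂ p.2)) := by
    intro z
    rw [fourierInv_eq_expI, fourierInv_eq_expI]
    refine (integral_prod_mul (fun ξ => expI (inner ℝ ξ (a - z)) * σ₁ ξ)
      (fun ξ => expI (inner ℝ ξ (b - z)) * σ₂ ξ)).symm.trans ?_
    refine integral_congr_ae (Eventually.of_forall fun p => ?_)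
    simp only [sub_eq_add_neg, inner_add_right, inner_neg_right, neg_add, expI_add,
      real_inner_comm z]
    ring
  simp only [e1]
  refine key.trans ?_
  rw [fourierInv_eq_expI, fourierInv_eq_expI]
  refine Eq.trans ?_ (integral_prod_mul (fun ξ => expI (inner ℝ ξ a) * σ₁ ξ)
      (fun ξ => expI (inner ℝ ξ b) * σ₂ ξ))
  refine integral_congr_ae (Eventually.of_forall fun p => ?_)
  by_cases hp : σ₁ p.1 = 0
  · simp [hp]
  by_cases hp2 : σ₂ p.2 = 0
  · simp [hp2]
  simp [h _ _ hp hp2]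

end Fourier

/-! ### Littlewood–Paley kernels -/

section Kernel

variable {χ χ' χ₁ χ₂ : ℝ → ℝ}

theorem lam_pos (q : ℤ) : 0 < lam q := zpow_pos two_pos q

theorem lam_natCast_succ (p : ℕ) : lam ((p + 1 : ℕ) : ℤ) = 2 * lam p := by
  rw [lam, lam, Nat.cast_succ, zpow_add_one₀ two_ne_zero, mul_comm]

theorem lam_mono {p q : ℤ} (h : p ≤ q) : lam p ≤ lam q := zpow_le_zpow_right₀ (by norm_num) h

/-- The Fourier symbol of the low-frequency projection. -/
def symb (χ : ℝ → ℝ) (p : ℕ) (ξ : E3) : ℂ := (belowSymbol χ p ‖ξ‖ : ℂ)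

theorem symb_eq (χ : ℝ → ℝ) (p : ℕ) (ξ : E3) : symb χ p ξ = (χ (‖ξ‖ / lam p) : ℂ) := by
  rw [symb, belowSymbol_eq]

theorem symb_eq_one (hχ : IsLPProfile χ) {p : ℕ} {ξ : E3} (h : ‖ξ‖ ≤ 3 / 4 * lam p) :
    symb χ p ξ = 1 := by
  rw [symb_eq, hχ.eq_one _ ((div_le_iff₀ (lam_pos _)).2 h), Complex.ofReal_one]

theorem norm_lt_of_symb_ne_zero (hχ : IsLPProfile χ) {p : ℕ} {ξ : E3} (h : symb χ p ξ ≠ 0) :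
    ‖ξ‖ < lam p := by
  by_contra! h'
  exact h (by rw [symb_eq, hχ.eq_zero _ ((one_le_div (lam_pos _)).2 h'), Complex.ofReal_zero])

theorem hasCompactSupport_symb (hχ : IsLPProfile χ) (p : ℕ) : HasCompactSupport (symb χ p) := by
  refine HasCompactSupport.intro (isCompact_closedBall 0 (lam p)) fun ξ hξ => ?_
  by_contra h
  exact hξ (by simpa using (norm_lt_of_symb_ne_zero hχ h).le)

theorem contDiff_symb (hχ : IsLPProfile χ) (p : ℕ) : ContDiff ℝ ∞ (symb χ p) := by
  rw [contDiff_iff_contDiffAt]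
  intro ξ
  -- The norm is not smooth at the origin, but the symbol is constant there.
  by_cases hξ : ξ = 0
  · have : symb χ p =ᶠ[𝓝 ξ] fun _ => 1 := by
      have hpos : 0 < 3 / 4 * lam p := by have := lam_pos p; positivity
      filter_upwards [Metric.ball_mem_nhds ξ hpos] with η hη
      refine symb_eq_one hχ ?_
      rw [hξ, mem_ball_zero_iff] at hη
      exact hη.le
    exact contDiffAt_const.congr_of_eventuallyEq this
  · rw [show symb χ p = fun ξ => (χ (‖ξ‖ / lam p) : ℂ) from funext (symb_eq χ p)]
    refine Complex.ofRealCLM.contDiff.contDiffAt.comp ξ ?_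
    refine hχ.smooth.contDiffAt.comp ξ ?_
    exact ((contDiffAt_id.norm ℝ hξ).div_const _)

/-- The symbol as a Schwartz function. -/
def symbS (hχ : IsLPProfile χ) (p : ℕ) : 𝓢(E3, ℂ) :=
  (hasCompactSupport_symb hχ p).toSchwartzMap (contDiff_symb hχ p)

theorem coe_symbS (hχ : IsLPProfile χ) (p : ℕ) : ⇑(symbS hχ p) = symb χ p := rfl

/-- The kernel as a Schwartz function. -/
def lpK (hχ : IsLPProfile χ) (p : ℕ) : 𝓢(E3, ℝ) :=
  SchwartzMap.postcompCLM (𝕜 := ℝ) Complex.reCLM (𝓕⁻ (symbS hχ p))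

theorem coe_lpK (hχ : IsLPProfile χ) (p : ℕ) : ⇑(lpK hχ p) = belowKernel χ p := by
  ext x
  rw [lpK, SchwartzMap.postcompCLM_apply, SchwartzMap.fourierInv_coe]
  rfl

theorem rapid_below (hχ : IsLPProfile χ) (p : ℕ) : Rapid (belowKernel χ p) :=
  coe_lpK hχ p ▸ rapid_schwartz _

theorem symb_neg (χ : ℝ → ℝ) (p : ℕ) (ξ : E3) : symb χ p (-ξ) = symb χ p ξ := by
  rw [symb, symb, norm_neg]

theorem fourierInv_symb_neg (χ : ℝ → ℝ) (p : ℕ) (x : E3) :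
    𝓕⁻ (symb χ p) (-x) = 𝓕⁻ (symb χ p) x := by
  rw [fourierInv_eq_expI, fourierInv_eq_expI, ← integral_neg_eq_self]
  simp [symb_neg]

theorem belowKernel_neg (χ : ℝ → ℝ) (p : ℕ) (x : E3) :
    belowKernel χ p (-x) = belowKernel χ p x := by
  have := congrArg Complex.re (fourierInv_symb_neg χ p x)
  exact this

theorem ofReal_belowKernel (χ : ℝ → ℝ) (p : ℕ) (x : E3) :
    (belowKernel χ p x : ℂ) = 𝓕⁻ (symb χ p) x := by
  have h : (starRingEnd ℂ) (𝓕⁻ (symb χ p) x) = 𝓕⁻ (symb χ p) x := by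
    conv_rhs => rw [← fourierInv_symb_neg]
    rw [fourierInv_eq_expI, fourierInv_eq_expI, ← integral_conj]
    congr 1; ext ξ
    rw [map_mul, expI, expI, ← Complex.exp_conj, map_mul, Complex.conj_ofReal, Complex.conj_I,
      symb, Complex.conj_ofReal, inner_neg_right]
    congr 2
    push_cast; ring
  exact Complex.conj_eq_iff_re.1 h

theorem integrable_symb (hχ : IsLPProfile χ) (p : ℕ) : Integrable (symb χ p) :=
  (symbS hχ p).integrable

theorem fourier_belowKernel (hχ : IsLPProfile χ) (p : ℕ) (ξ : E3) :
    𝓕 (fun x => (belowKernel χ p x : ℂ)) ξ = symb χ p ξ := by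
  have h : 𝓕 (𝓕⁻ (symbS hχ p)) = symbS hχ p := FourierTransform.fourier_fourierInv_eq _
  have h2 := congrArg (fun k : 𝓢(E3, ℂ) => k ξ) h
  simp only [SchwartzMap.fourier_coe, SchwartzMap.fourierInv_coe, coe_symbS] at h2
  rw [← h2]
  exact congrArg (fun g : E3 → ℂ => 𝓕 g ξ) (funext fun x => ofReal_belowKernel χ p x)

theorem integrable_belowKernel (hχ : IsLPProfile χ) (p : ℕ) :
    Integrable (fun x => (belowKernel χ p x : ℂ)) :=
  (rapid_below hχ p).integrable.ofReal

theorem integral_belowKernel (hχ : IsLPProfile χ) (p : ℕ) : ∫ x, belowKernel χ p x = 1 := by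
  have h := fourier_belowKernel hχ p 0
  rw [fourier_eq_expI, symb_eq_one hχ (by have := lam_pos p; simp; positivity)] at h
  simp only [inner_zero_right, neg_zero] at h
  rw [show expI 0 = 1 by simp [expI]] at h
  simp only [one_mul] at h
  rw [integral_complex_ofReal] at h
  exact_mod_cast h

theorem ofReal_conv_belowKernel (hχ : IsLPProfile χ) (hχ' : IsLPProfile χ') (p q : ℕ) (x : E3) :
    ((conv (belowKernel χ' q) (belowKernel χ p) x : ℝ) : ℂ) =
      𝓕⁻ (fun ξ => symb χ p ξ * symb χ' q ξ) x := by
  have h := integral_mul_fourierInv (integrable_symb hχ p) (integrable_belowKernel hχ' q) x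
  simp only [fourier_belowKernel hχ', ← ofReal_belowKernel] at h
  rw [← h, conv, ← integral_complex_ofReal]
  simp

/-- Low-frequency projections are absorbed by projections to larger frequency balls. -/
theorem conv_belowKernel_of_lt (hχ : IsLPProfile χ) (hχ' : IsLPProfile χ') {p q : ℕ} (h : p < q) :
    conv (belowKernel χ' q) (belowKernel χ p) = belowKernel χ p := by
  ext x
  have h1 := ofReal_conv_belowKernel hχ hχ' p q x
  have h2 : (fun ξ => symb χ p ξ * symb χ' q ξ) = symb χ p := by
    ext1 ξ
    by_cases h0 : symb χ p ξ = 0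
    · rw [h0, zero_mul]
    · have h3 := norm_lt_of_symb_ne_zero hχ h0
      have h4 : lam ((p + 1 : ℕ) : ℤ) ≤ lam q := lam_mono (by exact_mod_cast h)
      rw [lam_natCast_succ] at h4
      rw [symb_eq_one hχ' (by have := lam_pos p; linarith), mul_one]
  rw [h2, ← ofReal_belowKernel] at h1
  exact_mod_cast h1

/-- The profile of `1 - (1 - m)²` if `χ` is the profile of `m`. -/
def sqProfile (χ : ℝ → ℝ) (r : ℝ) : ℝ := 2 * χ r - χ r ^ 2

theorem IsLPProfile.sqProfile (hχ : IsLPProfile χ) : IsLPProfile (sqProfile χ) where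
  smooth := (contDiff_const.mul hχ.smooth).sub (hχ.smooth.pow 2)
  eq_one r hr := by simp [NSE.sqProfile, hχ.eq_one r hr]; norm_num
  eq_zero r hr := by simp [NSE.sqProfile, hχ.eq_zero r hr]

/-- On the Fourier side this is m² = 2m - (2m - m²). Keeping 2m - m² as a symbol with its own
profile makes every result on low-frequency kernels apply to it. -/
theorem conv_belowKernel_self (hχ : IsLPProfile χ) (p : ℕ) (x : E3) :
    conv (belowKernel χ p) (belowKernel χ p) x =
      2 * belowKernel χ p x - belowKernel (sqProfile χ) p x := by
  have h1 := ofReal_conv_belowKernel hχ hχ p p x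
  have hm : ∀ {χ : ℝ → ℝ}, IsLPProfile χ → Integrable (fun ξ => expI (inner ℝ ξ x) * symb χ p ξ) := by
    intro χ hχ
    refine (integrable_symb hχ p).bdd_mul (c := 1) ?_
      (Eventually.of_forall fun p => (norm_expI _).le)
    exact (continuous_expI.comp (by fun_prop)).aestronglyMeasurable
  have h2 : 𝓕⁻ (fun ξ => symb χ p ξ * symb χ p ξ) x =
      2 * 𝓕⁻ (symb χ p) x - 𝓕⁻ (symb (sqProfile χ) p) x := by
    rw [fourierInv_eq_expI, fourierInv_eq_expI, fourierInv_eq_expI, ← integral_const_mul,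
      ← integral_sub ((hm hχ).const_mul 2) (hm hχ.sqProfile)]
    congr 1; ext ξ
    simp only [symb_eq, sqProfile]
    push_cast; ring
  rw [h2, ← ofReal_belowKernel, ← ofReal_belowKernel] at h1
  exact_mod_cast h1

/-- Frequencies of the product lie below λ_{p₁} + λ_{p₂}, and the symbol at scale q is one up to
¾λ_q. -/
theorem belowKernel_reproducing (h₁ : IsLPProfile χ₁) (h₂ : IsLPProfile χ₂) (hχ : IsLPProfile χ)
    {p₁ p₂ q : ℕ} (h : lam p₁ + lam p₂ ≤ 3 / 4 * lam q) (a b : E3) :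
    ∫ z, belowKernel χ q z * (belowKernel χ₁ p₁ (a - z) * belowKernel χ₂ p₂ (b - z)) =
      belowKernel χ₁ p₁ a * belowKernel χ₂ p₂ b := by
  have key := integral_mul_fourierInv_mul_fourierInv (integrable_symb h₁ p₁)
    (integrable_symb h₂ p₂) (integrable_belowKernel hχ q) (fun ξ η hξ hη => by
      rw [fourier_belowKernel hχ]
      refine symb_eq_one hχ ((norm_add_le _ _).trans ?_)
      have := norm_lt_of_symb_ne_zero h₁ hξ
      have := norm_lt_of_symb_ne_zero h₂ hη
      linarith) a b
  simp only [← ofReal_belowKernel, ← Complex.ofReal_mul] at key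
  rw [integral_complex_ofReal] at key
  exact_mod_cast key

/-- All kernels of a profile are L¹-normalized dilates of one function. Hence their L¹ norms do not
depend on the scale, and the constants of the theorem depend on χ alone. -/
theorem belowKernel_scale (χ : ℝ → ℝ) (p : ℕ) (x : E3) :
    belowKernel χ p x = lam p ^ 3 * belowKernel χ 0 (lam p • x) := by
  have hl := lam_pos p
  have h : 𝓕⁻ (symb χ p) x = (lam p : ℂ) ^ 3 * 𝓕⁻ (symb χ 0) (lam p • x) := by
    rw [fourierInv_eq_expI, fourierInv_eq_expI]
    have h1 := Measure.integral_comp_smul (volume : Measure E3)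
      (fun ξ => expI (inner ℝ ξ x) * symb χ p ξ) (lam p)
    have h2 : ∀ ξ : E3, expI (inner ℝ (lam p • ξ) x) * symb χ p (lam p • ξ) =
        expI (inner ℝ ξ (lam p • x)) * symb χ 0 ξ := by
      intro ξ
      rw [inner_smul_left, inner_smul_right, symb_eq, symb_eq, norm_smul,
        Real.norm_of_nonneg hl.le, mul_div_cancel_left₀ _ hl.ne']
      simp [lam]
    simp only [h2] at h1
    rw [h1, finrank_euclideanSpace_fin, abs_of_pos (by positivity), Complex.real_smul]
    push_cast
    rw [← mul_assoc, mul_inv_cancel₀ (by exact_mod_cast (pow_pos hl 3).ne'), one_mul]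
  have h3 := ofReal_belowKernel χ p x
  rw [h, ← ofReal_belowKernel] at h3
  exact_mod_cast h3

theorem integral_scale {φ : E3 → ℝ} {R : ℝ} (hR : 0 < R) :
    ∫ x, R ^ 3 * φ (R • x) = ∫ x, φ x := by
  rw [integral_const_mul, Measure.integral_comp_smul, finrank_euclideanSpace_fin,
    abs_of_pos (by positivity), smul_eq_mul, ← mul_assoc, mul_inv_cancel₀ (by positivity), one_mul]

theorem integral_norm_belowKernel (χ : ℝ → ℝ) (p : ℕ) :
    ∫ x, ‖belowKernel χ p x‖ = ∫ x, ‖belowKernel χ 0 x‖ := by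
  have hl := lam_pos p
  rw [← integral_scale (φ := fun x => ‖belowKernel χ 0 x‖) hl]
  congr 1; ext x
  rw [belowKernel_scale, norm_mul, Real.norm_of_nonneg (by positivity : 0 ≤ lam p ^ 3)]

theorem integral_norm_mul_belowKernel (χ : ℝ → ℝ) (p : ℕ) :
    ∫ x, ‖x‖ * ‖belowKernel χ p x‖ = (lam p)⁻¹ * ∫ x, ‖x‖ * ‖belowKernel χ 0 x‖ := by
  have hl := lam_pos p
  rw [← integral_scale (φ := fun x => ‖x‖ * ‖belowKernel χ 0 x‖) hl, ← integral_const_mul]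
  congr 1; ext x
  rw [belowKernel_scale, norm_mul, Real.norm_of_nonneg (by positivity : 0 ≤ lam p ^ 3), norm_smul,
    Real.norm_of_nonneg hl.le]
  field_simp

theorem fderiv_belowKernel_scale (hχ : IsLPProfile χ) (p : ℕ) (x : E3) :
    ‖fderiv ℝ (belowKernel χ p) x‖ =
      lam p ^ 4 * ‖fderiv ℝ (belowKernel χ 0) (lam p • x)‖ := by
  have hl := lam_pos p
  have hd : HasFDerivAt (belowKernel χ 0) (fderiv ℝ (belowKernel χ 0) (lam p • x)) (lam p • x) := by
    rw [← coe_lpK hχ]; exact (lpK hχ 0).hasFDerivAt _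
  have h1 : HasFDerivAt (belowKernel χ p)
      (lam p ^ 3 • (fderiv ℝ (belowKernel χ 0) (lam p • x)).comp
        (lam p • ContinuousLinearMap.id ℝ E3)) x := by
    rw [show belowKernel χ p = fun x => lam p ^ 3 * belowKernel χ 0 (lam p • x) from
      funext (belowKernel_scale χ p)]
    exact ((hd.comp x ((hasFDerivAt_id x).const_smul (lam p))).const_mul _)
  rw [h1.fderiv, ContinuousLinearMap.comp_smul, ContinuousLinearMap.comp_id, norm_smul, norm_smul,
    Real.norm_of_nonneg hl.le, Real.norm_of_nonneg (by positivity)]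
  ring

/-- The factor |x| compensates exactly for the derivative, so the commutator estimate loses no power
of λ_p. -/
theorem integral_norm_mul_fderiv_belowKernel (hχ : IsLPProfile χ) (p : ℕ) :
    ∫ x, ‖x‖ * ‖fderiv ℝ (belowKernel χ p) x‖ = ∫ x, ‖x‖ * ‖fderiv ℝ (belowKernel χ 0) x‖ := by
  have hl := lam_pos p
  rw [← integral_scale (φ := fun x => ‖x‖ * ‖fderiv ℝ (belowKernel χ 0) x‖) hl]
  congr 1; ext x
  rw [fderiv_belowKernel_scale hχ, norm_smul, Real.norm_of_nonneg hl.le]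
  ring

end Kernel

/-! ### Low-frequency projections of fields -/

section Below

variable {Ω : Dom} {χ χ' : ℝ → ℝ} {F : Type*} [NormedAddCommGroup F] [NormedSpace ℝ F]
  [CompleteSpace F] {f : E3 → F}

theorem conv_below_of_lt (hχ : IsLPProfile χ) (hχ' : IsLPProfile χ') {p q : ℕ} (h : p < q)
    (hf : L2On Ω f) :
    conv (belowKernel χ' q) (conv (belowKernel χ p) f) = conv (belowKernel χ p) f := by
  rw [conv_conv (rapid_below hχ' q) (rapid_below hχ p) hf, conv_belowKernel_of_lt hχ hχ' h]

theorem conv_below_self (hχ : IsLPProfile χ) (p : ℕ) (hf : L2On Ω f) (x : E3) :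
    conv (belowKernel χ p) (conv (belowKernel χ p) f) x =
      (2 : ℝ) • conv (belowKernel χ p) f x - conv (belowKernel (sqProfile χ) p) f x := by
  rw [conv_conv (rapid_below hχ p) (rapid_below hχ p) hf, conv]
  simp only [conv_belowKernel_self hχ, sub_smul, mul_smul]
  rw [integral_sub _ (hf.integrable_rapid (rapid_below hχ.sqProfile p) x), integral_smul]
  · rfl
  · exact (hf.integrable_rapid (rapid_below hχ p) x).smul (2 : ℝ)

theorem conv_below_mul {χ₁ χ₂ : ℝ → ℝ} (h₁ : IsLPProfile χ₁) (h₂ : IsLPProfile χ₂)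
    (hχ : IsLPProfile χ) {p₁ p₂ q : ℕ} (h : lam p₁ + lam p₂ ≤ 3 / 4 * lam q) {f g : E3 → ℝ}
    (hf : L2On Ω f) (hg : L2On Ω g) (x : E3) :
    conv (belowKernel χ q)
      (fun x => conv (belowKernel χ₁ p₁) f x * conv (belowKernel χ₂ p₂) g x) x =
      conv (belowKernel χ₁ p₁) f x * conv (belowKernel χ₂ p₂) g x :=
  conv_mul_of_reproducing (rapid_below hχ q) (rapid_below h₁ p₁) (rapid_below h₂ p₂)
    (belowKernel_reproducing h₁ h₂ hχ h) hf hg x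

theorem integral_inner_below {F : Type*} [NormedAddCommGroup F] [InnerProductSpace ℝ F]
    [CompleteSpace F] (hχ : IsLPProfile χ) (p : ℕ) {f g : E3 → F} (hf : L2On Ω f)
    (hg : L2On Ω g) :
    ∫ x, inner ℝ (conv (belowKernel χ p) f x) (g x) ∂Ω.measure =
      ∫ x, inner ℝ (f x) (conv (belowKernel χ p) g x) ∂Ω.measure := by
  rw [integral_inner_conv (rapid_below hχ p) hf hg]
  simp only [belowKernel_neg]

/-- Operator bound for the low-frequency projections. -/
def lpC (χ : ℝ → ℝ) : ℝ := ∫ x, ‖belowKernel χ 0 x‖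

theorem lpC_nonneg (χ : ℝ → ℝ) : 0 ≤ lpC χ := integral_nonneg fun _ => norm_nonneg _

omit [CompleteSpace F] in
theorem l2_below_le (hχ : IsLPProfile χ) (p : ℕ) (hf : L2On Ω f) :
    l2 Ω (conv (belowKernel χ p) f) ≤ lpC χ * l2 Ω f := by
  have := (hf.conv (rapid_below hχ p)).2
  rwa [integral_norm_belowKernel] at this

end Below

/-! ### Truncation of Schwartz functions -/

section Cutoff

/-- Distributional identities are given for compactly supported functions but are used with
reflected kernels, which are merely Schwartz. Multiplication by dilated bumps keeps functions and
derivatives under one multiple of the weight, as dominated convergence requires. -/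
theorem exists_schwartz_cutoff (ψ : 𝓢(E3, ℝ)) : ∃ φ : ℕ → E3 → ℝ,
    (∀ n, ContDiff ℝ ∞ (φ n)) ∧ (∀ n, HasCompactSupport (φ n)) ∧
    (∃ C, ∀ n y, ‖φ n y‖ ≤ C * wt y ∧ ‖fderiv ℝ (φ n) y‖ ≤ C * wt y) ∧
    (∀ y, Tendsto (fun n => φ n y) atTop (𝓝 (ψ y))) ∧
    ∀ y, Tendsto (fun n => fderiv ℝ (φ n) y) atTop (𝓝 (fderiv ℝ ψ y)) := by
  let θ : ContDiffBump (0 : E3) := ⟨1, 2, one_pos, one_lt_two⟩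
  have hθs : ContDiff ℝ ∞ θ := θ.contDiff
  obtain ⟨B, hB⟩ : ∃ B, ∀ y, ‖fderiv ℝ θ y‖ ≤ B :=
    (hθs.continuous_fderiv (by simp)).bounded_above_of_compact_support
      (θ.hasCompactSupport.fderiv (𝕜 := ℝ))
  have hB0 : 0 ≤ B := (norm_nonneg _).trans (hB 0)
  obtain ⟨C₁, hC₁, h₁⟩ := schwartz_exists_le_wt ψ
  obtain ⟨C₂, hC₂, h₂⟩ := schwartz_exists_le_wt (SchwartzMap.fderivCLM ℝ E3 ℝ ψ)
  simp only [SchwartzMap.fderivCLM_apply] at h₂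
  set s : ℕ → ℝ := fun n => ((n : ℝ) + 1)⁻¹ with hs
  have hs0 : ∀ n, 0 < s n := fun n => by simp only [hs]; positivity
  have hs1 : ∀ n, s n ≤ 1 := fun n => inv_le_one_of_one_le₀ (by simp)
  set φ : ℕ → E3 → ℝ := fun n y => θ (s n • y) * ψ y with hφ
  have hθn : ∀ n, ContDiff ℝ ∞ (fun y : E3 => θ (s n • y)) := fun n =>
    hθs.comp (contDiff_const_smul _)
  -- Near a given point the dilated bump is eventually one, so both convergences are eventual
  -- equalities.
  have hev : ∀ y : E3, ∀ᶠ n in atTop, φ n =ᶠ[𝓝 y] ψ := by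
    intro y
    obtain ⟨N, hN⟩ := exists_nat_gt ‖y‖
    filter_upwards [eventually_ge_atTop N] with n hn
    have hyn : ‖y‖ < n + 1 := by
      have : (N : ℝ) ≤ n := by exact_mod_cast hn
      linarith
    have : {z : E3 | ‖z‖ < n + 1} ∈ 𝓝 y :=
      (isOpen_lt continuous_norm continuous_const).mem_nhds hyn
    filter_upwards [this] with z hz
    have h1 : θ (s n • z) = 1 := by
      refine θ.one_of_mem_closedBall ?_
      rw [mem_closedBall_zero_iff, norm_smul, Real.norm_of_nonneg (hs0 n).le]
      simp only [hs]
      rw [inv_mul_le_iff₀ (by positivity)]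
      have hz' : ‖z‖ < n + 1 := hz
      change ‖z‖ ≤ (n + 1) * 1
      linarith
    simp only [hφ, h1, one_mul]
  refine ⟨φ, fun n => (hθn n).mul (ψ.smooth ⊤), fun n => ?_, ⟨C₂ + C₁ * B + C₁, fun n y => ?_⟩,
    fun y => ?_, fun y => ?_⟩
  · refine HasCompactSupport.mul_right ?_
    exact θ.hasCompactSupport.comp_homeomorph (Homeomorph.smulOfNeZero (s n) (hs0 n).ne')
  · have hw := (wt_pos y).le
    have hθ1 : ‖θ (s n • y)‖ ≤ 1 := by
      rw [Real.norm_of_nonneg θ.nonneg]; exact θ.le_one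
    constructor
    · simp only [hφ, norm_mul]
      calc _ ≤ 1 * (C₁ * wt y) := by gcongr; exact h₁ y
        _ ≤ _ := by nlinarith [mul_nonneg hC₂ hw, mul_nonneg (mul_nonneg hC₁ hB0) hw]
    · have hd1 : HasFDerivAt (fun y : E3 => θ (s n • y))
          ((fderiv ℝ θ (s n • y)).comp (s n • ContinuousLinearMap.id ℝ E3)) y :=
        (hθs.differentiable (by simp) (s n • y)).hasFDerivAt.comp y
          ((hasFDerivAt_id y).const_smul (s n))
      have hd := hd1.mul (ψ.hasFDerivAt y)
      change ‖fderiv ℝ ((fun y : E3 => θ (s n • y)) * ⇑ψ) y‖ ≤ _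
      rw [hd.fderiv]
      refine (norm_add_le _ _).trans ?_
      rw [norm_smul, norm_smul, ContinuousLinearMap.comp_smul, ContinuousLinearMap.comp_id,
        norm_smul, Real.norm_of_nonneg (hs0 n).le]
      calc _ ≤ 1 * (C₂ * wt y) + (C₁ * wt y) * (1 * B) := by
            gcongr
            · exact h₂ y
            · exact h₁ y
            · exact hs1 n
            · exact hB _
        _ ≤ _ := by nlinarith [mul_nonneg hC₁ hw]
  · refine tendsto_const_nhds.congr' ?_
    filter_upwards [hev y] with n hn
    exact hn.eq_of_nhds.symm
  · refine tendsto_const_nhds.congr' ?_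
    filter_upwards [hev y] with n hn
    exact hn.fderiv_eq.symm

/-- The function `y ↦ k (x - y)` for a Schwartz function `k`. -/
def reflS (k : 𝓢(E3, ℝ)) (x : E3) : 𝓢(E3, ℝ) :=
  SchwartzMap.compSubConstCLM ℝ x
    (SchwartzMap.compCLMOfContinuousLinearEquiv ℝ (ContinuousLinearEquiv.neg ℝ) k)

theorem reflS_apply (k : 𝓢(E3, ℝ)) (x y : E3) : reflS k x y = k (x - y) := by
  simp [reflS]

theorem fderiv_reflS (k : 𝓢(E3, ℝ)) (x y : E3) :
    fderiv ℝ (reflS k x) y = -fderiv ℝ k (x - y) := by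
  have h : HasFDerivAt (reflS k x) ((fderiv ℝ k (x - y)).comp (-ContinuousLinearMap.id ℝ E3)) y := by
    rw [show (reflS k x : E3 → ℝ) = fun y => k (x - y) from funext (reflS_apply k x)]
    exact (k.hasFDerivAt (x - y)).comp y ((hasFDerivAt_id y).const_sub x)
  rw [h.fderiv]
  simp

end Cutoff

/-! ### Distributional incompressibility -/

section Weak

variable {Ω : Dom}

/-- Divergence-free in the sense of distributions. -/
def IsDivFree (u : E3 → E3) : Prop := ∀ φ : E3 → ℝ, ContDiff ℝ ∞ φ → HasCompactSupport φ →
  ∫ x, fderiv ℝ φ x (u x) = 0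

theorem L2On.integrable_wt_mul {F : Type*} [NormedAddCommGroup F] {f : E3 → F} (hf : L2On Ω f) :
    Integrable (fun y => wt y * ‖f y‖) := by
  simpa [wt] using hf.integrable_wt_sub 0

theorem aestronglyMeasurable_clm_apply {G H : Type*} [NormedAddCommGroup G] [NormedSpace ℝ G]
    [NormedAddCommGroup H] [NormedSpace ℝ H] {A : E3 → G →L[ℝ] H} {f : E3 → G} {μ : Measure E3}
    (hA : Continuous A) (hf : AEStronglyMeasurable f μ) :
    AEStronglyMeasurable (fun x => A x (f x)) μ :=
  (ContinuousLinearMap.id ℝ (G →L[ℝ] H)).aestronglyMeasurable_comp₂ hA.aestronglyMeasurable hf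

theorem IsDivFree.integral_schwartz {u : E3 → E3} (h : IsDivFree u) (hu : L2On Ω u)
    (ψ : 𝓢(E3, ℝ)) : ∫ x, fderiv ℝ ψ x (u x) = 0 := by
  obtain ⟨φ, hs, hc, ⟨C, hC⟩, -, ht⟩ := exists_schwartz_cutoff ψ
  have hlim : Tendsto (fun n => ∫ x, fderiv ℝ (φ n) x (u x)) atTop
      (𝓝 (∫ x, fderiv ℝ ψ x (u x))) := by
    refine tendsto_integral_of_dominated_convergence (fun y => C * (wt y * ‖u y‖)) (fun n => ?_)
      (hu.integrable_wt_mul.const_mul C) (fun n => Eventually.of_forall fun y => ?_)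
      (Eventually.of_forall fun y => ?_)
    · exact aestronglyMeasurable_clm_apply ((hs n).continuous_fderiv (by simp))
        hu.aestronglyMeasurable
    · refine (ContinuousLinearMap.le_opNorm _ _).trans ?_
      rw [← mul_assoc]
      exact mul_le_mul_of_nonneg_right (hC n y).2 (norm_nonneg _)
    · exact ((ContinuousLinearMap.apply ℝ ℝ (u y)).continuous.tendsto _).comp (ht y)
  simp only [h _ (hs _) (hc _)] at hlim
  exact tendsto_nhds_unique hlim tendsto_const_nhds

theorem L2On.clm {F G : Type*} [NormedAddCommGroup F] [NormedSpace ℝ F] [NormedAddCommGroup G]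
    [NormedSpace ℝ G] {f : E3 → F} (hf : L2On Ω f) (A : F →L[ℝ] G) : L2On Ω (fun x => A (f x)) :=
  ⟨hf.isFunOn.comp _, A.comp_memLp' hf.memLp⟩

theorem L2On.coord {u : E3 → E3} (hu : L2On Ω u) (j : Fin 3) : L2On Ω (fun x => u x j) :=
  hu.clm (EuclideanSpace.proj j : E3 →L[ℝ] ℝ)

theorem conv_coord {k : E3 → ℝ} (hk : Rapid k) {u : E3 → E3} (hu : L2On Ω u) (j : Fin 3)
    (x : E3) : conv k (fun x => u x j) x = conv k u x j :=
  conv_clm hk hu (EuclideanSpace.proj j : E3 →L[ℝ] ℝ) x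

/-- Partial derivatives of kernels. -/
def pd (j : Fin 3) (k : 𝓢(E3, ℝ)) : 𝓢(E3, ℝ) := ∂_{e j} k

theorem pd_apply (j : Fin 3) (k : 𝓢(E3, ℝ)) (x : E3) : pd j k x = fderiv ℝ k x (e j) := by
  rw [pd, SchwartzMap.lineDerivOp_apply_eq_fderiv]

theorem pd_neg {k : 𝓢(E3, ℝ)} (hk : ∀ x, k (-x) = k x) (j : Fin 3) (x : E3) :
    pd j k (-x) = -pd j k x := by
  rw [pd_apply, pd_apply]
  have h : HasFDerivAt k ((fderiv ℝ k (-x)).comp (-ContinuousLinearMap.id ℝ E3)) x := by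
    have h1 := (k.hasFDerivAt (-x)).comp x (hasFDerivAt_id x).neg
    refine h1.congr_of_eventuallyEq (Eventually.of_forall fun y => (hk y).symm)
  rw [h.fderiv]
  simp

theorem fderiv_conv_e {F : Type*} [NormedAddCommGroup F] [NormedSpace ℝ F] (k : 𝓢(E3, ℝ))
    {f : E3 → F} (hf : L2On Ω f) (x : E3) (j : Fin 3) :
    fderiv ℝ (conv k f) x (e j) = conv (pd j k) f x := fderiv_conv_apply k hf x (e j)

theorem clm_apply_eq_sum {F : Type*} [NormedAddCommGroup F] [NormedSpace ℝ F] (A : E3 →L[ℝ] F)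
    (v : E3) : A v = ∑ j : Fin 3, v j • A (e j) := by
  conv_lhs => rw [clm_eq_sum A]
  simp

theorem fderiv_conv_eq_sum {F : Type*} [NormedAddCommGroup F] [NormedSpace ℝ F] (k : 𝓢(E3, ℝ))
    {f : E3 → F} (hf : L2On Ω f) (x v : E3) :
    fderiv ℝ (conv k f) x v = ∑ j : Fin 3, v j • conv (pd j k) f x := by
  rw [clm_apply_eq_sum]
  simp only [fderiv_conv_e k hf]

/-- The distributional identity is tested with the reflected kernel y ↦ k(x - y). -/
theorem IsDivFree.sum_conv {u : E3 → E3} (h : IsDivFree u) (hu : L2On Ω u) (k : 𝓢(E3, ℝ))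
    (x : E3) : ∑ j : Fin 3, conv (pd j k) u x j = 0 := by
  have h1 := h.integral_schwartz hu (reflS k x)
  have e1 : ∀ y, fderiv ℝ (reflS k x) y (u y) = ∑ j : Fin 3, -(pd j k (x - y) * u y j) := by
    intro y
    rw [fderiv_reflS, neg_apply, clm_apply_eq_sum, Finset.sum_neg_distrib]
    simp only [pd_apply, smul_eq_mul, mul_comm]
  simp only [e1] at h1
  rw [integral_finsetSum] at h1
  · rw [← neg_eq_zero, ← h1, ← Finset.sum_neg_distrib]
    congr 1; ext j
    rw [← conv_coord (rapid_schwartz _) hu, conv_eq, ← integral_neg]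
    rfl
  · intro j _
    exact ((hu.coord j).integrable_rapid_sub (rapid_schwartz (pd j k)) x).neg

theorem IsDivFree.divergence_conv {u : E3 → E3} (h : IsDivFree u) (hu : L2On Ω u) (k : 𝓢(E3, ℝ))
    (x : E3) : divergence (conv k u) x = 0 := by
  rw [divergence]
  simp only [fderiv_conv_e k hu]
  exact h.sum_conv hu k x

theorem integral_mul_conv_pd {k : 𝓢(E3, ℝ)} (hk : ∀ x, k (-x) = k x) (j : Fin 3) {f g : E3 → ℝ}
    (hf : L2On Ω f) (hg : L2On Ω g) :
    ∫ x, f x * conv (pd j k) g x ∂Ω.measure = -∫ x, conv (pd j k) f x * g x ∂Ω.measure := by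
  have h := integral_inner_conv (rapid_schwartz (pd j k)) hg hf
  simp only [Real.inner_apply, pd_neg hk] at h
  have hn : conv (fun y => -pd j k y) f = fun x => -conv (pd j k) f x := by
    ext x; simp [conv, integral_neg]
  rw [hn] at h
  simp only [mul_neg, integral_neg] at h
  simp only [mul_comm] at h ⊢
  exact h

/-- A divergence-free field is orthogonal to the gradient of a band-limited function. -/
theorem IsDivFree.integral_fderiv_eq_zero {h : E3 → E3} (hd : IsDivFree h) (hh : L2On Ω h)
    {k : 𝓢(E3, ℝ)} (hk : ∀ x, k (-x) = k x) {g : E3 → ℝ} (hg : L2On Ω g)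
    (hrep : ∀ x, conv k g x = g x) : ∫ x, fderiv ℝ g x (h x) ∂Ω.measure = 0 := by
  have e1 : ∀ x, fderiv ℝ g x (h x) = ∑ j : Fin 3, h x j * conv (pd j k) g x := by
    intro x
    conv_lhs => rw [← funext hrep]
    rw [fderiv_conv_eq_sum k hg]
    rfl
  simp only [e1]
  have hi : ∀ j : Fin 3, Integrable (fun x => h x j * conv (pd j k) g x) Ω.measure := fun j =>
    (hh.coord j).memLp.integrable_mul (hg.conv (rapid_schwartz (pd j k))).1.memLp
  have hi' : ∀ j : Fin 3, Integrable (fun x => conv (pd j k) (fun x => h x j) x * g x) Ω.measure :=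
    fun j => ((hh.coord j).conv (rapid_schwartz (pd j k))).1.memLp.integrable_mul hg.memLp
  rw [integral_finsetSum _ fun j _ => hi j]
  simp only [fun j => integral_mul_conv_pd hk j (hh.coord j) hg]
  rw [Finset.sum_neg_distrib, ← integral_finsetSum _ fun j _ => hi' j]
  simp only [← Finset.sum_mul, conv_coord (rapid_schwartz _) hh, hd.sum_conv hh k, zero_mul,
    integral_zero, neg_zero]

end Weak

/-! ### The trilinear form of the nonlinearity -/

section Tri

variable {Ω : Dom}

/-- Fields with a bounded derivative. -/
structure BddDeriv (b : E3 → E3) : Prop where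
  diff : Differentiable ℝ b
  cont : Continuous (fderiv ℝ b)
  bound : ∃ C, ∀ x, ‖fderiv ℝ b x‖ ≤ C

theorem opNorm_le_sum {F : Type*} [NormedAddCommGroup F] [NormedSpace ℝ F] (A : E3 →L[ℝ] F) :
    ‖A‖ ≤ ∑ j : Fin 3, ‖A (e j)‖ := by
  refine A.opNorm_le_bound (Finset.sum_nonneg fun j _ => norm_nonneg _) fun v => ?_
  rw [clm_apply_eq_sum, Finset.sum_mul]
  refine (norm_sum_le _ _).trans (Finset.sum_le_sum fun j _ => ?_)
  rw [norm_smul, mul_comm]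
  exact mul_le_mul_of_nonneg_left (PiLp.norm_apply_le v j) (norm_nonneg _)

theorem exists_norm_fderiv_conv_le (Ω : Dom) {F : Type*} [NormedAddCommGroup F] [NormedSpace ℝ F]
    (k : 𝓢(E3, ℝ)) : ∃ C, 0 ≤ C ∧ ∀ f : E3 → F, L2On Ω f → ∀ x,
      ‖fderiv ℝ (conv k f) x‖ ≤ C * l2 Ω f := by
  choose C hC h using fun j => exists_norm_conv_le (F := F) Ω (rapid_schwartz (pd j k))
  refine ⟨∑ j, C j, Finset.sum_nonneg fun j _ => hC j, fun f hf x => ?_⟩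
  refine (opNorm_le_sum _).trans ?_
  rw [Finset.sum_mul]
  refine Finset.sum_le_sum fun j _ => ?_
  rw [fderiv_conv_e k hf]
  exact h j f hf x

theorem bddDeriv_conv (k : 𝓢(E3, ℝ)) {f : E3 → E3} (hf : L2On Ω f) : BddDeriv (conv k f) := by
  obtain ⟨C, -, h⟩ := exists_norm_fderiv_conv_le (F := E3) Ω k
  exact ⟨differentiable_conv k hf, (contDiff_conv k hf).continuous_fderiv (by simp),
    _, h f hf⟩

theorem bddDeriv_below {χ : ℝ → ℝ} (hχ : IsLPProfile χ) (p : ℕ) {f : E3 → E3} (hf : L2On Ω f) :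
    BddDeriv (conv (belowKernel χ p) f) := by
  rw [← coe_lpK hχ]
  exact bddDeriv_conv _ hf

/-- The trilinear form `∫ (a · ∇) b · c`. -/
def tri (Ω : Dom) (a b c : E3 → E3) : ℝ := ∫ x, inner ℝ (c x) (fderiv ℝ b x (a x)) ∂Ω.measure

variable {a a' b b' c c' : E3 → E3}

theorem norm_tri_integrand_le {C : ℝ} (hb : ∀ x v, ‖fderiv ℝ b x v‖ ≤ C * ‖v‖) (x : E3) :
    ‖inner ℝ (c x) (fderiv ℝ b x (a x))‖ ≤ C * (‖a x‖ * ‖c x‖) := by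
  refine (norm_inner_le_norm _ _).trans ?_
  calc _ ≤ ‖c x‖ * (C * ‖a x‖) := by gcongr; exact hb x _
    _ = _ := by ring

theorem integrable_tri (ha : L2On Ω a) (hb : BddDeriv b) (hc : L2On Ω c) :
    Integrable (fun x => inner ℝ (c x) (fderiv ℝ b x (a x))) Ω.measure := by
  obtain ⟨C, hC⟩ := hb.bound
  refine ((ha.integrable_mul hc).const_mul C).mono'
    (hc.memLp.1.inner (aestronglyMeasurable_clm_apply hb.cont ha.memLp.1))
    (Eventually.of_forall fun x => norm_tri_integrand_le (C := C) (fun x v => ?_) x)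
  exact (ContinuousLinearMap.le_opNorm _ _).trans
    (mul_le_mul_of_nonneg_right (hC x) (norm_nonneg _))

theorem abs_tri_le (ha : L2On Ω a) (hc : L2On Ω c) {C : ℝ} (h0 : 0 ≤ C)
    (hb : ∀ x v, ‖fderiv ℝ b x v‖ ≤ C * ‖v‖) : |tri Ω a b c| ≤ C * (l2 Ω a * l2 Ω c) := by
  refine le_trans ?_ (mul_le_mul_of_nonneg_left (ha.integral_mul_le hc) h0)
  rw [← Real.norm_eq_abs, ← integral_const_mul]
  exact norm_integral_le_of_norm_le ((ha.integrable_mul hc).const_mul C)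
    (Eventually.of_forall fun x => norm_tri_integrand_le hb x)

theorem tri_add_left (ha : L2On Ω a) (ha' : L2On Ω a') (hb : BddDeriv b) (hc : L2On Ω c) :
    tri Ω (fun x => a x + a' x) b c = tri Ω a b c + tri Ω a' b c := by
  simp only [tri, map_add, inner_add_right]
  exact integral_add (integrable_tri ha hb hc) (integrable_tri ha' hb hc)

theorem tri_add_right (ha : L2On Ω a) (hb : BddDeriv b) (hc : L2On Ω c) (hc' : L2On Ω c') :
    tri Ω a b (fun x => c x + c' x) = tri Ω a b c + tri Ω a b c' := by
  simp only [tri, inner_add_left]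
  exact integral_add (integrable_tri ha hb hc) (integrable_tri ha hb hc')

theorem tri_add_mid (ha : L2On Ω a) (hb : BddDeriv b) (hb' : BddDeriv b') (hc : L2On Ω c) :
    tri Ω a (fun x => b x + b' x) c = tri Ω a b c + tri Ω a b' c := by
  have h : ∀ x, fderiv ℝ (fun x => b x + b' x) x = fderiv ℝ b x + fderiv ℝ b' x := fun x =>
    fderiv_fun_add (hb.diff x) (hb'.diff x)
  simp only [tri, h, add_apply, inner_add_right]
  exact integral_add (integrable_tri ha hb hc) (integrable_tri ha hb' hc)

theorem inner_eq_sum (x y : E3) : inner ℝ x y = ∑ i, x i * y i := by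
  simp [PiLp.inner_apply, mul_comm]

theorem fderiv_coord {b : E3 → E3} (hb : Differentiable ℝ b) (i : Fin 3) (x v : E3) :
    fderiv ℝ (fun x => b x i) x v = (fderiv ℝ b x v) i := by
  have := ((EuclideanSpace.proj i : E3 →L[ℝ] ℝ).hasFDerivAt.comp x (hb x).hasFDerivAt)
  have h2 : HasFDerivAt (fun x => b x i)
    ((EuclideanSpace.proj i : E3 →L[ℝ] ℝ).comp (fderiv ℝ b x)) x := this
  rw [h2.fderiv]
  rfl

end Tri

/-! ### Cancellations in the trilinear form -/

section Flux

variable {Ω : Dom} {χ χ₁ χ₂ η : ℝ → ℝ}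

theorem L2On.mul_of_bdd {f g : E3 → ℝ} (hf : L2On Ω f) (hg : L2On Ω g) {C : ℝ}
    (hC : ∀ x, ‖g x‖ ≤ C) : L2On Ω (fun x => f x * g x) := by
  refine hf.of_le (C := C) (hf.isFunOn.comp₂ hg.isFunOn _) (hf.memLp.1.mul hg.memLp.1) fun x => ?_
  rw [norm_mul, mul_comm]
  exact mul_le_mul_of_nonneg_right (hC x) (norm_nonneg _)

theorem L2On.below {F : Type*} [NormedAddCommGroup F] [NormedSpace ℝ F] {f : E3 → F}
    (hf : L2On Ω f) (hχ : IsLPProfile χ) (p : ℕ) : L2On Ω (NSE.conv (belowKernel χ p) f) :=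
  (hf.conv (rapid_below hχ p)).1

theorem exists_below_bound {F : Type*} [NormedAddCommGroup F] [NormedSpace ℝ F] {f : E3 → F}
    (hf : L2On Ω f) (hχ : IsLPProfile χ) (p : ℕ) : ∃ C, ∀ x, ‖conv (belowKernel χ p) f x‖ ≤ C := by
  obtain ⟨C, -, h⟩ := exists_norm_conv_le (F := F) Ω (rapid_below hχ p)
  exact ⟨_, h f hf⟩

theorem differentiable_below {F : Type*} [NormedAddCommGroup F] [NormedSpace ℝ F] {f : E3 → F}
    (hf : L2On Ω f) (hχ : IsLPProfile χ) (p : ℕ) : Differentiable ℝ (conv (belowKernel χ p) f) := by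
  rw [← coe_lpK hχ]
  exact differentiable_conv _ hf

theorem lpK_neg (hχ : IsLPProfile χ) (p : ℕ) (x : E3) : lpK hχ p (-x) = lpK hχ p x := by
  rw [coe_lpK]; exact belowKernel_neg χ p x

/-- Antisymmetry of the trilinear form for band-limited fields. -/
theorem tri_antisymm (h₁ : IsLPProfile χ₁) (h₂ : IsLPProfile χ₂) {p₁ p₂ q : ℕ}
    (hq : lam p₁ + lam p₂ ≤ 3 / 4 * lam q) {h f g : E3 → E3} (hd : IsDivFree h) (hh : L2On Ω h)
    (hf : L2On Ω f) (hg : L2On Ω g) :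
    tri Ω h (conv (belowKernel χ₁ p₁) f) (conv (belowKernel χ₂ p₂) g) =
      -tri Ω h (conv (belowKernel χ₂ p₂) g) (conv (belowKernel χ₁ p₁) f) := by
  set a := conv (belowKernel χ₁ p₁) f with ha
  set b := conv (belowKernel χ₂ p₂) g with hb
  have ha2 : L2On Ω a := hf.below h₁ p₁
  have hb2 : L2On Ω b := hg.below h₂ p₂
  have had : Differentiable ℝ a := differentiable_below hf h₁ p₁
  have hbd : Differentiable ℝ b := differentiable_below hg h₂ p₂
  have hi1 := integrable_tri hh (bddDeriv_below h₁ p₁ hf) hb2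
  have hi2 := integrable_tri hh (bddDeriv_below h₂ p₂ hg) ha2
  rw [eq_neg_iff_add_eq_zero, tri, tri, ← integral_add hi1 hi2]
  obtain ⟨C, hC⟩ := exists_below_bound hg h₂ p₂
  have hbi : ∀ i x, ‖b x i‖ ≤ C := fun i x => (PiLp.norm_apply_le _ i).trans (hC x)
  -- The sum of the two integrands is the derivative of a·b along `h`. Each product of components is
  -- reproduced by a kernel at scale q, so its gradient is orthogonal to the divergence-free field
  -- `h`.
  have key : ∀ i, ∫ x, fderiv ℝ (fun x => a x i * b x i) x (h x) ∂Ω.measure = 0 := by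
    intro i
    refine hd.integral_fderiv_eq_zero hh (lpK_neg h₁ q)
      ((ha2.coord i).mul_of_bdd (hb2.coord i) (hbi i)) fun x => ?_
    rw [coe_lpK]
    have := conv_below_mul h₁ h₂ h₁ hq (hf.coord i) (hg.coord i) x
    simpa only [conv_coord (rapid_below h₁ p₁) hf, conv_coord (rapid_below h₂ p₂) hg] using this
  have e1 : ∀ i x v, fderiv ℝ (fun x => a x i * b x i) x v =
      a x i * (fderiv ℝ b x v) i + b x i * (fderiv ℝ a x v) i := by
    intro i x v
    have d1 : DifferentiableAt ℝ (fun x => a x i) x :=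
      (EuclideanSpace.proj i : E3 →L[ℝ] ℝ).differentiableAt.comp x (had x)
    have d2 : DifferentiableAt ℝ (fun x => b x i) x :=
      (EuclideanSpace.proj i : E3 →L[ℝ] ℝ).differentiableAt.comp x (hbd x)
    rw [fderiv_fun_mul d1 d2]
    simp only [add_apply, smul_apply, smul_eq_mul, fderiv_coord had, fderiv_coord hbd]
  have hint : ∀ i, Integrable (fun x => fderiv ℝ (fun x => a x i * b x i) x (h x)) Ω.measure := by
    intro i
    simp only [e1]
    have hA : ∀ {f : E3 → E3} {χ : ℝ → ℝ} (p : ℕ), IsLPProfile χ → L2On Ω f →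
        MemLp (fun x => fderiv ℝ (conv (belowKernel χ p) f) x (h x) i) 2 Ω.measure := by
      intro f χ p hχ hf
      obtain ⟨hdf, hcf, B, hB⟩ := bddDeriv_below hχ p hf
      refine hh.memLp.of_le_mul (c := B)
        ((EuclideanSpace.proj i : E3 →L[ℝ] ℝ).continuous.comp_aestronglyMeasurable
          (aestronglyMeasurable_clm_apply hcf hh.memLp.1)) (Eventually.of_forall fun x => ?_)
      refine (PiLp.norm_apply_le _ i).trans ((ContinuousLinearMap.le_opNorm _ _).trans ?_)
      exact mul_le_mul_of_nonneg_right (hB x) (norm_nonneg _)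
    exact ((ha2.coord i).memLp.integrable_mul (hA p₂ h₂ hg)).add
      ((hb2.coord i).memLp.integrable_mul (hA p₁ h₁ hf))
  calc _ = ∫ x, ∑ i, fderiv ℝ (fun x => a x i * b x i) x (h x) ∂Ω.measure := by
        congr 1; ext x
        simp only [e1, inner_eq_sum, ← Finset.sum_add_distrib]
        refine Finset.sum_congr rfl fun i _ => by ring
    _ = 0 := by
        rw [integral_finsetSum _ fun i _ => hint i]
        simp [key]

/-- A convolution averages translates, and a translate of `u` is divergence-free because test
functions may be translated; Fubini exchanges the two integrals. -/
theorem IsDivFree.conv {u : E3 → E3} {k : E3 → ℝ} (hu : IsDivFree u) (h2 : L2On Ω u)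
    (hk : Rapid k) : IsDivFree (conv k u) := by
  intro φ hφ hφc
  obtain ⟨C, hC, hb⟩ := schwartz_exists_le_wt
    (SchwartzMap.fderivCLM ℝ E3 ℝ (hφc.toSchwartzMap hφ))
  have hb' : ∀ y, ‖fderiv ℝ φ y‖ ≤ C * wt y := hb
  have hcont : Continuous (fderiv ℝ φ) := hφ.continuous_fderiv (by simp)
  have hint : Integrable (fun q : E3 × E3 => k q.2 * fderiv ℝ φ q.1 (u (q.1 - q.2)))
      (volume.prod volume) := by
    have hum : AEStronglyMeasurable (fun q : E3 × E3 => u (q.1 - q.2)) (volume.prod volume) :=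
      h2.aestronglyMeasurable.comp_quasiMeasurePreserving
        (quasiMeasurePreserving_sub (volume : Measure E3) (volume : Measure E3))
    have hm : AEStronglyMeasurable (fun q : E3 × E3 => k q.2 * fderiv ℝ φ q.1 (u (q.1 - q.2)))
        (volume.prod volume) :=
      ((hk.continuous.comp continuous_snd).aestronglyMeasurable).mul
        ((ContinuousLinearMap.id ℝ (E3 →L[ℝ] ℝ)).aestronglyMeasurable_comp₂
          (hcont.comp continuous_fst).aestronglyMeasurable hum)
    have hku := (h2.norm.conv hk.norm).1
    have hbd : ∀ x y, ‖k y * fderiv ℝ φ x (u (x - y))‖ ≤ ‖fderiv ℝ φ x‖ * (‖k y‖ • ‖u (x - y)‖) := by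
      intro x y
      rw [norm_mul, smul_eq_mul]
      calc _ ≤ ‖k y‖ * (‖fderiv ℝ φ x‖ * ‖u (x - y)‖) := by
            gcongr; exact ContinuousLinearMap.le_opNorm _ _
        _ = _ := by ring
    have hI : ∀ x, Integrable (fun y => k y * fderiv ℝ φ x (u (x - y))) := by
      intro x
      have h := (h2.integrable_rapid hk x)
      have := (fderiv ℝ φ x).integrable_comp h
      simpa using this
    rw [integrable_prod_iff hm]
    refine ⟨Eventually.of_forall hI, ?_⟩
    refine (hku.integrable_wt_mul.const_mul C).mono' hm.norm.integral_prod_right'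
      (Eventually.of_forall fun x => ?_)
    have h0 : 0 ≤ NSE.conv (fun y => ‖k y‖) (fun y => ‖u y‖) x :=
      integral_nonneg fun y => smul_nonneg (norm_nonneg _) (norm_nonneg _)
    rw [Real.norm_of_nonneg (integral_nonneg fun y => norm_nonneg _), Real.norm_of_nonneg h0,
      ← mul_assoc]
    refine le_trans ?_ (mul_le_mul_of_nonneg_right (hb' x) h0)
    rw [NSE.conv, ← integral_const_mul]
    exact integral_mono (hI x).norm ((h2.norm.integrable_rapid hk.norm x).const_mul _) (hbd x)
  calc ∫ x, fderiv ℝ φ x (NSE.conv k u x) = ∫ x, ∫ y, k y * fderiv ℝ φ x (u (x - y)) := by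
        congr 1; ext x
        rw [NSE.conv, ← ContinuousLinearMap.integral_comp_comm _ (h2.integrable_rapid hk x)]
        simp
    _ = ∫ y, ∫ x, k y * fderiv ℝ φ x (u (x - y)) := integral_integral_swap hint
    _ = 0 := by
        refine integral_eq_zero_of_ae (Eventually.of_forall fun y => ?_)
        have h1 := hu (fun x => φ (x + y)) (hφ.comp (contDiff_id.add contDiff_const))
          (hφc.comp_homeomorph (Homeomorph.addRight y))
        simp only [fderiv_comp_add_right] at h1
        have h3 := integral_sub_right_eq_self (μ := volume) (fun x => fderiv ℝ φ (x + y) (u x)) y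
        simp only [sub_add_cancel] at h3
        simp [integral_const_mul, h3, h1]

theorem IsDivFree.sub {u v : E3 → E3} (hu : IsDivFree u) (hv : IsDivFree v) (h2 : L2On Ω u)
    (h2' : L2On Ω v) : IsDivFree (fun x => u x - v x) := by
  intro φ hφ hφc
  obtain ⟨C, hC, hb⟩ := schwartz_exists_le_wt
    (SchwartzMap.fderivCLM ℝ E3 ℝ (hφc.toSchwartzMap hφ))
  have hb' : ∀ y, ‖fderiv ℝ φ y‖ ≤ C * wt y := hb
  have hI : ∀ {w : E3 → E3}, L2On Ω w → Integrable (fun x => fderiv ℝ φ x (w x)) := by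
    intro w hw
    refine (hw.integrable_wt_mul.const_mul C).mono' (aestronglyMeasurable_clm_apply
      (hφ.continuous_fderiv (by simp)) hw.aestronglyMeasurable) (Eventually.of_forall fun x => ?_)
    refine (ContinuousLinearMap.le_opNorm _ _).trans ?_
    rw [← mul_assoc]
    exact mul_le_mul_of_nonneg_right (hb' x) (norm_nonneg _)
  simp only [map_sub]
  rw [integral_sub (hI h2) (hI h2'), hu φ hφ hφc, hv φ hφ hφc, sub_zero]

/-- Transport of a low-frequency field by itself, tested with a band-limited field. -/
theorem tri_low_low (hχ : IsLPProfile χ) (hη : IsLPProfile η) {r p : ℕ}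
    (hp : lam r + lam r ≤ 3 / 4 * lam p) {u : E3 → E3} (hd : IsDivFree u) (hu : L2On Ω u) :
    tri Ω (conv (belowKernel χ r) u) (conv (belowKernel η p) u) (conv (belowKernel χ r) u) =
      -tri Ω (conv (belowKernel χ r) u) (conv (belowKernel χ r) u) u := by
  set l := conv (belowKernel χ r) u with hl
  have hl2 : L2On Ω l := hu.below hχ r
  have hld : Differentiable ℝ l := differentiable_below hu hχ r
  obtain ⟨C, hC⟩ := exists_below_bound hu hχ r
  have hli : ∀ i x, ‖l x i‖ ≤ C := fun i x => (PiLp.norm_apply_le _ i).trans (hC x)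
  have hll : ∀ i j, L2On Ω (fun x => l x i * l x j) := fun i j =>
    (hl2.coord i).mul_of_bdd (hl2.coord j) (hli j)
  -- The products of components have frequencies at which the symbol at scale `p` is one. Once the
  -- derivative is moved onto them, the multiplier in front of `u` therefore disappears.
  have hrep : ∀ i j x, conv (lpK hη p) (fun x => l x i * l x j) x = l x i * l x j := by
    intro i j x
    rw [coe_lpK]
    have := conv_below_mul hχ hχ hη hp (hu.coord i) (hu.coord j) x
    simpa only [conv_coord (rapid_below hχ r) hu] using this
  have hpd : ∀ i j x, conv (pd j (lpK hη p)) (fun x => l x i * l x j) x =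
      l x i * (fderiv ℝ l x (e j)) j + l x j * (fderiv ℝ l x (e j)) i := by
    intro i j x
    rw [← fderiv_conv_e _ (hll i j), funext (hrep i j)]
    have d : ∀ i, DifferentiableAt ℝ (fun x => l x i) x := fun i =>
      (EuclideanSpace.proj i : E3 →L[ℝ] ℝ).differentiableAt.comp x (hld x)
    rw [fderiv_fun_mul (d i) (d j)]
    simp only [add_apply, smul_apply, smul_eq_mul, fderiv_coord hld]
  -- This removes the half of the product rule in which the derivative falls on the transporting
  -- component.
  have hdiv : ∀ x, ∑ j, (fderiv ℝ l x (e j)) j = 0 := by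
    intro x
    have := hd.divergence_conv hu (lpK hχ r) x
    rwa [coe_lpK] at this
  have hI : ∀ i j, Integrable (fun x => (l x i * l x j) *
      conv (pd j (lpK hη p)) (fun x => u x i) x) Ω.measure := fun i j =>
    (hll i j).memLp.integrable_mul ((hu.coord i).conv (rapid_schwartz _)).1.memLp
  have hI' : ∀ i j, Integrable (fun x =>
      conv (pd j (lpK hη p)) (fun x => l x i * l x j) x * u x i) Ω.measure := fun i j =>
    ((hll i j).conv (rapid_schwartz _)).1.memLp.integrable_mul (hu.coord i).memLp
  calc tri Ω l (conv (belowKernel η p) u) l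
      = ∫ x, ∑ i, ∑ j, (l x i * l x j) * conv (pd j (lpK hη p)) (fun x => u x i) x ∂Ω.measure := by
        rw [tri]
        congr 1; ext x
        rw [inner_eq_sum]
        refine Finset.sum_congr rfl fun i _ => ?_
        rw [← coe_lpK hη, fderiv_conv_eq_sum _ hu]
        simp only [WithLp.ofLp_sum, Finset.sum_apply, WithLp.ofLp_smul, Pi.smul_apply, smul_eq_mul,
          Finset.mul_sum, conv_coord (rapid_schwartz _) hu, mul_assoc]
    _ = -∫ x, ∑ i, ∑ j,
          conv (pd j (lpK hη p)) (fun x => l x i * l x j) x * u x i ∂Ω.measure := by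
        rw [integral_finsetSum _ fun i _ => integrable_finsetSum _ fun j _ => hI i j,
          integral_finsetSum _ fun i _ => integrable_finsetSum _ fun j _ => hI' i j,
          ← Finset.sum_neg_distrib]
        refine Finset.sum_congr rfl fun i _ => ?_
        rw [integral_finsetSum _ fun j _ => hI i j, integral_finsetSum _ fun j _ => hI' i j,
          ← Finset.sum_neg_distrib]
        refine Finset.sum_congr rfl fun j _ => ?_
        exact integral_mul_conv_pd (lpK_neg hη p) j (hll i j) (hu.coord i)
    _ = _ := by
        rw [tri]
        congr 2; ext x
        rw [inner_eq_sum, clm_apply_eq_sum]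
        refine Finset.sum_congr rfl fun i _ => ?_
        simp only [hpd, WithLp.ofLp_sum, Finset.sum_apply, WithLp.ofLp_smul, Pi.smul_apply,
          smul_eq_mul, ← Finset.sum_mul, Finset.sum_add_distrib, ← Finset.mul_sum, hdiv, mul_zero,
          zero_add]
        ring

/-- Projecting first to the larger ball changes nothing, so the gradient at scale p is an average of
the gradient at scale q against the kernel of scale p. -/
theorem fderiv_below_le (hχ : IsLPProfile χ) (hη : IsLPProfile η) {p q : ℕ} (hpq : p < q)
    {u : E3 → E3} (hu : L2On Ω u) {V : ℝ}
    (hV : ∀ x v, ‖fderiv ℝ (conv (belowKernel χ q) u) x v‖ ≤ V * ‖v‖) (x v : E3) :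
    ‖fderiv ℝ (conv (belowKernel η p) u) x v‖ ≤ lpC η * V * ‖v‖ := by
  have hp := rapid_below hη p
  have h1 : conv (belowKernel η p) u = conv (lpK hχ q) (conv (belowKernel η p) u) := by
    rw [coe_lpK, conv_below_of_lt hη hχ hpq hu]
  rw [h1, fderiv_conv_apply _ (hu.below hη p), conv_conv_comm (rapid_schwartz _) hp hu, mul_assoc,
    lpC, ← integral_norm_belowKernel η p]
  refine norm_conv_le_of_bound hp (fun y => ?_) x
  rw [← fderiv_conv_apply _ hu, coe_lpK]
  exact hV y v

end Flux

/-! ### Commutator estimate and bound of the flux -/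

section Commutator

variable {Ω : Dom} {χ χ₁ χ₂ η : ℝ → ℝ}

theorem norm_sub_le_of_fderiv {l : E3 → E3} (hl : Differentiable ℝ l) {L : ℝ}
    (hL : ∀ x v, ‖fderiv ℝ l x v‖ ≤ L * ‖v‖) (h0 : 0 ≤ L) (x y : E3) :
    ‖l x - l (x - y)‖ ≤ L * ‖y‖ := by
  have h := convex_univ.norm_image_sub_le_of_norm_fderiv_le (𝕜 := ℝ) (f := l) (C := L)
    (fun x _ => hl x) (fun x _ => (fderiv ℝ l x).opNorm_le_bound h0 (hL x))
    (Set.mem_univ (x - y)) (Set.mem_univ x)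
  simpa using h

/-- The commutator estimate, for the trilinear form symmetrized by the evenness of the kernel. -/
theorem abs_tri_commutator_le (k : 𝓢(E3, ℝ)) (hk : ∀ x, k (-x) = k x) {l h : E3 → E3}
    (hl2 : L2On Ω l) (hl : Differentiable ℝ l) {B L : ℝ} (hB : ∀ x, ‖l x‖ ≤ B)
    (hL : ∀ x v, ‖fderiv ℝ l x v‖ ≤ L * ‖v‖) (h0 : 0 ≤ L) (hh : L2On Ω h) :
    |tri Ω l (conv k h) h| ≤ (∫ y, ‖y‖ * ‖fderiv ℝ k y‖) * L * l2 Ω h ^ 2 := by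
  have hBj : ∀ j x, ‖l x j‖ ≤ B := fun j x => (PiLp.norm_apply_le _ j).trans (hB x)
  have hB0 : 0 ≤ B := (norm_nonneg _).trans (hB 0)
  have hinn : ∀ y, Integrable (fun x => inner ℝ (h x) (h (x - y))) Ω.measure := fun y =>
    hh.integrable_inner (hh.sub_right y)
  have hinn_le : ∀ y, ∫ x, ‖h x‖ * ‖h (x - y)‖ ∂Ω.measure ≤ l2 Ω h ^ 2 := by
    intro y
    have := hh.integral_mul_le (hh.sub_right y)
    rwa [hh.l2_sub_right, ← sq] at this
  have hj : ∀ j y, Integrable (fun x => l x j * inner ℝ (h x) (h (x - y))) Ω.measure := fun j y =>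
    (hinn y).bdd_mul (hl2.coord j).memLp.1 (Eventually.of_forall (hBj j))
  have hj' : ∀ j y, Integrable (fun x => l (x - y) j * inner ℝ (h x) (h (x - y))) Ω.measure :=
    fun j y => (hinn y).bdd_mul ((hl2.sub_right y).coord j).memLp.1
      (Eventually.of_forall fun x => hBj j _)
  set S : Fin 3 → E3 → ℝ := fun j y => ∫ x, l x j * inner ℝ (h x) (h (x - y)) ∂Ω.measure with hS
  set R : Fin 3 → E3 → ℝ := fun j y =>
    ∫ x, l (x - y) j * inner ℝ (h x) (h (x - y)) ∂Ω.measure with hR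
  have hSR : ∀ j y, S j (-y) = R j y := by
    intro j y
    have := integral_comp_sub (Ω := Ω) (f := fun x => l x j * inner ℝ (h x) (h (x + y)))
      ((hl2.coord j).isFunOn.comp₂ (hh.isFunOn.comp₂ (by simpa using hh.isFunOn.sub_right (-y))
        fun a b => inner ℝ a b) _) y
    simp only [hS, hR, sub_neg_eq_add]
    rw [← this]
    simp only [sub_add_cancel, real_inner_comm]
  have hprod : ∀ j, Integrable (fun q : E3 × E3 => pd j k q.2 *
      (l q.1 j * inner ℝ (h q.1) (h (q.1 - q.2)))) (Ω.measure.prod volume) := by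
    intro j
    refine integrable_kernel_prod (B := B * l2 Ω h ^ 2) (rapid_schwartz _) ?_ (hj j) fun y => ?_
    · exact (hl2.coord j).memLp.1.comp_fst.mul
        (hh.memLp.1.comp_fst.inner (aestronglyMeasurable_sub hh.aestronglyMeasurable Ω))
    · refine le_trans ?_ (mul_le_mul_of_nonneg_left (hinn_le y) hB0)
      rw [← integral_const_mul]
      refine integral_mono (hj j y).norm ((hh.integrable_mul (hh.sub_right y)).const_mul B)
        fun x => ?_
      simp only [norm_mul]
      gcongr
      · exact hBj j x
      · exact norm_inner_le_norm _ _
  have hSint : ∀ j, Integrable (fun y => pd j k y * S j y) := by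
    intro j
    have := (hprod j).integral_prod_right
    simpa only [integral_const_mul] using this
  have hT : tri Ω l (conv k h) h = ∑ j, ∫ y, pd j k y * S j y := by
    have e1 : ∀ x, inner ℝ (h x) (fderiv ℝ (conv k h) x (l x)) =
        ∑ j, ∫ y, pd j k y * (l x j * inner ℝ (h x) (h (x - y))) := by
      intro x
      rw [fderiv_conv_eq_sum k hh, inner_sum]
      refine Finset.sum_congr rfl fun j _ => ?_
      rw [inner_smul_right, conv, ← integral_inner (hh.integrable_rapid (rapid_schwartz _) x),
        ← integral_const_mul]
      congr 1; ext y
      rw [inner_smul_right]; ring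
    rw [tri]
    simp only [e1]
    rw [integral_finsetSum _ fun j _ => (hprod j).integral_prod_left]
    refine Finset.sum_congr rfl fun j _ => ?_
    rw [integral_integral_swap (hprod j)]
    simp only [integral_const_mul, hS]
  -- Reflecting `y` changes the sign of the differentiated kernel and turns `S` into `R`. Averaging
  -- the two expressions produces the difference l(x) - l(x - y), which trades the derivative of the
  -- kernel for a derivative of `l`.
  have hT' : tri Ω l (conv k h) h = -∑ j, ∫ y, pd j k y * R j y := by
    rw [hT, ← Finset.sum_neg_distrib]
    refine Finset.sum_congr rfl fun j _ => ?_
    rw [← integral_neg_eq_self, ← integral_neg]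
    congr 1; ext y
    rw [hSR, pd_neg hk]; ring
  have hRint : ∀ j, Integrable (fun y => pd j k y * R j y) := by
    intro j
    have := (hSint j).comp_neg.neg
    refine this.congr (Eventually.of_forall fun y => ?_)
    simp only [Pi.neg_apply, hSR, pd_neg hk]; ring
  have h2T : 2 * tri Ω l (conv k h) h = ∫ y, ∑ j, pd j k y * (S j y - R j y) := by
    rw [two_mul]
    conv_lhs => arg 1; rw [hT]
    rw [hT', ← sub_eq_add_neg, ← integral_finsetSum _ fun j _ => hSint j,
      ← integral_finsetSum _ fun j _ => hRint j, ← integral_sub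
      (integrable_finsetSum _ fun j _ => hSint j) (integrable_finsetSum _ fun j _ => hRint j)]
    simp only [mul_sub, Finset.sum_sub_distrib]
  have hpt : ∀ y, ‖∑ j, pd j k y * (S j y - R j y)‖ ≤
      ‖y‖ * ‖fderiv ℝ k y‖ * (L * l2 Ω h ^ 2) := by
    -- The difference S - R at shift y integrates (l(x) - l(x - y))·∇k(y) against h(x)·h(x - y); the
    -- mean value theorem gives the factor L‖y‖.
    intro y
    have e2 : ∑ j, pd j k y * (S j y - R j y) =
        ∫ x, fderiv ℝ k y (l x - l (x - y)) * inner ℝ (h x) (h (x - y)) ∂Ω.measure := by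
      simp only [hS, hR]
      simp only [← integral_sub (hj _ y) (hj' _ y), ← integral_const_mul]
      have hc : ∀ j, Integrable (fun x => pd j k y * (l x j * inner ℝ (h x) (h (x - y)) -
          l (x - y) j * inner ℝ (h x) (h (x - y)))) Ω.measure := fun j =>
        ((hj j y).sub (hj' j y)).const_mul _
      rw [← integral_finsetSum _ fun j _ => hc j]
      congr 1; ext x
      rw [clm_apply_eq_sum, Finset.sum_mul]
      refine Finset.sum_congr rfl fun j _ => ?_
      rw [pd_apply]
      simp only [PiLp.sub_apply, smul_eq_mul]
      ring
    rw [e2]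
    have hle : ‖∫ x, fderiv ℝ k y (l x - l (x - y)) * inner ℝ (h x) (h (x - y)) ∂Ω.measure‖ ≤
        ∫ x, (‖fderiv ℝ k y‖ * (L * ‖y‖)) * (‖h x‖ * ‖h (x - y)‖) ∂Ω.measure := by
      refine norm_integral_le_of_norm_le ((hh.integrable_mul (hh.sub_right y)).const_mul _)
        (Eventually.of_forall fun x => ?_)
      rw [norm_mul]
      gcongr
      · refine (ContinuousLinearMap.le_opNorm _ _).trans ?_
        gcongr
        exact norm_sub_le_of_fderiv hl hL h0 x y
      · exact norm_inner_le_norm _ _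
    refine hle.trans ?_
    rw [integral_const_mul]
    calc _ ≤ (‖fderiv ℝ k y‖ * (L * ‖y‖)) * l2 Ω h ^ 2 := by gcongr; exact hinn_le y
      _ = _ := by ring
  have hint : Integrable (fun y => ‖y‖ * ‖fderiv ℝ k y‖) := by
    have := (SchwartzMap.fderivCLM ℝ E3 ℝ k).integrable_pow_mul volume 1
    simpa using this
  have hfin : ‖2 * tri Ω l (conv k h) h‖ ≤ (∫ y, ‖y‖ * ‖fderiv ℝ k y‖) * (L * l2 Ω h ^ 2) := by
    rw [h2T, ← integral_mul_const]
    exact norm_integral_le_of_norm_le (hint.mul_const _) (Eventually.of_forall hpt)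
  rw [norm_mul, Real.norm_eq_abs, Real.norm_eq_abs, abs_two] at hfin
  have := abs_nonneg (tri Ω l (conv k h) h)
  linarith

/-- The constant of the flux estimate, for the profile `χ` of the projections and the profile `η`
of the test multiplier. -/
def fluxC (χ η : ℝ → ℝ) : ℝ :=
  (∫ y, ‖y‖ * ‖fderiv ℝ (belowKernel η 0) y‖) * lpC χ + lpC χ * lpC η + lpC η

theorem fluxC_nonneg (χ η : ℝ → ℝ) : 0 ≤ fluxC χ η := by
  have h1 : 0 ≤ ∫ y, ‖y‖ * ‖fderiv ℝ (belowKernel η 0) y‖ :=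
    integral_nonneg fun y => by positivity
  have h2 := lpC_nonneg χ
  have h3 := lpC_nonneg η
  unfold fluxC; positivity

/-- With u = l + h and Mu = l + Mh, the flux expands into terms graded by the number of factors `h`.
Those with at most one vanish by antisymmetry or cancel in pairs, leaving (l·∇)Mh·h, -(h·∇)l·Mh and
(h·∇)Mu·h, each bounded by ‖∇u_{≤r+2}‖_∞‖h‖². -/
theorem abs_flux_le (hχ : IsLPProfile χ) (hη : IsLPProfile η) (r : ℕ) {u : E3 → E3}
    (hd : IsDivFree u) (hu : L2On Ω u) {V : ℝ} (hV0 : 0 ≤ V)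
    (hV : ∀ x v, ‖fderiv ℝ (conv (belowKernel χ (r + 3)) u) x v‖ ≤ V * ‖v‖) :
    |tri Ω u (conv (belowKernel η (r + 2)) u) u| ≤
      fluxC χ η * V * l2 Ω (fun x => u x - conv (belowKernel χ r) u x) ^ 2 := by
  set l := conv (belowKernel χ r) u with hl
  set h : E3 → E3 := fun x => u x - l x with hh
  set M := belowKernel η (r + 2) with hM
  have hMr : Rapid M := rapid_below hη _
  have hl2 : L2On Ω l := hu.below hχ r
  have hh2 : L2On Ω h := hu.sub hl2
  have hld : IsDivFree l := hd.conv hu (rapid_below hχ r)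
  have hhd : IsDivFree h := hd.sub hld hu hl2
  have hMh2 : L2On Ω (conv M h) := hh2.below hη _
  have hbl : BddDeriv l := bddDeriv_below hχ r hu
  have hbMh : BddDeriv (conv M h) := bddDeriv_below hη _ hh2
  have hbMu : BddDeriv (conv M u) := bddDeriv_below hη _ hu
  have hMl : conv M l = l := conv_below_of_lt hχ hη (by omega) hu
  have hMu : conv M u = fun x => l x + conv M h x := by
    ext1 x
    have := conv_sub hMr hu hl2 x
    rw [hMl] at this
    rw [this]; abel
  have hul : u = fun x => l x + h x := by ext1 x; simp [hh]
  have ls : ∀ p : ℕ, lam ((p + 1 : ℕ) : ℤ) = 2 * lam p := lam_natCast_succ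
  have hr := lam_pos r
  -- In units of λ_r the two conditions read 2 ≤ 3 and 5 ≤ 6. They dictate the gap of two scales
  -- between `l` and the multiplier, and scale r + 3 for products of `l` with `conv M h`.
  have fr2 : lam r + lam r ≤ 3 / 4 * lam ((r + 2 : ℕ) : ℤ) := by
    rw [ls (r + 1), ls r]; linarith
  have fr3 : lam ((r + 2 : ℕ) : ℤ) + lam r ≤ 3 / 4 * lam ((r + 3 : ℕ) : ℤ) := by
    rw [ls (r + 2), ls (r + 1), ls r]; linarith
  have z1 : tri Ω l l l = 0 := by
    have := tri_antisymm hχ hχ fr2 hld hl2 hu hu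
    linarith
  have z2 : tri Ω h l l = 0 := by
    have := tri_antisymm hχ hχ fr2 hhd hh2 hu hu
    linarith
  have a1 : tri Ω h (conv M h) l = -tri Ω h l (conv M h) := tri_antisymm hη hχ fr3 hhd hh2 hh2 hu
  -- This cancels against the first term of `d2`, the only other contribution linear in `h` that is
  -- not zero by itself.
  have a2 : tri Ω l (conv M u) l = -tri Ω l l h := by
    rw [tri_low_low hχ hη fr2 hd hu, ← hl]
    conv_lhs => rw [hul]
    rw [tri_add_right hl2 hbl hl2 hh2, z1, zero_add]
  have d1 : tri Ω u (conv M u) u = tri Ω l (conv M u) l + tri Ω l (conv M u) h +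
      (tri Ω h (conv M u) l + tri Ω h (conv M u) h) := by
    have := tri_add_left hl2 hh2 hbMu (hl2.add hh2)
    rwa [tri_add_right hl2 hbMu hl2 hh2, tri_add_right hh2 hbMu hl2 hh2, ← hul] at this
  have d2 : tri Ω l (conv M u) h = tri Ω l l h + tri Ω l (conv M h) h := by
    rw [hMu]; exact tri_add_mid hl2 hbl hbMh hh2
  have d3 : tri Ω h (conv M u) l = tri Ω h l l + tri Ω h (conv M h) l := by
    rw [hMu]; exact tri_add_mid hh2 hbl hbMh hl2
  have total : tri Ω u (conv M u) u =
      tri Ω l (conv M h) h - tri Ω h l (conv M h) + tri Ω h (conv M u) h := by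
    rw [d1, d2, d3, a2, z2, a1]; ring
  have bl : ∀ x v, ‖fderiv ℝ l x v‖ ≤ lpC χ * V * ‖v‖ := fderiv_below_le hχ hχ (by omega) hu hV
  have bMu : ∀ x v, ‖fderiv ℝ (conv M u) x v‖ ≤ lpC η * V * ‖v‖ :=
    fderiv_below_le hχ hη (by omega) hu hV
  have n1 := lpC_nonneg χ
  have n2 := lpC_nonneg η
  have nh := l2_nonneg (Ω := Ω) h
  obtain ⟨B, hB⟩ := exists_below_bound hu hχ r
  -- Here `l` appears without derivative, so a direct bound would not be quadratic in `h`; the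
  -- commutator estimate replaces it by its gradient.
  have t1 : |tri Ω l (conv M h) h| ≤
      (∫ y, ‖y‖ * ‖fderiv ℝ (belowKernel η 0) y‖) * (lpC χ * V) * l2 Ω h ^ 2 := by
    have := abs_tri_commutator_le (lpK hη (r + 2)) (lpK_neg hη _) hl2 hbl.diff hB bl
      (by positivity) hh2
    rwa [coe_lpK, integral_norm_mul_fderiv_belowKernel hη] at this
  have t2 : |tri Ω h l (conv M h)| ≤ lpC χ * V * (l2 Ω h * (lpC η * l2 Ω h)) := by
    refine (abs_tri_le hh2 hMh2 (by positivity) bl).trans ?_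
    gcongr
    exact l2_below_le hη _ hh2
  have t3 : |tri Ω h (conv M u) h| ≤ lpC η * V * (l2 Ω h * l2 Ω h) :=
    abs_tri_le hh2 hh2 (by positivity) bMu
  rw [total]
  calc _ ≤ |tri Ω l (conv M h) h| + |tri Ω h l (conv M h)| + |tri Ω h (conv M u) h| :=
        (abs_add_le _ _).trans (by gcongr; exact abs_sub _ _)
    _ ≤ _ := by
        refine (add_le_add (add_le_add t1 t2) t3).trans (le_of_eq ?_)
        unfold fluxC; ring

end Commutator

/-! ### Weak gradients -/

section WeakGrad

variable {Ω : Dom} {f : E3 → E3} {G G' : E3 → GradVec}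

/-- After multiplication by the weight the function is integrable on ℝ³, and the inverse weight is
continuous. -/
theorem L2On.locallyIntegrable {F : Type*} [NormedAddCommGroup F] [NormedSpace ℝ F] {f : E3 → F}
    (hf : L2On Ω f) : LocallyIntegrable f volume := by
  have h : Integrable (fun y => wt y • f y) := by
    refine hf.integrable_wt_mul.mono' (continuous_wt.aestronglyMeasurable.smul
      hf.aestronglyMeasurable) (Eventually.of_forall fun y => ?_)
    rw [norm_smul, Real.norm_of_nonneg (wt_pos y).le]
  have h2 := h.locallyIntegrable.continuous_smul
    (continuous_wt.inv₀ fun y => (wt_pos y).ne')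
  refine h2.congr (Eventually.of_forall fun y => ?_)
  exact inv_smul_smul₀ (wt_pos y).ne' _

/-- The component of a gradient. -/
def comp (j : Fin 3) : GradVec →L[ℝ] E3 := PiLp.proj 2 (fun _ : Fin 3 => E3) j

theorem comp_apply (j : Fin 3) (A : GradVec) : comp j A = A j := rfl

theorem _root_.MeasureTheory.LocallyIntegrable.clm {V W : Type*} [NormedAddCommGroup V]
    [NormedSpace ℝ V] [NormedAddCommGroup W] [NormedSpace ℝ W] {f : E3 → V}
    (hf : LocallyIntegrable f volume) (A : V →L[ℝ] W) :
    LocallyIntegrable (fun x => A (f x)) volume := by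
  intro x
  obtain ⟨s, hs, hi⟩ := hf x
  exact ⟨s, hs, A.integrable_comp hi⟩

theorem IsWeakGrad.ae_eq (h : IsWeakGrad f G) (h' : IsWeakGrad f G') : G =ᵐ[volume] G' := by
  have hj : ∀ j : Fin 3, ∀ᵐ x, G x j = G' x j := by
    intro j
    refine ae_eq_of_integral_contDiff_smul_eq (h.locInt_grad.clm (comp j))
      (h'.locInt_grad.clm (comp j)) fun φ hφ hc => ?_
    have := (h.eq φ hφ hc j).symm.trans (h'.eq φ hφ hc j)
    exact neg_injective this
  rw [← ae_all_iff] at hj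
  filter_upwards [hj] with x hx
  ext1 j
  exact hx j

theorem IsWeakGrad.congr (h : IsWeakGrad f G) (hG : G =ᵐ[volume] G') : IsWeakGrad f G' := by
  refine ⟨h.locInt, h.locInt_grad.congr hG, fun φ hφ hc j => ?_⟩
  rw [h.eq φ hφ hc j]
  congr 1
  refine integral_congr_ae ?_
  filter_upwards [hG] with x hx
  rw [hx]

theorem gradNormSq_eq (h : IsWeakGrad f G) : Ω.gradNormSq f = eLpNorm G 2 Ω.measure ^ 2 := by
  refine le_antisymm (iInf₂_le G h) (le_iInf₂ fun G' h' => ?_)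
  rw [eLpNorm_congr_ae ((measure_absolutelyContinuous Ω).ae_eq (h.ae_eq h'))]

theorem IsWeakGrad.translate (h : IsWeakGrad f G) (y : E3) (hf : ∀ x, f (y + x) = f x) :
    IsWeakGrad f (fun x => G (y + x)) := by
  refine ⟨h.locInt, fun x => ?_, fun φ hφ hc j => ?_⟩
  · obtain ⟨s, hs, hi⟩ := h.locInt_grad (y + x)
    refine ⟨(fun x => y + x) ⁻¹' s, (continuous_const_add y).continuousAt.preimage_mem_nhds hs, ?_⟩
    exact ((measurePreserving_add_left volume y).integrableOn_comp_preimage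
      (Homeomorph.addLeft y).measurableEmbedding).2 hi
  · have hs : ContDiff ℝ ∞ (fun x => φ (x - y)) := hφ.comp (contDiff_id.sub contDiff_const)
    have hc' : HasCompactSupport (fun x => φ (x - y)) := by
      have := hc.comp_homeomorph (Homeomorph.subRight y)
      exact this
    have h1 := h.eq _ hs hc' j
    have hd : ∀ x, fderiv ℝ (fun x => φ (x - y)) x = fderiv ℝ φ (x - y) := fun x => by
      rw [fderiv_comp_sub]
    simp only [hd] at h1
    rw [← integral_add_left_eq_self _ y] at h1
    simp only [add_sub_cancel_left, hf] at h1
    rw [h1, ← integral_add_left_eq_self _ y]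
    simp only [add_sub_cancel_left]

/-- A square integrable weak gradient has a representative that lives on the domain. -/
theorem IsWeakGrad.exists_l2On (h : IsWeakGrad f G) (hf : Ω.IsFunOn f)
    (hG : eLpNorm G 2 Ω.measure < ⊤) : ∃ G', L2On Ω G' ∧ IsWeakGrad f G' := by
  cases Ω with
  | whole =>
    exact ⟨G, ⟨trivial, h.locInt_grad.aestronglyMeasurable.mono_ac
      (measure_absolutelyContinuous _), hG⟩, h⟩
  | torus =>
    set G' : E3 → GradVec := fun x => G (ZSpan.fract stdBasis x) with hG'
    have hae : G =ᵐ[volume] G' := by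
      -- Every translate of `G` by the lattice is again a weak gradient of the periodic `f`, so
      -- uniqueness gives equality a.e., for all of the countable lattice at once.
      have : ∀ᵐ x, ∀ g : lattice.toAddSubgroup, G (g + x) = G x := by
        rw [ae_all_iff]
        intro g
        exact (h.translate g (periodic_of_mem_lattice hf g.2)).ae_eq h
      filter_upwards [this] with x hx
      have hm : -(ZSpan.floor stdBasis x : E3) ∈ lattice.toAddSubgroup :=
        neg_mem (ZSpan.floor stdBasis x).2
      have := hx ⟨_, hm⟩
      rw [hG', ← this]
      simp only [ZSpan.fract_apply]
      congr 1
      abel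
    refine ⟨G', ⟨fun j x => ?_, h.locInt_grad.aestronglyMeasurable.congr hae |>.mono_ac
      (measure_absolutelyContinuous _), ?_⟩, h.congr hae⟩
    · simp only [hG']
      congr 1
      rw [← stdBasis_apply]
      exact ZSpan.fract_add_ZSpan _ _ (Submodule.subset_span ⟨j, rfl⟩)
    · rwa [← eLpNorm_congr_ae ((measure_absolutelyContinuous _).ae_eq hae)]

theorem exists_weakGrad (hf : Ω.IsFunOn f) (h : Ω.gradNormSq f < ⊤) :
    ∃ G, L2On Ω G ∧ IsWeakGrad f G ∧ Ω.gradNormSq f = ENNReal.ofReal (l2 Ω G ^ 2) := by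
  have : ∃ G, IsWeakGrad f G := by
    by_contra! hn
    simp [Dom.gradNormSq, hn] at h
  obtain ⟨G, hG⟩ := this
  rw [gradNormSq_eq hG] at h
  obtain ⟨G', h1, h2⟩ := hG.exists_l2On hf (by
    by_contra! hn
    simp [top_le_iff.1 hn] at h)
  refine ⟨G', h1, h2, ?_⟩
  rw [gradNormSq_eq h2, ENNReal.ofReal_pow (l2_nonneg _), h1.ofReal_l2]

theorem gradNormSq_eq_ofReal (h : IsWeakGrad f G) (hG : L2On Ω G) :
    Ω.gradNormSq f = ENNReal.ofReal (l2 Ω G ^ 2) := by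
  rw [gradNormSq_eq h, ENNReal.ofReal_pow (l2_nonneg _), hG.ofReal_l2]

theorem normSq_eq_ofReal (hf : L2On Ω f) : Ω.normSq f = ENNReal.ofReal (l2 Ω f ^ 2) := by
  rw [Dom.normSq, ENNReal.ofReal_pow (l2_nonneg _), hf.ofReal_l2]

theorem IsWeakGrad.integral_schwartz (h : IsWeakGrad f G) (hf : L2On Ω f) (hG : L2On Ω G)
    (ψ : 𝓢(E3, ℝ)) (j : Fin 3) :
    ∫ x, fderiv ℝ ψ x (e j) • f x = -∫ x, ψ x • G x j := by
  obtain ⟨φ, hs, hc, ⟨C, hC⟩, ht0, ht⟩ := exists_schwartz_cutoff ψ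
  have hGj : L2On Ω (fun x => G x j) := hG.clm (comp j)
  have he : ‖e j‖ = 1 := by simp [e]
  have h1 : Tendsto (fun n => ∫ x, fderiv ℝ (φ n) x (e j) • f x) atTop
      (𝓝 (∫ x, fderiv ℝ ψ x (e j) • f x)) := by
    refine tendsto_integral_of_dominated_convergence (fun y => C * (wt y * ‖f y‖)) (fun n => ?_)
      (hf.integrable_wt_mul.const_mul C) (fun n => Eventually.of_forall fun y => ?_)
      (Eventually.of_forall fun y => ?_)
    · exact (((hs n).continuous_fderiv (by simp)).clm_apply
        continuous_const).aestronglyMeasurable.smul hf.aestronglyMeasurable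
    · rw [norm_smul, ← mul_assoc]
      refine mul_le_mul_of_nonneg_right ?_ (norm_nonneg _)
      refine (ContinuousLinearMap.le_opNorm _ _).trans ?_
      rw [he, mul_one]
      exact (hC n y).2
    · exact (((ContinuousLinearMap.apply ℝ ℝ (e j)).continuous.tendsto _).comp (ht y)).smul_const _
  have h2 : Tendsto (fun n => ∫ x, φ n x • G x j) atTop (𝓝 (∫ x, ψ x • G x j)) := by
    refine tendsto_integral_of_dominated_convergence (fun y => C * (wt y * ‖G y j‖)) (fun n => ?_)
      (hGj.integrable_wt_mul.const_mul C) (fun n => Eventually.of_forall fun y => ?_)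
      (Eventually.of_forall fun y => ?_)
    · exact (hs n).continuous.aestronglyMeasurable.smul hGj.aestronglyMeasurable
    · rw [norm_smul, ← mul_assoc]
      exact mul_le_mul_of_nonneg_right (hC n y).1 (norm_nonneg _)
    · exact (ht0 y).smul_const _
  simp only [fun n => h.eq _ (hs n) (hc n) j] at h1
  exact tendsto_nhds_unique h1 h2.neg

theorem IsWeakGrad.conv_pd (h : IsWeakGrad f G) (hf : L2On Ω f) (hG : L2On Ω G) (k : 𝓢(E3, ℝ))
    (j : Fin 3) : conv (pd j k) f = conv k (fun y => G y j) := by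
  ext1 x
  have h1 := h.integral_schwartz hf hG (reflS k x) j
  simp only [fderiv_reflS, neg_apply, neg_smul, integral_neg, reflS_apply, neg_inj] at h1
  rw [conv_eq, conv_eq, ← h1]
  simp only [pd_apply]

theorem grad_conv_apply (k : 𝓢(E3, ℝ)) (hf : L2On Ω f) (x : E3) (j : Fin 3) :
    grad (conv k f) x j = conv (pd j k) f x := fderiv_conv_e k hf x j

theorem IsWeakGrad.grad_conv (h : IsWeakGrad f G) (hf : L2On Ω f) (hG : L2On Ω G) (k : 𝓢(E3, ℝ)) :
    grad (conv k f) = conv k G := by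
  ext x : 1
  ext1 j
  rw [grad_conv_apply k hf, h.conv_pd hf hG, ← comp_apply, ← conv_clm (rapid_schwartz k) hG]
  rfl

theorem continuous_grad {f : E3 → E3} (hf : ContDiff ℝ 1 f) : Continuous (grad f) := by
  unfold grad
  refine (PiLp.continuous_toLp 2 _).comp (continuous_pi fun j => ?_)
  exact (hf.continuous_fderiv (by simp)).clm_apply continuous_const

theorem isWeakGrad_grad {f : E3 → E3} (hf : ContDiff ℝ 1 f) : IsWeakGrad f (grad f) := by
  have hg := continuous_grad hf
  refine ⟨hf.continuous.locallyIntegrable, hg.locallyIntegrable, fun φ hφ hc j => ?_⟩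
  have hgj : Continuous fun x => fderiv ℝ f x (e j) :=
    (hf.continuous_fderiv (by simp)).clm_apply continuous_const
  have hφj : Continuous fun x => fderiv ℝ φ x (e j) :=
    (hφ.continuous_fderiv (by simp)).clm_apply continuous_const
  have hcj : HasCompactSupport fun x => fderiv ℝ φ x (e j) :=
    (hc.fderiv (𝕜 := ℝ)).comp_left (g := fun A : E3 →L[ℝ] ℝ => A (e j)) rfl
  have := integral_smul_fderiv_eq_neg_fderiv_smul_of_integrable (μ := volume) (v := e j)
    (f := φ) (g := f)
    ((hφj.smul hf.continuous).integrable_of_hasCompactSupport hcj.smul_right)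
    ((hφ.continuous.smul hgj).integrable_of_hasCompactSupport hc.smul_right)
    ((hφ.continuous.smul hf.continuous).integrable_of_hasCompactSupport hc.smul_right)
    (fun x _ => hφ.differentiable (by simp) x)
    (fun x _ => hf.differentiable (by simp) x)
  rw [eq_comm, neg_eq_iff_eq_neg]
  exact this

theorem _root_.MeasureTheory.LocallyIntegrable.integrable_smul_test {V : Type*}
    [NormedAddCommGroup V] [NormedSpace ℝ V] {g : E3 → V} (hg : LocallyIntegrable g volume)
    {φ : E3 → ℝ} (hφ : Continuous φ) (hc : HasCompactSupport φ) :
    Integrable (fun x => φ x • g x) :=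
  hg.integrable_smul_left_of_hasCompactSupport hφ hc

theorem IsWeakGrad.sub {f' : E3 → E3} (h : IsWeakGrad f G) (h' : IsWeakGrad f' G') :
    IsWeakGrad (fun x => f x - f' x) (fun x => G x - G' x) := by
  refine ⟨h.locInt.sub h'.locInt, h.locInt_grad.sub h'.locInt_grad, fun φ hφ hc j => ?_⟩
  have hφj : Continuous fun x => fderiv ℝ φ x (e j) :=
    (hφ.continuous_fderiv (by simp)).clm_apply continuous_const
  have hcj : HasCompactSupport fun x => fderiv ℝ φ x (e j) :=
    (hc.fderiv (𝕜 := ℝ)).comp_left (g := fun A : E3 →L[ℝ] ℝ => A (e j)) rfl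
  have hi := (h.locInt_grad.clm (comp j)).integrable_smul_test hφ.continuous hc
  have hi' := (h'.locInt_grad.clm (comp j)).integrable_smul_test hφ.continuous hc
  simp only [comp_apply] at hi hi'
  simp only [PiLp.sub_apply, smul_sub]
  rw [integral_sub (h.locInt.integrable_smul_test hφj hcj)
    (h'.locInt.integrable_smul_test hφj hcj), h.eq φ hφ hc j, h'.eq φ hφ hc j,
    integral_sub hi hi']
  abel

theorem IsWeakGrad.sub_conv (h : IsWeakGrad f G) (hf : L2On Ω f) (hG : L2On Ω G) (k : 𝓢(E3, ℝ)) :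
    IsWeakGrad (fun x => f x - conv k f x) (fun x => G x - conv k G x) := by
  have h2 := isWeakGrad_grad ((contDiff_conv k hf).of_le (show (1 : WithTop ℕ∞) ≤ (∞ : WithTop ℕ∞) by
    exact_mod_cast le_top))
  rw [h.grad_conv hf hG k] at h2
  exact h.sub h2

theorem norm_fderiv_le_grad (f : E3 → E3) (x v : E3) : ‖fderiv ℝ f x v‖ ≤ ‖grad f x‖ * ‖v‖ := by
  rw [clm_apply_eq_sum]
  refine (norm_sum_le _ _).trans ?_
  simp only [norm_smul]
  rw [EuclideanSpace.norm_eq, PiLp.norm_eq_of_L2, mul_comm]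
  exact Real.sum_mul_le_sqrt_mul_sqrt _ _ _

end WeakGrad

/-! ### The viscous term and high-frequency norms -/

section Viscous

variable {Ω : Dom} {f : E3 → E3} {G : E3 → GradVec} {χ : ℝ → ℝ}

theorem laplacian_eq_sum {g : E3 → E3} (hg : ContDiff ℝ ∞ g) (x : E3) :
    Laplacian.laplacian g x =
      ∑ j : Fin 3, fderiv ℝ (fun y => fderiv ℝ g y (e j)) x (e j) := by
  rw [InnerProductSpace.laplacian_eq_iteratedFDeriv_orthonormalBasis g
    (EuclideanSpace.basisFun (Fin 3) ℝ)]
  refine Finset.sum_congr rfl fun j _ => ?_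
  rw [iteratedFDeriv_two_apply]
  have hd : DifferentiableAt ℝ (fderiv ℝ g) x :=
    (hg.fderiv_right (m := 1)
      (show ((2 : ℕ∞) : WithTop ℕ∞) ≤ ((⊤ : ℕ∞) : WithTop ℕ∞) from WithTop.coe_le_coe.2 le_top)).differentiable (by simp) x
  have : HasFDerivAt (fun y => fderiv ℝ g y (e j))
      ((ContinuousLinearMap.apply ℝ E3 (e j)).comp (fderiv ℝ (fderiv ℝ g) x)) x :=
    (ContinuousLinearMap.apply ℝ E3 (e j)).hasFDerivAt.comp x hd.hasFDerivAt
  rw [this.fderiv]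
  simp [e]

theorem laplacian_conv (k : 𝓢(E3, ℝ)) (hf : L2On Ω f) (x : E3) :
    Laplacian.laplacian (conv k f) x = ∑ j : Fin 3, conv (pd j (pd j k)) f x := by
  rw [laplacian_eq_sum (contDiff_conv k hf)]
  simp only [fderiv_conv_e k hf, fun j => fderiv_conv_e (pd j k) hf x j]

/-- The viscous term of a mollified field. -/
theorem integral_inner_laplacian_conv (h : IsWeakGrad f G) (hf : L2On Ω f) (hG : L2On Ω G)
    {k : 𝓢(E3, ℝ)} (hk : ∀ x, k (-x) = k x) :
    ∫ x, inner ℝ (f x) (Laplacian.laplacian (conv k f) x) ∂Ω.measure =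
      -∫ x, inner ℝ (G x) (conv k G x) ∂Ω.measure := by
  have hGj : ∀ j, L2On Ω (fun x => G x j) := fun j => hG.clm (comp j)
  have hc : ∀ j, L2On Ω (conv (pd j k) (fun x => G x j)) := fun j =>
    ((hGj j).conv (rapid_schwartz _)).1
  have hc' : ∀ j, L2On Ω (conv k (fun x => G x j)) := fun j =>
    ((hGj j).conv (rapid_schwartz _)).1
  simp only [laplacian_conv k hf, inner_sum, fun j => h.conv_pd hf hG (pd j k) j]
  rw [integral_finsetSum _ fun j _ => hf.integrable_inner (hc j)]
  have e1 : ∀ x, inner ℝ (G x) (conv k G x) =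
      ∑ j : Fin 3, inner ℝ (G x j) (conv k (fun x => G x j) x) := by
    intro x
    rw [PiLp.inner_apply]
    refine Finset.sum_congr rfl fun j _ => ?_
    rw [← comp_apply j (conv k G x), ← conv_clm (rapid_schwartz k) hG]
    rfl
  simp only [e1]
  rw [integral_finsetSum _ fun j _ => (hGj j).integrable_inner (hc' j), ← Finset.sum_neg_distrib]
  refine Finset.sum_congr rfl fun j _ => ?_
  have h1 := integral_inner_conv (rapid_schwartz (pd j k)) hf (hGj j)
  have hn : conv (fun y => pd j k (-y)) (fun x => G x j) =
      fun x => -conv (pd j k) (fun x => G x j) x := by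
    ext1 x
    simp only [conv, pd_neg hk, neg_smul, integral_neg]
  rw [hn, h.conv_pd hf hG] at h1
  simp only [inner_neg_right, integral_neg] at h1
  rw [← neg_eq_iff_eq_neg, ← h1]
  simp only [real_inner_comm]

/-- Plancherel with (1 - m)² = 1 - (2m - m²), carried out through self-adjointness so that it holds
equally on the torus. It expresses the high-frequency energy as the full energy minus a quantity
that can be tested in the weak formulation. -/
theorem l2_sub_below_sq {V : Type*} [NormedAddCommGroup V] [InnerProductSpace ℝ V]
    [CompleteSpace V] (hχ : IsLPProfile χ) (p : ℕ) {f : E3 → V} (hf : L2On Ω f) :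
    l2 Ω (fun x => f x - conv (belowKernel χ p) f x) ^ 2 = l2 Ω f ^ 2 -
      ∫ x, inner ℝ (f x) (conv (belowKernel (sqProfile χ) p) f x) ∂Ω.measure := by
  set m := conv (belowKernel χ p) f with hm
  set M := conv (belowKernel (sqProfile χ) p) f with hM
  have h1 : L2On Ω m := hf.below hχ p
  have h2 : L2On Ω M := hf.below hχ.sqProfile p
  have h3 : ∫ x, inner ℝ (m x) (m x) ∂Ω.measure = 2 * ∫ x, inner ℝ (f x) (m x) ∂Ω.measure -
      ∫ x, inner ℝ (f x) (M x) ∂Ω.measure := by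
    rw [hm, integral_inner_below hχ p hf h1, ← integral_const_mul, ← integral_sub
      ((hf.integrable_inner h1).const_mul 2) (hf.integrable_inner h2)]
    refine integral_congr_ae (Eventually.of_forall fun x => ?_)
    simp only [conv_below_self hχ p hf x, inner_sub_right, inner_smul_right, hm, hM]
  have hi := h1.integrable_inner h1
  have hi' := hf.integrable_inner h1
  rw [(hf.sub h1).l2_sq, hf.l2_sq]
  have e1 : ∀ x, ‖f x - m x‖ ^ 2 = ‖f x‖ ^ 2 - 2 * inner ℝ (f x) (m x) + inner ℝ (m x) (m x) :=
    fun x => by rw [norm_sub_sq_real, real_inner_self_eq_norm_sq]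
  simp only [e1]
  have hs : Integrable (fun x => ‖f x‖ ^ 2 - 2 * inner ℝ (f x) (m x)) Ω.measure :=
    hf.integrable_sq.sub (hi'.const_mul 2)
  rw [integral_add hs hi, integral_sub hf.integrable_sq (hi'.const_mul 2), integral_const_mul, h3]
  ring

/-- The viscous part of the flux through scale `p`. -/
def visc (χ : ℝ → ℝ) (Ω : Dom) (p : ℕ) (f : E3 → E3) : ℝ :=
  ∫ x, inner ℝ (f x) (Laplacian.laplacian (conv (belowKernel (sqProfile χ) p) f) x) ∂Ω.measure

theorem above_eq (χ : ℝ → ℝ) (p : ℕ) (f : E3 → E3) :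
    above χ p f = fun x => f x - conv (belowKernel χ p) f x := rfl

/-- The identity `l2_sub_below_sq` for the gradient; integration by parts identifies the subtracted
term with minus the viscous term of the low-frequency balance. -/
theorem gradNormSq_above (hχ : IsLPProfile χ) (p : ℕ) (h : IsWeakGrad f G) (hf : L2On Ω f)
    (hG : L2On Ω G) :
    Ω.gradNormSq (above χ p f) = ENNReal.ofReal (l2 Ω G ^ 2 + visc χ Ω p f) := by
  have hl := fun x => lpK_neg hχ.sqProfile p x
  rw [above_eq, ← coe_lpK hχ, gradNormSq_eq_ofReal (h.sub_conv hf hG _)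
    (hG.sub (hG.conv (rapid_schwartz _)).1), coe_lpK hχ, l2_sub_below_sq hχ p hG, visc,
    ← coe_lpK hχ.sqProfile, integral_inner_laplacian_conv h hf hG hl]
  rfl

/-- The subtractive identity in a form that needs no subtraction in `ℝ≥0∞` and remains true when the
gradient is not square integrable: the negative part of the viscous term stands on the left, the
positive part on the right. -/
theorem gradNormSq_above_add_le (hχ : IsLPProfile χ) (p : ℕ) (hf : L2On Ω f) :
    Ω.gradNormSq (above χ p f) + ENNReal.ofReal (-visc χ Ω p f) ≤
      Ω.gradNormSq f + ENNReal.ofReal (visc χ Ω p f) := by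
  by_cases hfin : Ω.gradNormSq f < ⊤
  · obtain ⟨G, hG, h, he⟩ := exists_weakGrad hf.isFunOn hfin
    have h0 : 0 ≤ l2 Ω G ^ 2 + visc χ Ω p f := by
      have hl := fun x => lpK_neg hχ.sqProfile p x
      have := l2_sub_below_sq hχ p hG
      rw [visc, ← coe_lpK hχ.sqProfile, integral_inner_laplacian_conv h hf hG hl, coe_lpK,
        ← sub_eq_add_neg, ← this]
      positivity
    rw [gradNormSq_above hχ p h hf hG, he]
    rcases le_total 0 (visc χ Ω p f) with hv | hv
    · rw [ENNReal.ofReal_of_nonpos (neg_nonpos.2 hv), add_zero, ENNReal.ofReal_add (sq_nonneg _) hv]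
    · rw [ENNReal.ofReal_of_nonpos hv, add_zero, ← ENNReal.ofReal_add h0 (neg_nonneg.2 hv)]
      simp
  · rw [not_lt_top_iff.1 hfin, top_add]
    exact le_top

theorem gradNormSq_above_le (hχ : IsLPProfile χ) (p : ℕ) (hf : L2On Ω f) :
    Ω.gradNormSq (above χ p f) ≤ ENNReal.ofReal ((1 + lpC χ) ^ 2) * Ω.gradNormSq f := by
  have hC := lpC_nonneg χ
  by_cases hfin : Ω.gradNormSq f < ⊤
  · obtain ⟨G, hG, h, he⟩ := exists_weakGrad hf.isFunOn hfin
    rw [above_eq, ← coe_lpK hχ, gradNormSq_eq_ofReal (h.sub_conv hf hG _)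
      (hG.sub (hG.conv (rapid_schwartz _)).1), he, ← ENNReal.ofReal_mul (by positivity), ← mul_pow,
      coe_lpK]
    refine ENNReal.ofReal_le_ofReal (pow_le_pow_left₀ (l2_nonneg _) ?_ 2)
    refine (hG.l2_sub_le (hG.below hχ p)).trans ?_
    have := l2_below_le hχ p hG
    linarith
  · rw [not_lt_top_iff.1 hfin, ENNReal.mul_top (by
      have : 0 < (1 + lpC χ) ^ 2 := by positivity
      exact (ENNReal.ofReal_pos.2 this).ne')]
    exact le_top

theorem L2On.above (hχ : IsLPProfile χ) (p : ℕ) (hf : L2On Ω f) : L2On Ω (above χ p f) :=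
  hf.sub (hf.below hχ p)

theorem l2_above_le (hχ : IsLPProfile χ) (p : ℕ) (hf : L2On Ω f) :
    l2 Ω (NSE.above χ p f) ≤ (1 + lpC χ) * l2 Ω f := by
  refine (hf.l2_sub_le (hf.below hχ p)).trans ?_
  have := l2_below_le hχ p hf
  linarith

end Viscous

/-! ### Poincaré inequality for smooth functions -/

section Poincare

variable {Ω : Dom} {f : E3 → E3} {G : E3 → GradVec} {χ : ℝ → ℝ}

theorem enorm_sub_le_lintegral_grad (hf : ContDiff ℝ 1 f) (x y : E3) :
    ‖f x - f (x - y)‖ₑ ≤ ∫⁻ s in Set.Icc (0 : ℝ) 1, ‖y‖ₑ * ‖grad f (x - s • y)‖ₑ := by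
  have hd : ∀ s : ℝ, HasDerivAt (fun s : ℝ => f (x - s • y)) (-fderiv ℝ f (x - s • y) y) s := by
    intro s
    have h1 : HasDerivAt (fun s : ℝ => x - s • y) (-y) s := by
      simpa using ((hasDerivAt_id s).smul_const y).const_sub x
    have := (hf.differentiable (by simp) (x - s • y)).hasFDerivAt.comp_hasDerivAt s h1
    rw [map_neg] at this
    exact this
  have hc : Continuous fun s : ℝ => fderiv ℝ f (x - s • y) y :=
    ((hf.continuous_fderiv (by simp)).comp (by fun_prop)).clm_apply continuous_const
  have h := intervalIntegral.integral_eq_sub_of_hasDerivAt (a := 0) (b := 1) (fun s _ => hd s)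
    (hc.neg.intervalIntegrable _ _)
  have e1 : f x - f (x - y) = ∫ s in (0 : ℝ)..1, fderiv ℝ f (x - s • y) y := by
    rw [intervalIntegral.integral_neg] at h
    rw [← neg_inj, h]
    simp
  rw [e1, intervalIntegral.integral_of_le zero_le_one, ← integral_Icc_eq_integral_Ioc]
  refine (enorm_integral_le_lintegral_enorm _).trans (lintegral_mono fun s => ?_)
  have h2 := norm_fderiv_le_grad f (x - s • y) y
  rw [mul_comm, ← ofReal_norm, ← ofReal_norm, ← ofReal_norm, ← ENNReal.ofReal_mul (norm_nonneg _)]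
  exact ENNReal.ofReal_le_ofReal h2

/-- A Poincaré inequality for mollification. -/
theorem l2_sub_conv_le (k : 𝓢(E3, ℝ)) (hk : ∫ y, k y = 1) (hf : L2On Ω f) (hs : ContDiff ℝ 1 f)
    (hg : L2On Ω (grad f)) :
    l2 Ω (fun x => f x - conv k f x) ≤ (∫ y, ‖y‖ * ‖k y‖) * l2 Ω (grad f) := by
  have hgc := continuous_grad hs
  have hI : Integrable fun y : E3 => ‖y‖ * ‖k y‖ := by
    simpa using k.integrable_pow_mul volume 1
  have haM : AEMeasurable (fun z : E3 × ℝ => ‖k z.1‖ₑ * ‖z.1‖ₑ)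
      (volume.prod (volume.restrict (Set.Icc (0 : ℝ) 1))) :=
    (Continuous.aemeasurable (k.continuous.comp continuous_fst).enorm).mul
      (Continuous.aemeasurable continuous_fst.enorm)
  have hΦM : ∀ x, AEMeasurable (fun z : E3 × ℝ => ‖grad f (x - z.2 • z.1)‖ₑ)
      (volume.prod (volume.restrict (Set.Icc (0 : ℝ) 1))) := fun x =>
    Continuous.aemeasurable (hgc.comp (by fun_prop)).enorm
  have hpt : ∀ x, ‖f x - conv k f x‖ₑ ≤ ∫⁻ z : E3 × ℝ, (‖k z.1‖ₑ * ‖z.1‖ₑ) *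
      ‖grad f (x - z.2 • z.1)‖ₑ ∂(volume.prod (volume.restrict (Set.Icc (0 : ℝ) 1))) := by
    intro x
    have e1 : f x - conv k f x = ∫ y, k y • (f x - f (x - y)) := by
      simp only [smul_sub]
      rw [integral_sub (k.integrable.smul_const _) (hf.integrable_rapid (rapid_schwartz k) x),
        integral_smul_const, hk, one_smul, conv]
    rw [e1]
    refine (enorm_integral_le_lintegral_enorm _).trans ?_
    rw [lintegral_prod]
    · refine lintegral_mono fun y => ?_
      rw [enorm_smul]
      simp only [mul_assoc]
      rw [lintegral_const_mul']
      · gcongr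
        exact enorm_sub_le_lintegral_grad hs x y
      · exact enorm_ne_top
    · exact haM.mul (hΦM x)
  have hsub : L2On Ω (fun x => f x - conv k f x) := hf.sub (hf.conv (rapid_schwartz k)).1
  have ha : ∫⁻ z : E3 × ℝ, ‖k z.1‖ₑ * ‖z.1‖ₑ ∂(volume.prod (volume.restrict (Set.Icc (0 : ℝ) 1))) =
      ENNReal.ofReal (∫ y, ‖y‖ * ‖k y‖) := by
    rw [lintegral_prod _ haM, ofReal_integral_eq_lintegral_ofReal hI
      (Eventually.of_forall fun y => by positivity)]
    refine lintegral_congr fun y => ?_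
    simp only []
    rw [lintegral_const, Measure.restrict_apply_univ, Real.volume_Icc, sub_zero,
      ENNReal.ofReal_one, mul_one, mul_comm, ENNReal.ofReal_mul (norm_nonneg _), ofReal_norm,
      ofReal_norm]
  have hA0 : 0 ≤ ∫ y, ‖y‖ * ‖k y‖ := integral_nonneg fun y => by positivity
  have hmain : eLpNorm (fun x => f x - conv k f x) 2 Ω.measure ^ 2 ≤
      ENNReal.ofReal (((∫ y, ‖y‖ * ‖k y‖) * l2 Ω (grad f)) ^ 2) := by
    rw [eLpNorm_two_sq, mul_pow, ENNReal.ofReal_mul (by positivity),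
      ENNReal.ofReal_pow (l2_nonneg _), ENNReal.ofReal_pow hA0, hg.ofReal_l2, ← ha]
    refine (lintegral_mono fun x => pow_le_pow_left' (hpt x) 2).trans ?_
    -- Minkowski over the pairs (y, s) with weight |k(y)||y|; the shifts s·y do not change the norm
    -- of the gradient.
    refine lintegral_sq_lintegral_le (Φ := fun q : E3 × E3 × ℝ => ‖grad f (q.1 - q.2.2 • q.2.1)‖ₑ)
      haM (Continuous.aemeasurable (hgc.comp (by fun_prop)).enorm) fun z => le_of_eq ?_
    rw [eLpNorm_two_sq]
    exact lintegral_comp_sub (f := fun x => ‖grad f x‖ₑ ^ 2) (hg.isFunOn.comp fun w => ‖w‖ₑ ^ 2)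
      (z.2 • z.1)
  rw [← hsub.ofReal_l2, ← ENNReal.ofReal_pow (l2_nonneg _), ENNReal.ofReal_le_ofReal_iff
    (sq_nonneg _)] at hmain
  exact (sq_le_sq₀ (l2_nonneg _) (mul_nonneg hA0 (l2_nonneg _))).1 hmain

end Poincare

/-! ### Mollification and Poincaré inequality for weak gradients -/

section Mollifier

variable {Ω : Dom} {f : E3 → E3} {G : E3 → GradVec} {χ : ℝ → ℝ}

/-- A sequence of bump functions with shrinking supports. -/
def mollBump (n : ℕ) : ContDiffBump (0 : E3) :=
  ⟨((n : ℝ) + 1)⁻¹, 2 * ((n : ℝ) + 1)⁻¹, by positivity, by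
    have : 0 < ((n : ℝ) + 1)⁻¹ := by positivity
    linarith⟩

/-- A sequence of compactly supported mollifiers. -/
def moll (n : ℕ) : 𝓢(E3, ℝ) :=
  ((mollBump n).hasCompactSupport_normed (μ := volume)).toSchwartzMap (mollBump n).contDiff_normed

theorem hasCompactSupport_moll (n : ℕ) : HasCompactSupport (moll n) :=
  (mollBump n).hasCompactSupport_normed (μ := volume)

theorem moll_neg (n : ℕ) (x : E3) : moll n (-x) = moll n x := (mollBump n).normed_neg x

theorem integral_moll (n : ℕ) : ∫ x, moll n x = 1 := (mollBump n).integral_normed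

theorem norm_moll (n : ℕ) (x : E3) : ‖moll n x‖ = moll n x :=
  Real.norm_of_nonneg ((mollBump n).nonneg_normed x)

theorem integral_norm_mul_moll_le (n : ℕ) : ∫ y, ‖y‖ * ‖moll n y‖ ≤ 2 * ((n : ℝ) + 1)⁻¹ := by
  have hI : Integrable fun y : E3 => ‖y‖ * ‖moll n y‖ := by
    simpa using (moll n).integrable_pow_mul volume 1
  have h : ∀ y, ‖y‖ * ‖moll n y‖ ≤ 2 * ((n : ℝ) + 1)⁻¹ * moll n y := by
    intro y
    rw [norm_moll]
    have h0 : 0 ≤ moll n y := (mollBump n).nonneg_normed y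
    by_cases hy : moll n y = 0
    · simp [hy]
    · have : y ∈ tsupport ((mollBump n).normed volume) := subset_closure hy
      rw [(mollBump n).tsupport_normed_eq, mem_closedBall_zero_iff] at this
      exact mul_le_mul_of_nonneg_right this h0
  refine (integral_mono hI ((moll n).integrable.const_mul _) h).trans ?_
  rw [integral_const_mul, integral_moll, mul_one]

theorem tendsto_conv_moll {V : Type*} [NormedAddCommGroup V] [NormedSpace ℝ V] [CompleteSpace V]
    {f : E3 → V} (hf : L2On Ω f) :
    ∀ᵐ x, Tendsto (fun n => conv (moll n) f x) atTop (𝓝 (f x)) := by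
  refine ContDiffBump.ae_convolution_tendsto_right_of_locallyIntegrable (φ := mollBump) (K := 2)
    ?_ (Eventually.of_forall fun n => le_rfl) hf.locallyIntegrable
  have : Tendsto (fun n : ℕ => 2 * ((n : ℝ) + 1)⁻¹) atTop (𝓝 (2 * 0)) := by
    refine Tendsto.const_mul 2 ?_
    simpa using tendsto_one_div_add_atTop_nhds_zero_nat (𝕜 := ℝ)
  rw [mul_zero] at this
  exact this

theorem l2_conv_moll_le {V : Type*} [NormedAddCommGroup V] [NormedSpace ℝ V]
    {f : E3 → V} (hf : L2On Ω f) (n : ℕ) : l2 Ω (conv (moll n) f) ≤ l2 Ω f := by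
  refine (hf.conv (rapid_schwartz (moll n))).2.trans ?_
  simp only [norm_moll, integral_moll, one_mul, le_refl]

theorem L2On.grad_conv (hf : L2On Ω f) (k : 𝓢(E3, ℝ)) : L2On Ω (grad (NSE.conv k f)) := by
  have hj : ∀ j, L2On Ω (NSE.conv (pd j k) f) := fun j => (hf.conv (rapid_schwartz _)).1
  have hs : L2On Ω (fun x => ∑ j : Fin 3, ‖NSE.conv (pd j k) f x‖) := L2On.sum fun j => (hj j).norm
  refine hs.of_le (C := 1) ?_ ?_ fun x => ?_
  · have : grad (NSE.conv k f) = fun x => WithLp.toLp 2 fun j => NSE.conv (pd j k) f x := by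
      ext x : 1
      ext1 j
      exact grad_conv_apply k hf x j
    rw [this]
    cases Ω with
    | whole => trivial
    | torus =>
      intro i x
      simp only [fun j => (hj j).isFunOn i x]
  · exact (continuous_grad ((contDiff_conv k hf).of_le (show (1 : WithTop ℕ∞) ≤ (∞ : WithTop ℕ∞) by
      exact_mod_cast le_top))).aestronglyMeasurable
  · rw [one_mul, Real.norm_of_nonneg (Finset.sum_nonneg fun j _ => norm_nonneg _),
      PiLp.norm_eq_of_L2]
    refine (Real.sqrt_le_iff).2 ⟨Finset.sum_nonneg fun j _ => norm_nonneg _, ?_⟩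
    simp only [grad_conv_apply k hf]
    exact Finset.sum_sq_le_sq_sum_of_nonneg fun j _ => norm_nonneg _

/-- Fatou's lemma, used to pass norm bounds from mollified fields to the field itself. -/
theorem l2_le_of_tendsto {V : Type*} [NormedAddCommGroup V] {f : E3 → V} {g : ℕ → E3 → V}
    (hg : ∀ n, L2On Ω (g n)) (h : ∀ᵐ x, Tendsto (fun n => g n x) atTop (𝓝 (f x)))
    {C : ℝ} (hC : ∀ n, l2 Ω (g n) ≤ C) : l2 Ω f ≤ C := by
  have hC0 : 0 ≤ C := (l2_nonneg _).trans (hC 0)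
  have h1 := Lp.eLpNorm_lim_le_liminf_eLpNorm (p := 2) (μ := Ω.measure) (fun n => (hg n).memLp.1) f
    ((measure_absolutelyContinuous Ω).ae_le h)
  have h2 : eLpNorm f 2 Ω.measure ≤ ENNReal.ofReal C := by
    refine h1.trans (liminf_le_of_le (by isBoundedDefault) fun b hb => ?_)
    obtain ⟨n, hn⟩ := hb.exists
    refine hn.trans ?_
    rw [← (hg n).ofReal_l2]
    exact ENNReal.ofReal_le_ofReal (hC n)
  exact ENNReal.toReal_le_of_le_ofReal hC0 h2

/-- The smooth case is applied to mollifications of `f`: they commute with convolution by `k`, and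
mollifying does not increase the norm of the gradient. -/
theorem IsWeakGrad.l2_sub_conv_le (h : IsWeakGrad f G) (hf : L2On Ω f) (hG : L2On Ω G)
    (k : 𝓢(E3, ℝ)) (hk : ∫ y, k y = 1) :
    l2 Ω (fun x => f x - NSE.conv k f x) ≤ (∫ y, ‖y‖ * ‖k y‖) * l2 Ω G := by
  have hr := rapid_schwartz k
  have hm := fun n => rapid_schwartz (moll n)
  have hsub : L2On Ω (fun x => f x - NSE.conv k f x) := hf.sub (hf.conv hr).1
  refine l2_le_of_tendsto (fun n => (hsub.conv (hm n)).1) (tendsto_conv_moll hsub) fun n => ?_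
  have e1 : conv (moll n) (fun x => f x - NSE.conv k f x) =
      fun x => conv (moll n) f x - NSE.conv k (conv (moll n) f) x := by
    ext1 x
    rw [conv_sub (hm n) hf (hf.conv hr).1, conv_conv_comm (hm n) hr hf]
  rw [e1]
  refine (NSE.l2_sub_conv_le k hk (hf.conv (hm n)).1 ((contDiff_conv (moll n) hf).of_le
    (show (1 : WithTop ℕ∞) ≤ (∞ : WithTop ℕ∞) by exact_mod_cast le_top))
    (hf.grad_conv _)).trans ?_
  gcongr
  rw [h.grad_conv hf hG]
  exact l2_conv_moll_le hG n

/-- High frequencies are controlled by the gradient. -/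
theorem normSq_above_le (hχ : IsLPProfile χ) (p : ℕ) (hf : L2On Ω f) :
    Ω.normSq (above χ p f) ≤
      ENNReal.ofReal (((lam p)⁻¹ * (1 + ∫ x, ‖x‖ * ‖belowKernel χ 0 x‖)) ^ 2) *
        Ω.gradNormSq f := by
  have hA : 0 ≤ ∫ x, ‖x‖ * ‖belowKernel χ 0 x‖ := integral_nonneg fun x => by positivity
  have hl := lam_pos p
  by_cases hfin : Ω.gradNormSq f < ⊤
  · obtain ⟨G, hG, h, he⟩ := exists_weakGrad hf.isFunOn hfin
    rw [he, normSq_eq_ofReal (hf.above hχ p), ← ENNReal.ofReal_mul (sq_nonneg _), ← mul_pow]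
    refine ENNReal.ofReal_le_ofReal (pow_le_pow_left₀ (l2_nonneg _) ?_ 2)
    have h1 := h.l2_sub_conv_le hf hG (lpK hχ p) (by rw [coe_lpK]; exact integral_belowKernel hχ p)
    rw [coe_lpK, integral_norm_mul_belowKernel] at h1
    refine h1.trans ?_
    have := l2_nonneg (Ω := Ω) G
    gcongr
    linarith
  · rw [not_lt_top_iff.1 hfin, ENNReal.mul_top]
    · exact le_top
    · exact (ENNReal.ofReal_pos.2 (by positivity)).ne'

end Mollifier

/-! ### Solenoidal test fields and their orthogonal complement -/

section TestFields

theorem pd_sub (j : Fin 3) (k k' : 𝓢(E3, ℝ)) : pd j (k - k') = pd j k - pd j k' :=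
  (LineDeriv.lineDerivOpCLM ℝ 𝓢(E3, ℝ) (e j)).map_sub k k'

theorem pd_sum (j : Fin 3) {ι : Type*} (s : Finset ι) (k : ι → 𝓢(E3, ℝ)) :
    pd j (∑ i ∈ s, k i) = ∑ i ∈ s, pd j (k i) :=
  map_sum (LineDeriv.lineDerivOpCLM ℝ 𝓢(E3, ℝ) (e j)) k s

theorem pd_zero (j : Fin 3) : pd j (0 : 𝓢(E3, ℝ)) = 0 :=
  (LineDeriv.lineDerivOpCLM ℝ 𝓢(E3, ℝ) (e j)).map_zero

theorem pd_comm (i j : Fin 3) (k : 𝓢(E3, ℝ)) : pd i (pd j k) = pd j (pd i k) := by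
  ext x
  have h : ∀ a b : Fin 3, pd a (pd b k) x = fderiv ℝ (fderiv ℝ k) x (e a) (e b) := by
    intro a b
    have hd : DifferentiableAt ℝ (fderiv ℝ k) x :=
      ((k.smooth ⊤).fderiv_right (m := 1)
      (show ((2 : ℕ∞) : WithTop ℕ∞) ≤ ((⊤ : ℕ∞) : WithTop ℕ∞) from WithTop.coe_le_coe.2 le_top)
      ).differentiable (by simp) x
    have h2 : HasFDerivAt (fun y => fderiv ℝ k y (e b))
        ((ContinuousLinearMap.apply ℝ ℝ (e b)).comp (fderiv ℝ (fderiv ℝ k) x)) x :=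
      (ContinuousLinearMap.apply ℝ ℝ (e b)).hasFDerivAt.comp x hd.hasFDerivAt
    rw [pd_apply, show ⇑(pd b k) = fun y => fderiv ℝ k y (e b) from funext (pd_apply b k), h2.fderiv]
    rfl
  rw [h, h]
  have hs : IsSymmSndFDerivAt ℝ k x := (k.smooth ⊤).contDiffAt.isSymmSndFDerivAt (by
    simp only [minSmoothness_of_isRCLikeNormedField]
    exact (show ((2 : ℕ∞) : WithTop ℕ∞) ≤ ((⊤ : ℕ∞) : WithTop ℕ∞) from WithTop.coe_le_coe.2 le_top))
  exact hs _ _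

/-- Time-independent divergence-free test fields. -/
structure IsField (φ : E3 → E3) : Prop where
  smooth : ContDiff ℝ ∞ φ
  div_free : ∀ x, divergence φ x = 0
  compact : HasCompactSupport φ

theorem IsField.add {φ ψ : E3 → E3} (hφ : IsField φ) (hψ : IsField ψ) :
    IsField (fun x => φ x + ψ x) := by
  refine ⟨hφ.smooth.add hψ.smooth, fun x => ?_, hφ.compact.add hψ.compact⟩
  have h1 := hφ.div_free x
  have h2 := hψ.div_free x
  simp only [divergence] at h1 h2 ⊢
  rw [fderiv_fun_add (hφ.smooth.differentiable (by simp) x) (hψ.smooth.differentiable (by simp) x)]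
  simp only [add_apply, PiLp.add_apply, Finset.sum_add_distrib, h1, h2, add_zero]

theorem IsField.smul {φ : E3 → E3} (hφ : IsField φ) (c : ℝ) : IsField (fun x => c • φ x) := by
  refine ⟨hφ.smooth.const_smul c, fun x => ?_, hφ.compact.smul_left (f := fun _ => c)⟩
  have h1 := hφ.div_free x
  simp only [divergence] at h1 ⊢
  rw [fderiv_fun_const_smul (hφ.smooth.differentiable (by simp) x)]
  simp only [smul_apply, PiLp.smul_apply, ← Finset.smul_sum, h1, smul_zero]

theorem isField_zero : IsField (fun _ => (0 : E3)) := by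
  refine ⟨contDiff_const, fun x => ?_, HasCompactSupport.zero⟩
  simp [divergence]

theorem IsField.l2On {φ : E3 → E3} (hφ : IsField φ) : L2On Dom.whole φ :=
  ⟨trivial, by
    have : MemLp φ 2 volume := hφ.smooth.continuous.memLp_of_hasCompactSupport hφ.compact
    simpa [Dom.measure, Dom.cell] using this⟩

theorem IsField.isDivFree {φ : E3 → E3} (hφ : IsField φ) : IsDivFree φ := by
  intro g hg hc
  have hdg : Differentiable ℝ g := hg.differentiable (by simp)
  have hdφ : Differentiable ℝ φ := hφ.smooth.differentiable (by simp)
  have hφj : ∀ j, ContDiff ℝ ∞ fun x => φ x j := fun j =>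
    (EuclideanSpace.proj j : E3 →L[ℝ] ℝ).contDiff.comp hφ.smooth
  have hgj : ∀ j, Continuous fun x => fderiv ℝ g x (e j) := fun j =>
    (hg.continuous_fderiv (by simp)).clm_apply continuous_const
  have hφjj : ∀ j, Continuous fun x => fderiv ℝ (fun x => φ x j) x (e j) := fun j =>
    ((hφj j).continuous_fderiv (by simp)).clm_apply continuous_const
  have hcj : ∀ j, HasCompactSupport fun x => fderiv ℝ g x (e j) := fun j =>
    (hc.fderiv (𝕜 := ℝ)).comp_left (g := fun A : E3 →L[ℝ] ℝ => A (e j)) rfl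
  have h1 : ∀ j, Integrable fun x => fderiv ℝ g x (e j) * φ x j := fun j =>
    ((hgj j).mul (hφj j).continuous).integrable_of_hasCompactSupport (hcj j).mul_right
  have h2 : ∀ j, Integrable fun x => g x * fderiv ℝ (fun x => φ x j) x (e j) := fun j =>
    (hg.continuous.mul (hφjj j)).integrable_of_hasCompactSupport hc.mul_right
  have e1 : ∀ x, fderiv ℝ g x (φ x) = ∑ j, fderiv ℝ g x (e j) * φ x j := fun x => by
    rw [clm_apply_eq_sum]
    simp only [smul_eq_mul, mul_comm]
  simp only [e1]
  rw [integral_finsetSum _ fun j _ => h1 j]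
  have h3 : ∀ j, ∫ x, fderiv ℝ g x (e j) * φ x j =
      -∫ x, g x * fderiv ℝ (fun x => φ x j) x (e j) := fun j => by
    rw [integral_mul_fderiv_eq_neg_fderiv_mul_of_integrable (h1 j) (h2 j)
      ((hg.continuous.mul (hφj j).continuous).integrable_of_hasCompactSupport hc.mul_right)
      (fun x _ => hdg x) (fun x _ => (hφj j).differentiable (by simp) x), neg_neg]
  simp only [h3, Finset.sum_neg_distrib]
  rw [← integral_finsetSum _ fun j _ => h2 j]
  simp only [← Finset.mul_sum, fderiv_coord hdφ]
  have := hφ.div_free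
  simp only [divergence] at this
  simp [this]

/-- The kernels `∂ᵢ∂ⱼρ - δᵢⱼ Δρ`. -/
def lerayK (ρ : 𝓢(E3, ℝ)) (i j : Fin 3) : 𝓢(E3, ℝ) :=
  pd j (pd i ρ) - if j = i then ∑ l : Fin 3, pd l (pd l ρ) else 0

/-- Δ∂ᵢρ - ∂ᵢΔρ = 0. These kernels, up to sign a double curl, give divergence-free fields with
compact support, which a Leray projection would not. -/
theorem sum_pd_lerayK (ρ : 𝓢(E3, ℝ)) (i : Fin 3) : ∑ j, pd j (lerayK ρ i j) = 0 := by
  have h1 : ∀ j, pd j (lerayK ρ i j) = pd j (pd j (pd i ρ)) -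
      if j = i then ∑ l : Fin 3, pd j (pd l (pd l ρ)) else 0 := by
    intro j
    rw [lerayK, pd_sub]
    congr 1
    split_ifs
    · rw [pd_sum]
    · exact pd_zero j
  simp only [h1, Finset.sum_sub_distrib, Finset.sum_ite_eq', Finset.mem_univ, if_true]
  rw [sub_eq_zero]
  refine Finset.sum_congr rfl fun j _ => ?_
  rw [pd_comm j i ρ, pd_comm j i]

theorem hasCompactSupport_pd {k : 𝓢(E3, ℝ)} (hk : HasCompactSupport k) (j : Fin 3) :
    HasCompactSupport (pd j k) := by
  rw [show ⇑(pd j k) = fun y => fderiv ℝ k y (e j) from funext (pd_apply j k)]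
  exact (hk.fderiv (𝕜 := ℝ)).comp_left (g := fun A : E3 →L[ℝ] ℝ => A (e j)) rfl

theorem hasCompactSupport_lerayK {ρ : 𝓢(E3, ℝ)} (hρ : HasCompactSupport ρ) (i j : Fin 3) :
    HasCompactSupport (lerayK ρ i j) := by
  have h2 : ∀ l, HasCompactSupport (pd l (pd l ρ)) := fun l =>
    hasCompactSupport_pd (hasCompactSupport_pd hρ l) l
  have h0 := hasCompactSupport_pd (hasCompactSupport_pd hρ i) j
  unfold lerayK
  split_ifs
  · have e1 : ⇑(pd j (pd i ρ) - ∑ l : Fin 3, pd l (pd l ρ)) = fun x =>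
        pd j (pd i ρ) x - (pd 0 (pd 0 ρ) x + pd 1 (pd 1 ρ) x + pd 2 (pd 2 ρ) x) := by
      ext x
      rw [Fin.sum_univ_three]
      rfl
    rw [e1]
    exact h0.sub (((h2 0).add (h2 1)).add (h2 2))
  · simpa using h0

/-- The test field `y ↦ (∂ᵢ∂ⱼρ - δᵢⱼ Δρ) (x - y)`. -/
def lerayField (ρ : 𝓢(E3, ℝ)) (i : Fin 3) (x y : E3) : E3 :=
  WithLp.toLp 2 fun j => reflS (lerayK ρ i j) x y

theorem isField_lerayField {ρ : 𝓢(E3, ℝ)} (hρ : HasCompactSupport ρ) (i : Fin 3) (x : E3) :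
    IsField (lerayField ρ i x) := by
  have hs : ContDiff ℝ ∞ (lerayField ρ i x) :=
    contDiff_euclidean.2 fun j => (reflS (lerayK ρ i j) x).smooth ⊤
  refine ⟨hs, fun y => ?_, ?_⟩
  · simp only [divergence, ← fderiv_coord (hs.differentiable (by simp))]
    have : ∀ j, fderiv ℝ (fun y => lerayField ρ i x y j) y (e j) = -pd j (lerayK ρ i j) (x - y) := by
      intro j
      rw [pd_apply, ← neg_apply, ← fderiv_reflS]
      rfl
    simp only [this, Finset.sum_neg_distrib]
    rw [← sum_apply, sum_pd_lerayK]
    simp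
  · have hj : ∀ j, HasCompactSupport fun y => lerayK ρ i j (x - y) := fun j =>
      (hasCompactSupport_lerayK hρ i j).comp_homeomorph (Homeomorph.subLeft x)
    have : lerayField ρ i x = fun y => lerayK ρ i 0 (x - y) • e 0 + lerayK ρ i 1 (x - y) • e 1 +
        lerayK ρ i 2 (x - y) • e 2 := by
      ext y j
      fin_cases j <;> simp [lerayField, reflS_apply, e]
    rw [this]
    exact ((hj 0).smul_right.add (hj 1).smul_right).add (hj 2).smul_right

/-- Testing with `lerayField` yields ∂ᵢ of the divergence of `W`, convolved with ρ, minus the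
Laplacian of the i-th component of ρ * W. The first part vanishes as `W` is divergence-free. -/
theorem laplacian_conv_eq_zero {ρ : 𝓢(E3, ℝ)} (hρ : HasCompactSupport ρ) {W : E3 → E3}
    (hW : L2On Dom.whole W) (hd : IsDivFree W)
    (ho : ∀ φ, IsField φ → ∫ x, inner ℝ (W x) (φ x) ∂Dom.whole.measure = 0) (x : E3) :
    ∑ l : Fin 3, conv (pd l (pd l ρ)) W x = 0 := by
  ext1 i
  have h := ho _ (isField_lerayField hρ i x)
  simp only [Dom.measure, Dom.cell, Measure.restrict_univ] at h
  have e1 : ∀ y, inner ℝ (W y) (lerayField ρ i x y) =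
      ∑ j : Fin 3, (pd j (pd i ρ) (x - y) * W y j) - ∑ l : Fin 3, pd l (pd l ρ) (x - y) * W y i := by
    intro y
    rw [inner_eq_sum]
    have : ∀ j, lerayField ρ i x y j = pd j (pd i ρ) (x - y) -
        if j = i then ∑ l : Fin 3, pd l (pd l ρ) (x - y) else 0 := by
      intro j
      change reflS (lerayK ρ i j) x y = _
      rw [reflS_apply, lerayK]
      split_ifs
      · rw [sub_apply, sum_apply]
      · simp
    simp only [this, mul_sub, Finset.sum_sub_distrib, mul_ite, mul_zero, Finset.sum_ite_eq',
      Finset.mem_univ, if_true, Finset.mul_sum]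
    simp only [mul_comm]
  have hi1 : ∀ j, Integrable fun y => pd j (pd i ρ) (x - y) * W y j := fun j =>
    (hW.coord j).integrable_rapid_sub (rapid_schwartz _) x
  have hi2 : ∀ l, Integrable fun y => pd l (pd l ρ) (x - y) * W y i := fun l =>
    (hW.coord i).integrable_rapid_sub (rapid_schwartz _) x
  simp only [e1] at h
  rw [integral_sub (integrable_finsetSum _ fun j _ => hi1 j)
    (integrable_finsetSum _ fun l _ => hi2 l), integral_finsetSum _ fun j _ => hi1 j,
    integral_finsetSum _ fun j _ => hi2 j] at h
  have h2 : ∀ (k : 𝓢(E3, ℝ)) j, ∫ y, k (x - y) * W y j = conv k W x j := fun k j => by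
    rw [← conv_coord (rapid_schwartz k) hW, conv_eq]
    rfl
  simp only [h2] at h
  rw [hd.sum_conv hW (pd i ρ), zero_sub, neg_eq_zero] at h
  simp only [WithLp.ofLp_sum, Finset.sum_apply, WithLp.ofLp_zero, Pi.zero_apply]
  exact h

theorem conv_pd_conv_pd {Ω : Dom} {W : E3 → E3} (hW : L2On Ω W) (ρ : 𝓢(E3, ℝ)) (l : Fin 3)
    (x : E3) : conv (pd l ρ) (conv (pd l ρ) W) x = conv ρ (conv (pd l (pd l ρ)) W) x := by
  have hr := rapid_schwartz ρ
  have hl := rapid_schwartz (pd l ρ)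
  rw [← fderiv_conv_e ρ (hW.conv hl).1, conv_conv_comm hr hl hW, fderiv_conv_e _ (hW.conv hr).1,
    conv_conv_comm (rapid_schwartz _) hr hW]

/-- A divergence-free field orthogonal to all test fields vanishes. -/
theorem ae_eq_zero_of_orthogonal {W : E3 → E3} (hW : L2On Dom.whole W) (hd : IsDivFree W)
    (ho : ∀ φ, IsField φ → ∫ x, inner ℝ (W x) (φ x) ∂Dom.whole.measure = 0) :
    W =ᵐ[volume] 0 := by
  have hμ : Dom.whole.measure = volume := by simp [Dom.measure, Dom.cell]
  have key : ∀ n x, conv (moll n) W x = 0 := by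
    intro n
    set ρ := moll n with hρ
    have hlap : ∀ x, ∑ l, conv (pd l (pd l ρ)) W x = 0 :=
      laplacian_conv_eq_zero (hasCompactSupport_moll n) hW hd ho
    have hl : ∀ l, L2On Dom.whole (conv (pd l ρ) W) := fun l => (hW.conv (rapid_schwartz _)).1
    have hll : ∀ l, L2On Dom.whole (conv (pd l (pd l ρ)) W) := fun l =>
      (hW.conv (rapid_schwartz _)).1
    -- Liouville by energy: the squared gradient of ρ * W integrates by parts to a pairing with the
    -- Laplacian of ρ * W, which is zero.
    have h1 : ∑ l, l2 Dom.whole (conv (pd l ρ) W) ^ 2 = 0 := by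
      have h2 : ∀ l, l2 Dom.whole (conv (pd l ρ) W) ^ 2 =
          -∫ x, inner ℝ (W x) (conv ρ (conv (pd l (pd l ρ)) W) x) ∂Dom.whole.measure := by
        intro l
        rw [(hl l).l2_sq]
        simp only [← real_inner_self_eq_norm_sq]
        rw [integral_inner_conv (rapid_schwartz _) hW (hl l), ← integral_neg]
        refine integral_congr_ae (Eventually.of_forall fun x => ?_)
        have hn : conv (fun y => pd l ρ (-y)) (conv (pd l ρ) W) x =
            -conv (pd l ρ) (conv (pd l ρ) W) x := by
          simp only [conv, pd_neg (moll_neg n), neg_smul, integral_neg, hρ]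
        simp only [hn, inner_neg_right, conv_pd_conv_pd hW]
      simp only [h2, Finset.sum_neg_distrib]
      rw [← integral_finsetSum _ fun l _ =>
        hW.integrable_inner ((hll l).conv (rapid_schwartz ρ)).1]
      simp only [← inner_sum, ← conv_sum (rapid_schwartz ρ) hll, hlap]
      simp [conv]
    have h3 : ∀ l x, conv (pd l ρ) W x = 0 := by
      intro l
      have h4 := (Finset.sum_eq_zero_iff_of_nonneg fun l _ => sq_nonneg _).1 h1 l (Finset.mem_univ l)
      have h5 : l2 Dom.whole (conv (pd l ρ) W) = 0 := by simpa using h4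
      have h6 : eLpNorm (conv (pd l ρ) W) 2 volume = 0 := by
        rw [← hμ, ← (hl l).ofReal_l2, h5, ENNReal.ofReal_zero]
      rw [eLpNorm_eq_zero_iff (hl l).aestronglyMeasurable two_ne_zero] at h6
      have := Continuous.ae_eq_iff_eq volume (continuous_conv (rapid_schwartz _) hW)
        (continuous_const (y := (0 : E3))) |>.1 h6
      exact fun x => congrFun this x
    have hc : ∀ x y, conv ρ W x = conv ρ W y :=
      is_const_of_fderiv_eq_zero (differentiable_conv ρ hW) fun x => by
        ext1 v
        rw [fderiv_conv_eq_sum ρ hW]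
        simp [h3]
    -- A constant that is square integrable over ℝ³ is zero, the volume being infinite.
    have hm := (hW.conv (rapid_schwartz ρ)).1.memLp
    rw [hμ, show conv ρ W = fun _ => conv ρ W 0 from funext fun x => hc x 0,
      memLp_const_iff two_ne_zero ENNReal.ofNat_ne_top] at hm
    intro x
    rw [hc x 0]
    refine hm.resolve_right ?_
    simp
  filter_upwards [tendsto_conv_moll hW] with x hx
  simp only [key] at hx
  exact tendsto_nhds_unique hx tendsto_const_nhds

end TestFields

/-! ### Density of solenoidal test fields on ℝ³ -/

section Density

/-- The Hilbert space of square integrable fields on the whole space. -/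
abbrev HilbertField := Lp E3 2 Dom.whole.measure

theorem measure_whole : Dom.whole.measure = volume := by simp [Dom.measure, Dom.cell]

/-- The subspace of divergence-free test fields. -/
def testSpace : Submodule ℝ HilbertField where
  carrier := {w | ∃ φ, IsField φ ∧ w =ᵐ[Dom.whole.measure] φ}
  add_mem' := by
    rintro a b ⟨φ, hφ, ha⟩ ⟨ψ, hψ, hb⟩
    exact ⟨_, hφ.add hψ, (Lp.coeFn_add a b).trans (ha.add hb)⟩
  zero_mem' := ⟨_, isField_zero, Lp.coeFn_zero _ _ _⟩
  smul_mem' := by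
    rintro c a ⟨φ, hφ, ha⟩
    exact ⟨_, hφ.smul c, (Lp.coeFn_smul c a).trans (ha.const_smul c)⟩

theorem inner_eq_integral (v w : HilbertField) {f g : E3 → E3}
    (hv : v =ᵐ[Dom.whole.measure] f) (hw : w =ᵐ[Dom.whole.measure] g) :
    inner ℝ v w = ∫ x, inner ℝ (f x) (g x) ∂Dom.whole.measure := by
  rw [L2.inner_def]
  refine integral_congr_ae ?_
  filter_upwards [hv, hw] with x h1 h2
  rw [h1, h2]

/-- Being divergence-free means being orthogonal to gradients of test functions, which are
themselves in L²; this is a closed condition satisfied by all test fields. -/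
theorem isDivFree_of_mem_closure {w : HilbertField} (hw : w ∈ testSpace.topologicalClosure) :
    IsDivFree w := by
  intro g hg hc
  set γ : E3 → E3 := fun x => (InnerProductSpace.toDual ℝ E3).symm (fderiv ℝ g x) with hγ
  have hγc : Continuous γ :=
    (InnerProductSpace.toDual ℝ E3).symm.continuous.comp (hg.continuous_fderiv (by simp))
  have hγm : MemLp γ 2 Dom.whole.measure := by
    rw [measure_whole]
    refine hγc.memLp_of_hasCompactSupport ?_
    exact (hc.fderiv (𝕜 := ℝ)).comp_left (map_zero _)
  have h1 : ∀ (v : HilbertField) (f : E3 → E3), v =ᵐ[Dom.whole.measure] f →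
      inner ℝ (hγm.toLp γ) v = ∫ x, fderiv ℝ g x (f x) := by
    intro v f hv
    rw [inner_eq_integral _ _ hγm.coeFn_toLp hv, measure_whole]
    simp only [hγ, InnerProductSpace.toDual_symm_apply]
  rw [← h1 w w (Filter.EventuallyEq.refl _ _)]
  have hcl : IsClosed {v : HilbertField | inner ℝ (hγm.toLp γ) v = 0} :=
    isClosed_eq (continuous_const.inner continuous_id) continuous_const
  refine closure_minimal (s := (testSpace : Set HilbertField)) ?_ hcl hw
  rintro v ⟨φ, hφ, hv⟩
  change inner ℝ (hγm.toLp γ) v = 0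
  rw [h1 v φ hv]
  exact hφ.isDivFree g hg hc

/-- Divergence-free test fields are dense among the square integrable divergence-free fields on
the whole space. -/
theorem exists_test_seq {V : E3 → E3} (hV : L2On Dom.whole V) (hd : IsDivFree V) :
    ∃ φ : ℕ → E3 → E3, (∀ n, IsField (φ n)) ∧
      Tendsto (fun n => l2 Dom.whole (fun x => φ n x - V x)) atTop (𝓝 0) := by
  set K := testSpace.topologicalClosure with hK
  have : CompleteSpace K := testSpace.isClosed_topologicalClosure.completeSpace_coe
  set v : HilbertField := hV.memLp.toLp V with hv
  set p : HilbertField := K.starProjection v with hp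
  have hpK : p ∈ K := K.starProjection_apply_mem v
  have hvV : v =ᵐ[Dom.whole.measure] V := hV.memLp.coeFn_toLp
  have hp2 : L2On Dom.whole p := ⟨trivial, Lp.memLp p⟩
  have hpd : IsDivFree p := isDivFree_of_mem_closure hpK
  have hW : L2On Dom.whole (fun x => V x - p x) := hV.sub hp2
  have hWv : (v - p : HilbertField) =ᵐ[Dom.whole.measure] fun x => V x - p x :=
    (Lp.coeFn_sub v p).trans (hvV.sub (Filter.EventuallyEq.refl _ _))
  -- The remainder of the orthogonal projection is divergence-free and orthogonal to every test
  -- field, hence zero; so `V` lies in the closure.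
  have h0 : (fun x => V x - p x) =ᵐ[volume] 0 := by
    refine ae_eq_zero_of_orthogonal hW (hd.sub hpd hV hp2) fun φ hφ => ?_
    have hφm := hφ.l2On.memLp
    have hmem : hφm.toLp φ ∈ K :=
      testSpace.le_topologicalClosure ⟨φ, hφ, hφm.coeFn_toLp⟩
    rw [← inner_eq_integral _ _ hWv hφm.coeFn_toLp]
    exact K.starProjection_inner_eq_zero v _ hmem
  obtain ⟨w, hw, hlim⟩ := mem_closure_iff_seq_limit.1 hpK
  choose φ hφ hwφ using hw
  refine ⟨φ, hφ, ?_⟩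
  rw [tendsto_iff_norm_sub_tendsto_zero] at hlim
  refine hlim.congr fun n => ?_
  rw [Lp.norm_def, l2]
  congr 1
  refine eLpNorm_congr_ae ?_
  rw [← measure_whole] at h0
  filter_upwards [Lp.coeFn_sub (w n) p, hwφ n, h0] with x h1 h2 h3
  rw [h1, Pi.sub_apply, h2]
  have h4 : V x - p x = 0 := h3
  rw [sub_eq_zero.1 h4]

end Density

/-! ### The weak formulation with time-independent test fields -/

section WeakForm

variable {Ω : Dom} {S : ℝ} {u : ℝ → E3 → E3}

theorem IsLerayHopf.l2On (hu : IsLerayHopf Ω S u) {t : ℝ} (ht : t ∈ Set.Icc 0 S) : L2On Ω (u t) :=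
  ⟨hu.isFunOn t ht, hu.memLp t ht⟩

theorem IsLerayHopf.isDivFree (hu : IsLerayHopf Ω S u) {t : ℝ} (ht : t ∈ Set.Icc 0 S) :
    IsDivFree (u t) := hu.div_free t ht

theorem IsLerayHopf.exists_l2_le (hu : IsLerayHopf Ω S u) :
    ∃ R, 0 ≤ R ∧ ∀ t ∈ Set.Icc 0 S, l2 Ω (u t) ≤ R := by
  obtain ⟨M, hM⟩ := hu.energy_bounded
  refine ⟨Real.sqrt M, Real.sqrt_nonneg _, fun t ht => Real.le_sqrt_of_sq_le ?_⟩
  have h := hM t ht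
  rw [normSq_eq_ofReal (hu.l2On ht), ← ENNReal.ofReal_coe_nnreal] at h
  exact (ENNReal.ofReal_le_ofReal_iff M.2).1 h

/-- The right-hand side of the Navier-Stokes equations tested with `Φ`. -/
def evo (Ω : Dom) (f Φ : E3 → E3) : ℝ :=
  tri Ω f Φ f + ∫ x, inner ℝ (f x) (Laplacian.laplacian Φ x) ∂Ω.measure

theorem L2On.laplacian_conv {V : E3 → E3} (hV : L2On Ω V) (k : 𝓢(E3, ℝ)) :
    L2On Ω (Laplacian.laplacian (NSE.conv k V)) := by
  rw [show Laplacian.laplacian (NSE.conv k V) = fun x => ∑ j : Fin 3, NSE.conv (pd j (pd j k)) V x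
    from funext fun x => NSE.laplacian_conv k hV x]
  exact L2On.sum fun j => (hV.conv (rapid_schwartz _)).1

theorem exists_l2_laplacian_conv_le (Ω : Dom) (k : 𝓢(E3, ℝ)) : ∃ C, 0 ≤ C ∧ ∀ V : E3 → E3,
    L2On Ω V → l2 Ω (Laplacian.laplacian (conv k V)) ≤ C * l2 Ω V := by
  refine ⟨∑ j, ∫ y, ‖pd j (pd j k) y‖, Finset.sum_nonneg fun j _ => integral_nonneg fun y =>
    norm_nonneg _, fun V hV => ?_⟩
  rw [show Laplacian.laplacian (conv k V) = fun x => ∑ j : Fin 3, conv (pd j (pd j k)) V x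
    from funext fun x => laplacian_conv k hV x, Finset.sum_mul]
  refine (L2On.l2_sum_le fun j => (hV.conv (rapid_schwartz _)).1).trans ?_
  exact Finset.sum_le_sum fun j _ => (hV.conv (rapid_schwartz _)).2

/-- Linear in the L² norm of `V`, thanks to the smoothing kernel. This makes the tested equation
continuous under L² approximation of the test field. -/
theorem exists_abs_evo_le (Ω : Dom) (k : 𝓢(E3, ℝ)) : ∃ C, 0 ≤ C ∧ ∀ f V : E3 → E3,
    L2On Ω f → L2On Ω V → |evo Ω f (conv k V)| ≤ C * (l2 Ω f ^ 2 + l2 Ω f) * l2 Ω V := by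
  obtain ⟨C₁, h1, hC1⟩ := exists_norm_fderiv_conv_le (F := E3) Ω k
  obtain ⟨C₂, h2, hC2⟩ := exists_l2_laplacian_conv_le Ω k
  refine ⟨C₁ + C₂, by positivity, fun f V hf hV => ?_⟩
  have h0 := l2_nonneg (Ω := Ω) V
  have h0f := l2_nonneg (Ω := Ω) f
  have e1 := abs_tri_le (b := conv k V) hf hf (mul_nonneg h1 h0) fun x v =>
    (ContinuousLinearMap.le_opNorm _ v).trans
      (mul_le_mul_of_nonneg_right (hC1 V hV x) (norm_nonneg v))
  have e2 := hf.abs_integral_inner_le (hV.laplacian_conv k)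
  have e3 := mul_le_mul_of_nonneg_left (hC2 V hV) h0f
  refine (abs_add_le _ _).trans ((add_le_add e1 (e2.trans e3)).trans ?_)
  have p1 : 0 ≤ C₁ * l2 Ω f * l2 Ω V := by positivity
  have p2 : 0 ≤ C₂ * l2 Ω f ^ 2 * l2 Ω V := by positivity
  nlinarith

theorem evo_conv_sub {f V V' : E3 → E3} (k : 𝓢(E3, ℝ)) (hf : L2On Ω f) (hV : L2On Ω V)
    (hV' : L2On Ω V') : evo Ω f (conv k (fun x => V x - V' x)) =
      evo Ω f (conv k V) - evo Ω f (conv k V') := by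
  have hs : conv k (fun x => V x - V' x) = fun x => conv k V x - conv k V' x :=
    funext fun x => conv_sub (rapid_schwartz k) hV hV' x
  have hd : ∀ x, fderiv ℝ (fun x => conv k V x - conv k V' x) x =
      fderiv ℝ (conv k V) x - fderiv ℝ (conv k V') x := fun x =>
    fderiv_fun_sub (differentiable_conv k hV x) (differentiable_conv k hV' x)
  have hl : ∀ x, Laplacian.laplacian (conv k (fun x => V x - V' x)) x =
      Laplacian.laplacian (conv k V) x - Laplacian.laplacian (conv k V') x := fun x => by
    rw [laplacian_conv k (hV.sub hV'), laplacian_conv k hV, laplacian_conv k hV',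
      ← Finset.sum_sub_distrib]
    exact Finset.sum_congr rfl fun j _ => conv_sub (rapid_schwartz _) hV hV' x
  simp only [evo, hl, inner_sub_right]
  rw [integral_sub (hf.integrable_inner (hV.laplacian_conv k))
    (hf.integrable_inner (hV'.laplacian_conv k)), hs]
  simp only [tri, hd, sub_apply, inner_sub_right]
  rw [integral_sub (integrable_tri hf (bddDeriv_conv k hV) hf)
    (integrable_tri hf (bddDeriv_conv k hV') hf)]
  ring

/-- The weak form of the equations with the time-independent test field `Φ`. -/
def HoldsFor (Ω : Dom) (S : ℝ) (u : ℝ → E3 → E3) (Φ : E3 → E3) : Prop :=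
  ∀ t ∈ Set.Icc 0 S, ∫ x, inner ℝ (u t x) (Φ x) ∂Ω.measure =
    ∫ x, inner ℝ (u 0 x) (Φ x) ∂Ω.measure + ∫ s in (0 : ℝ)..t, evo Ω (u s) Φ

theorem IsLerayHopf.holdsFor_of_smooth (hu : IsLerayHopf Ω S u) {Φ : E3 → E3}
    (hs : ContDiff ℝ ∞ Φ) (hd : ∀ x, divergence Φ x = 0) (hf : Ω.IsFunOn Φ)
    (hc : Ω = Dom.whole → HasCompactSupport Φ) (hb : BddDeriv Φ)
    (hl : L2On Ω (Laplacian.laplacian Φ)) : HoldsFor Ω S u Φ := by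
  intro t ht
  have hS : 0 ≤ S := ht.1.trans ht.2
  -- A time cutoff that is one on a neighbourhood of [0, S]; its derivative does not contribute
  -- there.
  let θ : ContDiffBump (0 : ℝ) := ⟨S + 1, S + 2, by linarith, by linarith⟩
  have hθ1 : ∀ s ∈ Set.Icc (-(S + 1)) (S + 1), θ s = 1 := fun s hs => by
    refine θ.one_of_mem_closedBall ?_
    rw [mem_closedBall_zero_iff, Real.norm_eq_abs, abs_le]
    exact hs
  have hθe : ∀ s ∈ Set.Icc 0 S, (fun r => θ r) =ᶠ[𝓝 s] fun _ => 1 := fun s hs => by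
    filter_upwards [Icc_mem_nhds (show -(S + 1) < s by linarith [hs.1])
      (show s < S + 1 by linarith [hs.2])] with r hr
    exact hθ1 r hr
  have htest : Ω.IsTest (fun t x => θ t • Φ x) := by
    refine ⟨(θ.contDiff.comp contDiff_fst).smul (hs.comp contDiff_snd), fun t x => ?_, fun t => ?_,
      fun hΩ => ?_⟩
    · have := hd x
      simp only [divergence] at this ⊢
      rw [fderiv_fun_const_smul (hb.diff x)]
      simp only [smul_apply, PiLp.smul_apply, ← Finset.smul_sum, this, smul_zero]
    · exact hf.comp fun v => θ t • v
    · refine HasCompactSupport.intro (θ.hasCompactSupport.isCompact.prod (hc hΩ).isCompact)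
        fun z hz => ?_
      simp only [Set.mem_prod, not_and_or] at hz
      rcases hz with hz | hz
      · simp [image_eq_zero_of_notMem_tsupport hz]
      · simp [image_eq_zero_of_notMem_tsupport hz]
  have h := hu.weak_form _ htest t ht
  have e1 : ∀ s ∈ Set.Icc 0 S, θ s = 1 := fun s hs => (hθe s hs).eq_of_nhds
  simp only [e1 t ht, e1 0 ⟨le_rfl, hS⟩, one_smul] at h
  rw [h]
  congr 1
  refine intervalIntegral.integral_congr fun s hs' => ?_
  rw [Set.uIcc_of_le ht.1] at hs'
  have hsS : s ∈ Set.Icc 0 S := ⟨hs'.1, hs'.2.trans ht.2⟩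
  have e2 : ∀ x, deriv (fun r => θ r • Φ x) s = 0 := fun x => by
    have : (fun r => θ r • Φ x) =ᶠ[𝓝 s] fun _ => Φ x := by
      filter_upwards [hθe s hsS] with r hr
      rw [hr, one_smul]
    rw [this.deriv_eq, deriv_const]
  have hus := hu.l2On hsS
  simp only [e1 s hsS, one_smul, e2, inner_zero_right, zero_add, evo, tri]
  exact integral_add (integrable_tri hus hb hus) (hus.integrable_inner hl)

end WeakForm

/-! ### Measurability in time -/

section Measurability

variable {Ω : Dom} {S : ℝ} {u : ℝ → E3 → E3}

/-- The restriction of the measure of time to `[0, S]`. -/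
abbrev timeMeasure (S : ℝ) : Measure ℝ := volume.restrict (Set.Icc 0 S)

theorem IsLerayHopf.aestronglyMeasurable (hu : IsLerayHopf Ω S u) :
    AEStronglyMeasurable (fun z : ℝ × E3 => u z.1 z.2) ((timeMeasure S).prod volume) := by
  have := hu.measurable
  rwa [Measure.volume_eq_prod, ← Measure.prod_restrict, Measure.restrict_univ] at this

theorem timeMeasure_prod_absolutelyContinuous (Ω : Dom) (S : ℝ) :
    (timeMeasure S).prod Ω.measure ≪ (timeMeasure S).prod volume :=
  Measure.AbsolutelyContinuous.rfl.prod (measure_absolutelyContinuous Ω)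

theorem aestronglyMeasurable_conv_prod (hu : IsLerayHopf Ω S u) {k : E3 → ℝ} (hk : Continuous k) :
    AEStronglyMeasurable (fun z : ℝ × E3 => conv k (u z.1) z.2)
      ((timeMeasure S).prod Ω.measure) := by
  refine AEStronglyMeasurable.mono_ac (timeMeasure_prod_absolutelyContinuous Ω S) ?_
  simp only [conv_eq]
  have hq : Measure.QuasiMeasurePreserving (Prod.map Prod.fst id : (ℝ × E3) × E3 → ℝ × E3)
      (((timeMeasure S).prod volume).prod volume) ((timeMeasure S).prod volume) :=
    MeasureTheory.QuasiMeasurePreserving.prodMap Measure.quasiMeasurePreserving_fst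
      (Measure.QuasiMeasurePreserving.id _)
  have h1 := hu.aestronglyMeasurable.comp_quasiMeasurePreserving hq
  have h2 : AEStronglyMeasurable (fun z : (ℝ × E3) × E3 => k (z.1.2 - z.2) • u z.1.1 z.2)
      (((timeMeasure S).prod volume).prod volume) :=
    (Continuous.aestronglyMeasurable (f := fun z : (ℝ × E3) × E3 => k (z.1.2 - z.2))
      (by fun_prop)).smul h1
  exact h2.integral_prod_right'

theorem aestronglyMeasurable_inner_conv (hu : IsLerayHopf Ω S u) {k : E3 → ℝ} (hk : Continuous k) :
    AEStronglyMeasurable (fun s => ∫ x, inner ℝ (u s x) (conv k (u s) x) ∂Ω.measure)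
      (timeMeasure S) := by
  have h : AEStronglyMeasurable (fun z : ℝ × E3 => inner ℝ (u z.1 z.2) (conv k (u z.1) z.2))
      ((timeMeasure S).prod Ω.measure) :=
    (hu.aestronglyMeasurable.mono_ac (timeMeasure_prod_absolutelyContinuous Ω S)).inner
      (aestronglyMeasurable_conv_prod hu hk)
  exact h.integral_prod_right'

/-- Measurability in time of the flux. -/
theorem aestronglyMeasurable_tri_conv (hu : IsLerayHopf Ω S u) (k : 𝓢(E3, ℝ)) :
    AEStronglyMeasurable (fun s => tri Ω (u s) (conv k (u s)) (u s)) (timeMeasure S) := by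
  have hm := hu.aestronglyMeasurable.mono_ac (timeMeasure_prod_absolutelyContinuous Ω S)
  have h : AEStronglyMeasurable (fun z : ℝ × E3 => inner ℝ (u z.1 z.2)
      (∑ j : Fin 3, u z.1 z.2 j • conv (pd j k) (u z.1) z.2)) ((timeMeasure S).prod Ω.measure) := by
    refine hm.inner (Finset.aestronglyMeasurable_fun_sum _ fun j _ => ?_)
    have h1 : AEStronglyMeasurable (fun z : ℝ × E3 => u z.1 z.2 j)
        ((timeMeasure S).prod Ω.measure) :=
      (EuclideanSpace.proj j : E3 →L[ℝ] ℝ).continuous.comp_aestronglyMeasurable hm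
    exact h1.smul (aestronglyMeasurable_conv_prod hu (pd j k).continuous)
  refine h.integral_prod_right'.congr ?_
  filter_upwards [ae_restrict_mem measurableSet_Icc] with s hs
  simp only [tri, fderiv_conv_eq_sum k (hu.l2On hs)]

theorem aestronglyMeasurable_evo_conv_self (hu : IsLerayHopf Ω S u) (k : 𝓢(E3, ℝ)) :
    AEStronglyMeasurable (fun s => evo Ω (u s) (conv k (u s))) (timeMeasure S) := by
  refine (aestronglyMeasurable_tri_conv hu k).add ?_
  have h := Finset.aestronglyMeasurable_fun_sum (μ := timeMeasure S) Finset.univ fun j _ =>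
    aestronglyMeasurable_inner_conv hu (pd j (pd j k)).continuous
  refine h.congr ?_
  filter_upwards [ae_restrict_mem measurableSet_Icc] with s hs
  have hus := hu.l2On hs
  simp only [laplacian_conv k hus, inner_sum]
  rw [integral_finsetSum _ fun j _ => hus.integrable_inner (hus.conv (rapid_schwartz _)).1]

theorem aestronglyMeasurable_evo (hu : IsLerayHopf Ω S u) {Φ : E3 → E3} (hb : BddDeriv Φ)
    (hl : L2On Ω (Laplacian.laplacian Φ)) :
    AEStronglyMeasurable (fun s => evo Ω (u s) Φ) (timeMeasure S) := by
  have hm := hu.aestronglyMeasurable.mono_ac (timeMeasure_prod_absolutelyContinuous Ω S)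
  have h1 : AEStronglyMeasurable (fun z : ℝ × E3 => inner ℝ (u z.1 z.2)
      (fderiv ℝ Φ z.2 (u z.1 z.2))) ((timeMeasure S).prod Ω.measure) := by
    refine hm.inner ?_
    exact (ContinuousLinearMap.id ℝ (E3 →L[ℝ] E3)).aestronglyMeasurable_comp₂
      (hb.cont.comp continuous_snd).aestronglyMeasurable hm
  have h2 : AEStronglyMeasurable (fun z : ℝ × E3 => inner ℝ (u z.1 z.2)
      (Laplacian.laplacian Φ z.2)) ((timeMeasure S).prod Ω.measure) :=
    hm.inner (hl.memLp.1.comp_quasiMeasurePreserving Measure.quasiMeasurePreserving_snd)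
  exact h1.integral_prod_right'.add h2.integral_prod_right'

end Measurability

/-! ### Evolution and energy balance of the low frequencies -/

section Evolution

variable {Ω : Dom} {S : ℝ} {u : ℝ → E3 → E3} {χ : ℝ → ℝ}

theorem exists_abs_evo_conv_le (hu : IsLerayHopf Ω S u) (k : 𝓢(E3, ℝ)) :
    ∃ B, 0 ≤ B ∧ ∀ s ∈ Set.Icc 0 S, ∀ V, L2On Ω V → |evo Ω (u s) (conv k V)| ≤ B * l2 Ω V := by
  obtain ⟨R, hR, hRu⟩ := hu.exists_l2_le
  obtain ⟨C, hC, h⟩ := exists_abs_evo_le Ω k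
  refine ⟨C * (R ^ 2 + R), by positivity, fun s hs V hV => (h _ V (hu.l2On hs) hV).trans ?_⟩
  have := hRu s hs
  have h0 := l2_nonneg (Ω := Ω) (u s)
  have h1 := l2_nonneg (Ω := Ω) V
  gcongr

theorem abs_intervalIntegral_le {f : ℝ → ℝ} {a b C : ℝ} (h : ∀ x ∈ Set.uIoc a b, |f x| ≤ C) :
    |∫ x in a..b, f x| ≤ C * |b - a| := by
  rw [← Real.norm_eq_abs]
  exact intervalIntegral.norm_integral_le_of_norm_le_const h

theorem intervalIntegrable_of_bdd {f : ℝ → ℝ} {S C : ℝ}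
    (hf : AEStronglyMeasurable f (timeMeasure S)) (hC : ∀ s ∈ Set.Icc 0 S, |f s| ≤ C) {a b : ℝ}
    (ha : a ∈ Set.Icc 0 S) (hb : b ∈ Set.Icc 0 S) : IntervalIntegrable f volume a b := by
  have h : IntegrableOn f (Set.Icc 0 S) := by
    refine Integrable.of_bound (C := C) hf ?_
    filter_upwards [ae_restrict_mem measurableSet_Icc] with s hs
    exact hC s hs
  exact (h.mono_set (Set.uIcc_subset_Icc ha hb)).intervalIntegrable

theorem intervalIntegrable_evo (hu : IsLerayHopf Ω S u) (k : 𝓢(E3, ℝ)) {V : E3 → E3}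
    (hV : L2On Ω V) {a b : ℝ} (ha : a ∈ Set.Icc 0 S) (hb : b ∈ Set.Icc 0 S) :
    IntervalIntegrable (fun s => evo Ω (u s) (conv k V)) volume a b := by
  obtain ⟨B, -, hB⟩ := exists_abs_evo_conv_le hu k
  exact intervalIntegrable_of_bdd (aestronglyMeasurable_evo hu (bddDeriv_conv k hV)
    (hV.laplacian_conv k)) (fun s hs => hB s hs V hV) ha hb

/-- Every term of the tested equation is bounded by the L² norm of the field before smoothing,
uniformly in time, so L² convergence is enough even though the approximants are differentiated
twice. -/
theorem HoldsFor.conv_of_tendsto (hu : IsLerayHopf Ω S u) (k : 𝓢(E3, ℝ)) {V : E3 → E3}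
    {W : ℕ → E3 → E3} (hV : L2On Ω V) (hW : ∀ n, L2On Ω (W n))
    (h : ∀ n, HoldsFor Ω S u (conv k (W n)))
    (hlim : Tendsto (fun n => l2 Ω (fun x => W n x - V x)) atTop (𝓝 0)) :
    HoldsFor Ω S u (conv k V) := by
  intro t ht
  have h0S : (0 : ℝ) ∈ Set.Icc 0 S := ⟨le_rfl, ht.1.trans ht.2⟩
  have hr := rapid_schwartz k
  have hin : ∀ s ∈ Set.Icc 0 S, Tendsto (fun n => ∫ x, inner ℝ (u s x) (conv k (W n) x) ∂Ω.measure)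
      atTop (𝓝 (∫ x, inner ℝ (u s x) (conv k V x) ∂Ω.measure)) := by
    intro s hs
    have hus := hu.l2On hs
    rw [tendsto_iff_norm_sub_tendsto_zero]
    refine squeeze_zero (fun _ => norm_nonneg _) (fun n => ?_)
      (by simpa using hlim.const_mul (l2 Ω (u s) * ∫ y, ‖k y‖))
    rw [← integral_sub (hus.integrable_inner ((hW n).conv hr).1)
      (hus.integrable_inner (hV.conv hr).1)]
    simp only [← inner_sub_right, ← conv_sub hr (hW n) hV]
    refine (hus.abs_integral_inner_le (((hW n).sub hV).conv hr).1).trans ?_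
    rw [mul_assoc]
    exact mul_le_mul_of_nonneg_left (((hW n).sub hV).conv hr).2 (l2_nonneg _)
  have hint : Tendsto (fun n => ∫ s in (0 : ℝ)..t, evo Ω (u s) (conv k (W n))) atTop
      (𝓝 (∫ s in (0 : ℝ)..t, evo Ω (u s) (conv k V))) := by
    obtain ⟨B, hB0, hB⟩ := exists_abs_evo_conv_le hu k
    rw [tendsto_iff_norm_sub_tendsto_zero]
    refine squeeze_zero (fun _ => norm_nonneg _) (fun n => ?_)
      (by simpa using (hlim.const_mul B).mul_const |t|)
    rw [← intervalIntegral.integral_sub (intervalIntegrable_evo hu k (hW n) h0S ht)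
      (intervalIntegrable_evo hu k hV h0S ht)]
    rw [Real.norm_eq_abs]
    refine (abs_intervalIntegral_le (C := B * l2 Ω fun x => W n x - V x) fun s hs => ?_).trans
      (by rw [sub_zero])
    rw [Set.uIoc_of_le ht.1] at hs
    have hs' : s ∈ Set.Icc 0 S := ⟨hs.1.le, hs.2.trans ht.2⟩
    rw [← evo_conv_sub k (hu.l2On hs') (hW n) hV]
    exact hB s hs' _ ((hW n).sub hV)
  have hR := (hin 0 h0S).add hint
  refine tendsto_nhds_unique (hin t ht) (hR.congr fun n => ?_)
  exact (h n t ht).symm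

theorem hasCompactSupport_conv {k : E3 → ℝ} {f : E3 → E3} (hk : HasCompactSupport k)
    (hf : HasCompactSupport f) : HasCompactSupport (conv k f) :=
  HasCompactSupport.convolution (L := ContinuousLinearMap.lsmul ℝ ℝ) (μ := volume) hk hf

/-- Convolution with a compactly supported mollifier keeps compactly supported test fields
admissible; density does the rest. -/
theorem holdsFor_conv_moll {u : ℝ → E3 → E3} (hu : IsLerayHopf Dom.whole S u) {V : E3 → E3}
    (hV : L2On Dom.whole V) (hd : IsDivFree V) (n : ℕ) :
    HoldsFor Dom.whole S u (conv (moll n) V) := by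
  obtain ⟨φ, hφ, hlim⟩ := exists_test_seq hV hd
  refine HoldsFor.conv_of_tendsto hu (moll n) hV (fun m => (hφ m).l2On) (fun m => ?_) hlim
  have h2 := (hφ m).l2On
  exact hu.holdsFor_of_smooth (contDiff_conv _ h2) ((hφ m).isDivFree.divergence_conv h2 _) trivial
    (fun _ => hasCompactSupport_conv (hasCompactSupport_moll n) (hφ m).compact)
    (bddDeriv_conv _ h2) (h2.laplacian_conv _)

/-- The equations may be tested with low-frequency divergence-free fields. -/
theorem IsLerayHopf.holdsFor_below (hu : IsLerayHopf Ω S u) (hχ : IsLPProfile χ) (p : ℕ)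
    {V : E3 → E3} (hV : L2On Ω V) (hd : IsDivFree V) :
    HoldsFor Ω S u (conv (lpK hχ p) V) := by
  have hk := rapid_schwartz (lpK hχ p)
  cases Ω with
  | torus =>
    exact hu.holdsFor_of_smooth (contDiff_conv _ hV) (hd.divergence_conv hV _)
      (conv_isFunOn hV.isFunOn) (fun h => by cases h) (bddDeriv_conv _ hV) (hV.laplacian_conv _)
  | whole =>
    set W := conv (lpK hχ p) V with hW
    have hW2 : L2On Dom.whole W := (hV.conv hk).1
    have hWd : IsDivFree W := hd.conv hV hk
    -- Inserting a projection at scale p + 1 provides the fixed smoothing kernel required by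
    -- `HoldsFor.conv_of_tendsto`; the mollified fields then need to converge in L² only.
    have hrep : conv (lpK hχ (p + 1)) W = W := by
      rw [hW, coe_lpK, coe_lpK]
      exact conv_below_of_lt hχ hχ (Nat.lt_succ_self p) hV
    have hm := fun n => rapid_schwartz (moll n)
    rw [← hrep]
    refine HoldsFor.conv_of_tendsto (W := fun n => conv (moll n) W) hu _ hW2
      (fun n => (hW2.conv (hm n)).1) (fun n => ?_) ?_
    · rw [conv_conv_comm (rapid_schwartz _) (hm n) hW2, hrep]
      exact holdsFor_conv_moll hu hW2 hWd n
    · have hlim : Tendsto (fun n : ℕ => 2 * ((n : ℝ) + 1)⁻¹ * l2 Dom.whole (grad W)) atTop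
          (𝓝 0) := by
        have := (tendsto_one_div_add_atTop_nhds_zero_nat (𝕜 := ℝ)).const_mul 2
        simpa using this.mul_const (l2 Dom.whole (grad W))
      refine squeeze_zero (fun _ => l2_nonneg _) (fun n => ?_) hlim
      have h1 := l2_sub_conv_le (moll n) (integral_moll n) hW2 ((contDiff_conv (lpK hχ p) hV).of_le
        (show (1 : WithTop ℕ∞) ≤ (∞ : WithTop ℕ∞) by exact_mod_cast le_top)) (hV.grad_conv _)
      have h2 : l2 Dom.whole (fun x => conv (moll n) W x - W x) =
          l2 Dom.whole (fun x => W x - conv (moll n) W x) := by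
        rw [l2, l2]
        congr 1
        exact eLpNorm_sub_comm _ _ _ _
      rw [h2]
      exact h1.trans (mul_le_mul_of_nonneg_right (integral_norm_mul_moll_le n) (l2_nonneg _))

theorem HoldsFor.integral_sub {V : E3 → E3} (hu : IsLerayHopf Ω S u) {k : 𝓢(E3, ℝ)}
    (hV : L2On Ω V) (h : HoldsFor Ω S u (conv k V)) {s t : ℝ} (hs : s ∈ Set.Icc 0 S)
    (ht : t ∈ Set.Icc 0 S) :
    ∫ x, inner ℝ (u t x - u s x) (conv k V x) ∂Ω.measure =
      ∫ r in s..t, evo Ω (u r) (conv k V) := by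
  have h0S : (0 : ℝ) ∈ Set.Icc 0 S := ⟨le_rfl, ht.1.trans ht.2⟩
  have hc := (hV.conv (rapid_schwartz k)).1
  simp only [inner_sub_left]
  rw [MeasureTheory.integral_sub ((hu.l2On ht).integrable_inner hc)
    ((hu.l2On hs).integrable_inner hc), h t ht, h s hs,
    ← intervalIntegral.integral_interval_sub_left (intervalIntegrable_evo hu k hV h0S ht)
    (intervalIntegrable_evo hu k hV h0S hs)]
  ring

/-- Let V be the low-frequency part of the increment. Self-adjointness writes ‖V‖² as the increment
of u tested with the projection of V, which the equation bounds by B‖V‖|t - s|; one factor ‖V‖ is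
divided out. -/
theorem exists_l2_below_sub_le (hu : IsLerayHopf Ω S u) (hχ : IsLPProfile χ) (p : ℕ) :
    ∃ C, 0 ≤ C ∧ ∀ s ∈ Set.Icc 0 S, ∀ t ∈ Set.Icc 0 S,
      l2 Ω (conv (lpK hχ p) (fun x => u t x - u s x)) ≤ C * |t - s| := by
  obtain ⟨B, hB0, hB⟩ := exists_abs_evo_conv_le hu (lpK hχ p)
  refine ⟨B, hB0, fun s hs t ht => ?_⟩
  set w : E3 → E3 := fun x => u t x - u s x with hw
  have hw2 : L2On Ω w := (hu.l2On ht).sub (hu.l2On hs)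
  have hwd : IsDivFree w := (hu.isDivFree ht).sub (hu.isDivFree hs) (hu.l2On ht) (hu.l2On hs)
  have hk := rapid_schwartz (lpK hχ p)
  set V := conv (lpK hχ p) w with hV
  have hV2 : L2On Ω V := (hw2.conv hk).1
  have hVd : IsDivFree V := hwd.conv hw2 hk
  have h1 := (hu.holdsFor_below hχ p hV2 hVd).integral_sub hu hV2 hs ht
  have h2 : l2 Ω V ^ 2 = ∫ x, inner ℝ (w x) (conv (lpK hχ p) V x) ∂Ω.measure := by
    rw [hV2.l2_sq]
    simp only [← real_inner_self_eq_norm_sq]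
    have := integral_inner_conv hk hw2 hV2
    simp only [lpK_neg] at this
    exact this
  have h3 : l2 Ω V ^ 2 ≤ B * l2 Ω V * |t - s| := by
    rw [h2, h1]
    refine (le_abs_self _).trans (abs_intervalIntegral_le fun r hr => ?_)
    exact hB r (Set.uIcc_subset_Icc hs ht (Set.uIoc_subset_uIcc hr)) V hV2
  by_contra! hlt
  have h4 : 0 ≤ B * |t - s| := by positivity
  nlinarith

/-- Quadratic increments force the derivative to vanish everywhere. -/
theorem exists_const_of_sq_bound {H : ℝ → ℝ} {a b C : ℝ}
    (h : ∀ s ∈ Set.Icc a b, ∀ t ∈ Set.Icc a b, s ≤ t → |H t - H s| ≤ C * (t - s) ^ 2) :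
    ∀ t ∈ Set.Icc a b, H t = H a := by
  have hC : ∀ s ∈ Set.Icc a b, ∀ t ∈ Set.Icc a b, |H t - H s| ≤ C * (t - s) ^ 2 := by
    intro s hs t ht
    rcases le_total s t with hst | hst
    · exact h s hs t ht hst
    · rw [abs_sub_comm, show (t - s) ^ 2 = (s - t) ^ 2 by ring]
      exact h t ht s hs hst
  have hd : ∀ x ∈ Set.Icc a b, HasDerivWithinAt H 0 (Set.Icc a b) x := by
    intro x hx
    rw [hasDerivWithinAt_iff_isLittleO]
    have hO : (fun y => H y - H x - (y - x) • (0 : ℝ)) =O[𝓝[Set.Icc a b] x]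
        fun y => (y - x) ^ 2 := by
      refine Asymptotics.IsBigO.of_bound C ?_
      filter_upwards [self_mem_nhdsWithin] with y hy
      simpa using hC x hx y hy
    refine hO.trans_isLittleO ?_
    have : Tendsto (fun y : ℝ => y - x) (𝓝[Set.Icc a b] x) (𝓝 0) := by
      have : Tendsto (fun y : ℝ => y - x) (𝓝 x) (𝓝 (x - x)) :=
        (continuous_id.sub continuous_const).tendsto x
      rw [sub_self] at this
      exact this.mono_left nhdsWithin_le_nhds
    have h1 := (Asymptotics.isLittleO_pow_id (𝕜 := ℝ) one_lt_two).comp_tendsto this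
    exact h1
  refine constant_of_derivWithin_zero (fun x hx => (hd x hx).differentiableWithinAt) fun x hx => ?_
  have hab : a < b := hx.1.trans_lt hx.2
  exact (hd x ⟨hx.1, hx.2.le⟩).derivWithin (uniqueDiffOn_Icc hab x ⟨hx.1, hx.2.le⟩)

theorem exists_abs_evo_below_le (hu : IsLerayHopf Ω S u) (hχ : IsLPProfile χ) (p : ℕ) :
    ∃ C, ∀ r ∈ Set.Icc 0 S, |evo Ω (u r) (conv (lpK hχ p) (u r))| ≤ C := by
  obtain ⟨B, hB0, hB⟩ := exists_abs_evo_conv_le hu (lpK hχ p)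
  obtain ⟨R, hR, hRu⟩ := hu.exists_l2_le
  exact ⟨B * R, fun r hr => (hB r hr _ (hu.l2On hr)).trans
    (mul_le_mul_of_nonneg_left (hRu r hr) hB0)⟩

theorem intervalIntegrable_evo_below (hu : IsLerayHopf Ω S u) (hχ : IsLPProfile χ) (p : ℕ) {a b : ℝ}
    (ha : a ∈ Set.Icc 0 S) (hb : b ∈ Set.Icc 0 S) :
    IntervalIntegrable (fun r => evo Ω (u r) (conv (lpK hχ p) (u r))) volume a b := by
  obtain ⟨C, hC⟩ := exists_abs_evo_below_le hu hχ p
  exact intervalIntegrable_of_bdd (aestronglyMeasurable_evo_conv_self hu _) hC ha hb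

/-- The energy balance for the low frequencies. -/
theorem IsLerayHopf.energy_below (hu : IsLerayHopf Ω S u) (hχ : IsLPProfile χ) (p : ℕ) {s t : ℝ}
    (hs : s ∈ Set.Icc 0 S) (ht : t ∈ Set.Icc 0 S) :
    ∫ x, inner ℝ (u t x) (conv (lpK hχ p) (u t) x) ∂Ω.measure =
      ∫ x, inner ℝ (u s x) (conv (lpK hχ p) (u s) x) ∂Ω.measure +
        2 * ∫ r in s..t, evo Ω (u r) (conv (lpK hχ p) (u r)) := by
  set k := lpK hχ p with hk
  have hr := rapid_schwartz k
  set g : ℝ → ℝ := fun t => ∫ x, inner ℝ (u t x) (conv k (u t) x) ∂Ω.measure with hg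
  set h : ℝ → ℝ := fun r => evo Ω (u r) (conv k (u r)) with hh
  have hint := fun {a b : ℝ} (ha : a ∈ Set.Icc 0 S) (hb : b ∈ Set.Icc 0 S) =>
    intervalIntegrable_evo_below hu hχ p ha hb
  obtain ⟨B, hB0, hB⟩ := exists_abs_evo_conv_le hu (lpK hχ (p + 1))
  obtain ⟨C, hC0, hC⟩ := exists_l2_below_sub_le hu hχ p
  have h0S : (0 : ℝ) ∈ Set.Icc 0 S := ⟨le_rfl, ht.1.trans ht.2⟩
  -- Freezing the test field at time q instead of r costs O(|q - r|), since low frequencies are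
  -- Lipschitz in time. Scale p + 1 serves to reproduce the increment, so that the bound involves
  -- its low-frequency part only.
  have hcmp : ∀ r ∈ Set.Icc 0 S, ∀ q ∈ Set.Icc 0 S,
      |evo Ω (u r) (conv k (u q)) - h r| ≤ B * (C * |q - r|) := by
    intro r hr' q hq
    have hsub : L2On Ω (fun x => u q x - u r x) := (hu.l2On hq).sub (hu.l2On hr')
    have hc2 : L2On Ω (conv k (fun x => u q x - u r x)) := (hsub.conv hr).1
    have hrep : conv (lpK hχ (p + 1)) (conv k (fun x => u q x - u r x)) =
        conv k (fun x => u q x - u r x) := by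
      rw [hk, coe_lpK, coe_lpK]
      exact conv_below_of_lt hχ hχ (Nat.lt_succ_self p) hsub
    rw [hh, ← evo_conv_sub k (hu.l2On hr') (hu.l2On hq) (hu.l2On hr'), ← hrep]
    exact (hB r hr' _ hc2).trans (mul_le_mul_of_nonneg_left (hC r hr' q hq) hB0)
  -- The equation admits only test fields frozen in time. By symmetry of the kernel, the increment
  -- of ⟨u, ku⟩ is the sum of increments tested with the fields frozen at t and at s; replacing both
  -- by the running field makes an error quadratic in t - s, hence none at all.
  have hquad : ∀ s ∈ Set.Icc 0 S, ∀ t ∈ Set.Icc 0 S, s ≤ t →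
      |(g t - 2 * ∫ r in (0 : ℝ)..t, h r) - (g s - 2 * ∫ r in (0 : ℝ)..s, h r)| ≤
        (2 * (B * C)) * (t - s) ^ 2 := by
    intro s hs t ht hst
    have hus := hu.l2On hs
    have hut := hu.l2On ht
    have hcs := (hus.conv hr).1
    have hct := (hut.conv hr).1
    have e1 := (hu.holdsFor_below hχ p hut (hu.isDivFree ht)).integral_sub hu hut hs ht
    have e2 := (hu.holdsFor_below hχ p hus (hu.isDivFree hs)).integral_sub hu hus hs ht
    have e3 : ∫ x, inner ℝ (u s x) (conv k (u t) x) ∂Ω.measure =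
        ∫ x, inner ℝ (u t x) (conv k (u s) x) ∂Ω.measure := by
      have := integral_inner_conv hr hus hut
      simp only [hk, lpK_neg] at this
      simp only [hk, ← this, real_inner_comm]
    have e4 : g t - g s = (∫ r in s..t, evo Ω (u r) (conv k (u t))) +
        ∫ r in s..t, evo Ω (u r) (conv k (u s)) := by
      rw [← e1, ← e2]
      simp only [inner_sub_left, hg]
      rw [integral_sub (hut.integrable_inner hct) (hus.integrable_inner hct),
        integral_sub (hut.integrable_inner hcs) (hus.integrable_inner hcs), e3]
      ring
    have e5 : (g t - 2 * ∫ r in (0 : ℝ)..t, h r) - (g s - 2 * ∫ r in (0 : ℝ)..s, h r) =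
        (∫ r in s..t, (evo Ω (u r) (conv k (u t)) - h r)) +
          ∫ r in s..t, (evo Ω (u r) (conv k (u s)) - h r) := by
      rw [intervalIntegral.integral_sub (intervalIntegrable_evo hu k hut hs ht) (hint hs ht),
        intervalIntegral.integral_sub (intervalIntegrable_evo hu k hus hs ht) (hint hs ht),
        ← intervalIntegral.integral_interval_sub_left (hint h0S ht) (hint h0S hs)]
      linarith [e4]
    have e6 : ∀ q ∈ Set.Icc s t, |∫ r in s..t, (evo Ω (u r) (conv k (u q)) - h r)| ≤
        B * (C * (t - s)) * |t - s| := by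
      intro q hq
      refine abs_intervalIntegral_le fun r hr' => ?_
      rw [Set.uIoc_of_le hst] at hr'
      refine (hcmp r ⟨hs.1.trans hr'.1.le, hr'.2.trans ht.2⟩ q
        ⟨hs.1.trans hq.1, hq.2.trans ht.2⟩).trans ?_
      have : |q - r| ≤ t - s := abs_le.2 ⟨by linarith [hq.1, hr'.2], by linarith [hq.2, hr'.1]⟩
      gcongr
    rw [e5]
    refine (abs_add_le _ _).trans ((add_le_add (e6 t ⟨hst, le_rfl⟩) (e6 s ⟨le_rfl, hst⟩)).trans ?_)
    rw [abs_of_nonneg (sub_nonneg.2 hst)]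
    exact le_of_eq (by ring)
  have c1 := exists_const_of_sq_bound hquad t ht
  have c2 := exists_const_of_sq_bound hquad s hs
  have c3 := intervalIntegral.integral_interval_sub_left (hint h0S ht) (hint h0S hs)
  change g t = g s + 2 * ∫ r in s..t, h r
  have c4 : ∫ r in s..t, h r = (∫ r in (0 : ℝ)..t, h r) - ∫ r in (0 : ℝ)..s, h r := c3.symm
  rw [c4]
  linarith

end Evolution

/-! ### Energy inequality for the high frequencies -/

section HighFrequencyEnergy

variable {Ω : Dom} {S : ℝ} {u : ℝ → E3 → E3} {χ : ℝ → ℝ}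

/-- The nonlinear flux through scale `p`. -/
def flux (χ : ℝ → ℝ) (Ω : Dom) (p : ℕ) (f : E3 → E3) : ℝ :=
  tri Ω f (conv (belowKernel (sqProfile χ) p) f) f

theorem evo_eq_flux_add_visc (hχ : IsLPProfile χ) (p : ℕ) (f : E3 → E3) :
    evo Ω f (conv (lpK hχ.sqProfile p) f) = flux χ Ω p f + visc χ Ω p f := by
  rw [coe_lpK]; rfl

theorem integrableOn_flux (hu : IsLerayHopf Ω S u) (hχ : IsLPProfile χ) (p : ℕ) :
    IntegrableOn (fun s => flux χ Ω p (u s)) (Set.Icc 0 S) := by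
  obtain ⟨R, hR, hRu⟩ := hu.exists_l2_le
  obtain ⟨C, hC, h⟩ := exists_norm_fderiv_conv_le (F := E3) Ω (lpK hχ.sqProfile p)
  refine Integrable.of_bound (C := C * R * (R * R)) ?_ ?_
  · have := aestronglyMeasurable_tri_conv hu (lpK hχ.sqProfile p)
    rw [coe_lpK] at this
    exact this
  · filter_upwards [ae_restrict_mem measurableSet_Icc] with s hs
    have hus := hu.l2On hs
    have hr := hRu s hs
    have h0 := l2_nonneg (Ω := Ω) (u s)
    rw [Real.norm_eq_abs, flux, ← coe_lpK hχ.sqProfile]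
    refine (abs_tri_le hus hus (mul_nonneg hC h0) fun x v =>
      (ContinuousLinearMap.le_opNorm _ v).trans
        (mul_le_mul_of_nonneg_right (h _ hus x) (norm_nonneg v))).trans ?_
    gcongr

theorem integrableOn_visc (hu : IsLerayHopf Ω S u) (hχ : IsLPProfile χ) (p : ℕ) :
    IntegrableOn (fun s => visc χ Ω p (u s)) (Set.Icc 0 S) := by
  by_cases hS : 0 ≤ S
  · have h1 := intervalIntegrable_evo_below hu hχ.sqProfile p (a := 0) (b := S) ⟨le_rfl, hS⟩
      ⟨hS, le_rfl⟩
    rw [intervalIntegrable_iff_integrableOn_Icc_of_le hS] at h1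
    refine (h1.sub (integrableOn_flux hu hχ p)).congr (Eventually.of_forall fun s => ?_)
    simp only [Pi.sub_apply, evo_eq_flux_add_visc hχ]
    ring
  · simp [Set.Icc_eq_empty hS]

theorem ofReal_add_two_mul {a b : ℝ} (ha : 0 ≤ a) (hb : 0 ≤ b) :
    ENNReal.ofReal a + 2 * ENNReal.ofReal b = ENNReal.ofReal (a + 2 * b) := by
  rw [ENNReal.ofReal_add ha (by positivity), ENNReal.ofReal_mul (by norm_num), ENNReal.ofReal_ofNat]

/-- The energy inequality for the high frequencies. -/
theorem IsLerayHopf.energy_above (hu : IsLerayHopf Ω S u) (hχ : IsLPProfile χ) (p : ℕ) {t₀ t : ℝ}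
    (ht₀ : t₀ ∈ Set.Icc 0 S) (ht : t ∈ Set.Icc 0 S) (h0t : t₀ ≤ t)
    (he : Ω.normSq (u t) + 2 * ∫⁻ s in Set.Icc t₀ t, Ω.gradNormSq (u s) ≤ Ω.normSq (u t₀)) :
    Ω.normSq (above χ p (u t)) + 2 * ∫⁻ s in Set.Icc t₀ t, Ω.gradNormSq (above χ p (u s)) ≤
      Ω.normSq (above χ p (u t₀)) +
        2 * ∫⁻ s in Set.Icc t₀ t, ENNReal.ofReal |flux χ Ω p (u s)| := by
  have hsub : Set.Icc t₀ t ⊆ Set.Icc 0 S := Set.Icc_subset_Icc ht₀.1 ht.2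
  set μ := volume.restrict (Set.Icc t₀ t) with hμ
  have hF : Integrable (fun s => flux χ Ω p (u s)) μ := (integrableOn_flux hu hχ p).mono_set hsub
  have hN : Integrable (fun s => visc χ Ω p (u s)) μ := (integrableOn_visc hu hχ p).mono_set hsub
  set D := ∫⁻ s, Ω.gradNormSq (u s) ∂μ with hD
  set DQ := ∫⁻ s, Ω.gradNormSq (above χ p (u s)) ∂μ with hDQ
  set P := ∫⁻ s, ENNReal.ofReal (visc χ Ω p (u s)) ∂μ with hP
  set N := ∫⁻ s, ENNReal.ofReal (-visc χ Ω p (u s)) ∂μ with hN'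
  set Φ := ∫⁻ s, ENNReal.ofReal |flux χ Ω p (u s)| ∂μ with hΦ
  have hDfin : D ≠ ⊤ := ((lintegral_mono_set hsub).trans_lt hu.dissipation_finite).ne
  have hPfin : P ≠ ⊤ := by
    have := hN.lintegral_lt_top
    exact this.ne
  have hNfin : N ≠ ⊤ := hN.neg.lintegral_lt_top.ne
  have hΦfin : Φ ≠ ⊤ := hF.abs.lintegral_lt_top.ne
  have hNm : AEMeasurable (fun s => ENNReal.ofReal (-visc χ Ω p (u s))) μ :=
    hN.neg.aestronglyMeasurable.aemeasurable.ennreal_ofReal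
  -- The lower integrals are split only along the viscous terms, whose measurability in time is
  -- known; none is required of the gradient norms.
  have h1 : DQ + N ≤ D + P := by
    rw [hDQ, hN', hD, hP, ← lintegral_add_right' _ hN.aestronglyMeasurable.aemeasurable.ennreal_ofReal,
      ← lintegral_add_right' _ hNm]
    exact setLIntegral_mono' measurableSet_Icc fun s hs =>
      gradNormSq_above_add_le hχ p (hu.l2On (hsub hs))
  have hDQfin : DQ ≠ ⊤ := ne_top_of_le_ne_top (ENNReal.add_ne_top.2 ⟨hDfin, hPfin⟩)
    (le_self_add.trans h1)
  have h1r : DQ.toReal + N.toReal ≤ D.toReal + P.toReal := by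
    rw [← ENNReal.toReal_add hDQfin hNfin, ← ENNReal.toReal_add hDfin hPfin]
    exact ENNReal.toReal_mono (ENNReal.add_ne_top.2 ⟨hDfin, hPfin⟩) h1
  have hut := hu.l2On ht
  have hu0 := hu.l2On ht₀
  have her : l2 Ω (u t) ^ 2 + 2 * D.toReal ≤ l2 Ω (u t₀) ^ 2 := by
    rw [normSq_eq_ofReal hut, normSq_eq_ofReal hu0, ← ENNReal.ofReal_toReal hDfin,
      ofReal_add_two_mul (sq_nonneg _) ENNReal.toReal_nonneg] at he
    exact (ENNReal.ofReal_le_ofReal_iff (sq_nonneg _)).1 he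
  have hg := hu.energy_below hχ.sqProfile p ht₀ ht
  simp only [evo_eq_flux_add_visc hχ] at hg
  rw [intervalIntegral.integral_of_le h0t, ← integral_Icc_eq_integral_Ioc, integral_add hF hN,
    integral_eq_lintegral_pos_part_sub_lintegral_neg_part hN, coe_lpK] at hg
  have hFr : -Φ.toReal ≤ ∫ s, flux χ Ω p (u s) ∂μ := by
    rw [hΦ, ← integral_eq_lintegral_of_nonneg_ae (Eventually.of_forall fun s => abs_nonneg _)
      hF.abs.aestronglyMeasurable]
    have := abs_integral_le_integral_abs (μ := μ) (f := fun s => flux χ Ω p (u s))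
    have h2 := neg_abs_le (∫ s, flux χ Ω p (u s) ∂μ)
    linarith
  have q1 := l2_sub_below_sq hχ p hut
  have q0 := l2_sub_below_sq hχ p hu0
  rw [normSq_eq_ofReal (hut.above hχ p), normSq_eq_ofReal (hu0.above hχ p),
    ← ENNReal.ofReal_toReal hDQfin, ← ENNReal.ofReal_toReal hΦfin,
    ofReal_add_two_mul (sq_nonneg _) ENNReal.toReal_nonneg,
    ofReal_add_two_mul (sq_nonneg _) ENNReal.toReal_nonneg]
  refine ENNReal.ofReal_le_ofReal ?_
  rw [above_eq, above_eq, q1, q0]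
  linarith

/-- The essential bound on one cell holds a.e. on ℝ³ by periodicity, and everywhere by continuity,
since a set of full measure is dense. -/
theorem enorm_grad_below_le (hχ : IsLPProfile χ) (p : ℕ) {f : E3 → E3} (hf : L2On Ω f) (x : E3) :
    ‖grad (below χ p f) x‖ₑ ≤ eLpNorm (grad (below χ p f)) ⊤ Ω.measure := by
  have hb : below χ p f = conv (lpK hχ p) f := by rw [coe_lpK]; rfl
  rw [hb]
  have hg := hf.grad_conv (lpK hχ p)
  have hc : Continuous (grad (conv (lpK hχ p) f)) :=
    continuous_grad ((contDiff_conv (lpK hχ p) hf).of_le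
      (show (1 : WithTop ℕ∞) ≤ (∞ : WithTop ℕ∞) by exact_mod_cast le_top))
  set A := eLpNorm (grad (conv (lpK hχ p) f)) ⊤ Ω.measure with hA
  have h1 : ∀ᵐ x ∂Ω.measure, ‖grad (conv (lpK hχ p) f) x‖ₑ ≤ A := by
    rw [hA, eLpNorm_exponent_top]
    exact enorm_ae_le_eLpNormEssSup _ _
  have h2 := ae_of_ae_measure (hg.isFunOn.comp fun v => ‖v‖ₑ ≤ A) h1
  have hd : Dense {x | ‖grad (conv (lpK hχ p) f) x‖ₑ ≤ A} := Measure.dense_of_ae h2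
  have hcl : IsClosed {x | ‖grad (conv (lpK hχ p) f) x‖ₑ ≤ A} :=
    isClosed_le hc.enorm continuous_const
  have : x ∈ closure {x | ‖grad (conv (lpK hχ p) f) x‖ₑ ≤ A} := hd x
  rwa [hcl.closure_eq] at this

theorem eLpNorm_grad_below_lt_top (hχ : IsLPProfile χ) (p : ℕ) {f : E3 → E3} (hf : L2On Ω f) :
    eLpNorm (grad (below χ p f)) ⊤ Ω.measure < ⊤ := by
  have hb : below χ p f = conv (lpK hχ p) f := by rw [coe_lpK]; rfl
  obtain ⟨C, hC⟩ := (bddDeriv_conv (lpK hχ p) hf).bound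
  have hC0 : 0 ≤ C := (norm_nonneg _).trans (hC 0)
  rw [hb, eLpNorm_exponent_top]
  refine eLpNormEssSup_lt_top_of_ae_bound (C := Real.sqrt (∑ _j : Fin 3, C ^ 2))
    (Eventually.of_forall fun x => ?_)
  rw [PiLp.norm_eq_of_L2]
  refine Real.sqrt_le_sqrt (Finset.sum_le_sum fun j _ => pow_le_pow_left₀ (norm_nonneg _) ?_ 2)
  refine ((fderiv ℝ (conv (lpK hχ p) f) x).le_opNorm (e j)).trans ?_
  simpa [e] using hC x

/-- The flux is controlled by the gradient of the low frequencies. -/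
theorem ofReal_abs_flux_le (hχ : IsLPProfile χ) (r : ℕ) {f : E3 → E3} (hf : L2On Ω f)
    (hd : IsDivFree f) : ENNReal.ofReal |flux χ Ω (r + 2) f| ≤
      ENNReal.ofReal (fluxC χ (sqProfile χ)) *
        eLpNorm (grad (upTo χ (r + 2) f)) ⊤ Ω.measure * Ω.normSq (above χ r f) := by
  have hfin := eLpNorm_grad_below_lt_top hχ (r + 3) hf
  set A := eLpNorm (grad (below χ (r + 3) f)) ⊤ Ω.measure with hA
  have hV : ∀ x v, ‖fderiv ℝ (conv (belowKernel χ (r + 3)) f) x v‖ ≤ A.toReal * ‖v‖ := by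
    intro x v
    refine (norm_fderiv_le_grad _ x v).trans (mul_le_mul_of_nonneg_right ?_ (norm_nonneg _))
    have h1 := ENNReal.toReal_mono hfin.ne (enorm_grad_below_le hχ (r + 3) hf x)
    rwa [toReal_enorm] at h1
  have h := abs_flux_le hχ hχ.sqProfile r hd hf ENNReal.toReal_nonneg hV
  rw [normSq_eq_ofReal (hf.above hχ r)]
  change _ ≤ ENNReal.ofReal (fluxC χ (sqProfile χ)) * A * _
  rw [← ENNReal.ofReal_toReal hfin.ne, ← ENNReal.ofReal_mul (fluxC_nonneg _ _),
    ← ENNReal.ofReal_mul (mul_nonneg (fluxC_nonneg _ _) ENNReal.toReal_nonneg)]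
  exact ENNReal.ofReal_le_ofReal h

/-- Nested high-frequency projections. -/
theorem above_above (hχ : IsLPProfile χ) {p q : ℕ} (h : q < p) {f : E3 → E3} (hf : L2On Ω f) :
    above χ p (above χ q f) = above χ p f := by
  ext1 x
  simp only [above_eq]
  rw [conv_sub (rapid_below hχ p) hf (hf.below hχ q), conv_below_of_lt hχ hχ h hf]
  abel

end HighFrequencyEnergy

/-! ### The one-step inequality and its iteration -/

section Iteration

variable {Ω : Dom} {S T : ℝ} {u : ℝ → E3 → E3} {χ : ℝ → ℝ}

/-- The larger of the cutoff dissipation and the cutoff energy. -/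
def cutoffMax (χ : ℝ → ℝ) (Ω : Dom) (u : ℝ → E3 → E3) (T : ℝ) (p : ℕ) : ℝ≥0∞ :=
  max (cutoffDissipation χ Ω u T p) (cutoffEnergy χ Ω u T p)

/-- The constant in the Poincaré inequality for high frequencies. -/
def poincareC (χ : ℝ → ℝ) : ℝ := 1 + ∫ x, ‖x‖ * ‖belowKernel χ 0 x‖

theorem poincareC_pos (χ : ℝ → ℝ) : 0 < poincareC χ := by
  have hA : 0 ≤ ∫ x, ‖x‖ * ‖belowKernel χ 0 x‖ := integral_nonneg fun x => by positivity
  unfold poincareC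
  linarith

theorem timeI_subset_Icc (hTS : T ≤ S) {q : ℤ} (h0 : 0 ≤ T - (lam q ^ 2)⁻¹) :
    timeI T q ⊆ Set.Icc 0 S := fun _ hs => ⟨h0.trans hs.1, hs.2.le.trans hTS⟩

theorem normSq_above_le_mul (hχ : IsLPProfile χ) (p : ℕ) {f : E3 → E3} (hf : L2On Ω f) :
    Ω.normSq (above χ p f) ≤ ENNReal.ofReal ((1 + lpC χ) ^ 2) * Ω.normSq f := by
  rw [normSq_eq_ofReal (hf.above hχ p), normSq_eq_ofReal hf, ← ENNReal.ofReal_mul (sq_nonneg _),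
    ← mul_pow]
  exact ENNReal.ofReal_le_ofReal (pow_le_pow_left₀ (l2_nonneg _) (l2_above_le hχ p hf) 2)

/-- Finiteness starts the iteration; it comes from the Leray–Hopf bounds once the time interval lies
inside [0, S]. -/
theorem cutoffMax_lt_top (hu : IsLerayHopf Ω S u) (hχ : IsLPProfile χ) (hTS : T ≤ S) {p : ℕ}
    (h0 : 0 ≤ T - (lam p ^ 2)⁻¹) : cutoffMax χ Ω u T p < ⊤ := by
  have hsub := timeI_subset_Icc hTS h0
  refine max_lt ?_ ?_
  · have h1 : cutoffDissipation χ Ω u T p ≤ ENNReal.ofReal ((1 + lpC χ) ^ 2) *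
        ∫⁻ t in Set.Icc 0 S, Ω.gradNormSq (u t) := by
      rw [← lintegral_const_mul' _ _ ENNReal.ofReal_ne_top]
      refine (setLIntegral_mono' measurableSet_Ico fun s hs =>
        gradNormSq_above_le hχ p (hu.l2On (hsub hs))).trans ?_
      exact lintegral_mono_set hsub
    exact h1.trans_lt (ENNReal.mul_lt_top ENNReal.ofReal_lt_top hu.dissipation_finite)
  · obtain ⟨M, hM⟩ := hu.energy_bounded
    have h1 : cutoffEnergy χ Ω u T p ≤ ENNReal.ofReal ((1 + lpC χ) ^ 2) * M := by
      refine iSup₂_le fun t ht => ?_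
      refine (normSq_above_le_mul hχ p (hu.l2On (hsub ht))).trans ?_
      gcongr
      exact hM t (hsub ht)
    exact h1.trans_lt (ENNReal.mul_lt_top ENNReal.ofReal_lt_top ENNReal.coe_lt_top)

/-- The energy flux through scale `r + 2` on the time interval of a larger scale `q`. -/
theorem lintegral_flux_le (hu : IsLerayHopf Ω S u) (hχ : IsLPProfile χ) (hTS : T ≤ S) {q r : ℕ}
    (hqr : q < r) (h0 : 0 ≤ T - (lam q ^ 2)⁻¹) (hfin : cutoffMax χ Ω u T q ≠ ⊤) :
    ∫⁻ s in timeI T q, ENNReal.ofReal |flux χ Ω (r + 2) (u s)| ≤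
      ENNReal.ofReal (fluxC χ (sqProfile χ) * (1 + lpC χ) ^ 2) *
        (∫⁻ s in timeI T q, eLpNorm (grad (upTo χ (r + 2) (u s))) ⊤ Ω.measure) *
          cutoffMax χ Ω u T q := by
  have hsub := timeI_subset_Icc hTS h0
  have hF := fluxC_nonneg χ (sqProfile χ)
  rw [← lintegral_const_mul' _ _ ENNReal.ofReal_ne_top, ← lintegral_mul_const' _ _ hfin]
  refine setLIntegral_mono' measurableSet_Ico fun s hs => ?_
  have hus := hu.l2On (hsub hs)
  refine (ofReal_abs_flux_le hχ r hus (hu.isDivFree (hsub hs))).trans ?_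
  have h1 : Ω.normSq (above χ r (u s)) ≤
      ENNReal.ofReal ((1 + lpC χ) ^ 2) * cutoffMax χ Ω u T q := by
    -- The flux sees frequencies from r upwards, but the available energy is cut at q < r; nesting
    -- the projections costs the operator norm 1 + `lpC χ`.
    rw [← above_above hχ hqr hus]
    refine (normSq_above_le_mul hχ r (hus.above hχ q)).trans ?_
    gcongr
    have h2 : Ω.normSq (above χ q (u s)) ≤ cutoffEnergy χ Ω u T q :=
      le_iSup₂_of_le s hs le_rfl
    exact h2.trans (le_max_right _ _)
  refine (mul_le_mul_right h1 _).trans (le_of_eq ?_)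
  rw [ENNReal.ofReal_mul hF]
  ring

theorem lam_add (q b : ℕ) : lam ((q + b : ℕ) : ℤ) = 2 ^ b * lam q := by
  rw [lam, lam, zpow_natCast, zpow_natCast, pow_add, mul_comm]

/-- One step of the iteration, for a single time. -/
theorem energy_dissipation_le (hu : IsLerayHopf Ω S u) (hχ : IsLPProfile χ) (hTS : T ≤ S)
    {q r : ℕ} (hqr : q < r) (h0 : 0 ≤ T - (lam q ^ 2)⁻¹) (hfin : cutoffMax χ Ω u T q ≠ ⊤) {t : ℝ}
    (ht : t ∈ Set.Icc (T - (lam (r + 2 : ℕ) ^ 2)⁻¹) T) :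
    (Ω.normSq (above χ (r + 2) (u t)) + 2 * ∫⁻ s in Set.Icc (T - (lam (r + 2 : ℕ) ^ 2)⁻¹) t,
        Ω.gradNormSq (above χ (r + 2) (u s))) ≤
      (ENNReal.ofReal (4 / 3 * poincareC χ ^ 2 * (lam q / lam (r + 2 : ℕ)) ^ 2) +
        2 * ENNReal.ofReal (fluxC χ (sqProfile χ) * (1 + lpC χ) ^ 2) *
          ∫⁻ s in timeI T q, eLpNorm (grad (upTo χ (r + 2) (u s))) ⊤ Ω.measure) *
        cutoffMax χ Ω u T q := by
  set p := r + 2 with hp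
  set X := cutoffMax χ Ω u T q with hX
  set w := ∫⁻ s in timeI T q, eLpNorm (grad (upTo χ p (u s))) ⊤ Ω.measure with hw
  set c := poincareC χ with hc
  set K := ENNReal.ofReal (fluxC χ (sqProfile χ) * (1 + lpC χ) ^ 2) with hK
  set a := T - (lam p ^ 2)⁻¹ with ha
  set Y := Ω.normSq (above χ p (u t)) + 2 * ∫⁻ s in Set.Icc a t, Ω.gradNormSq (above χ p (u s))
    with hY
  have hlq := lam_pos q
  have hlp := lam_pos p
  have hc0 := poincareC_pos χ
  have hqp : 2 * lam q ≤ lam p := by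
    rw [← lam_natCast_succ]
    exact lam_mono (by omega)
  set L := (lam q ^ 2)⁻¹ - (lam p ^ 2)⁻¹ with hL
  -- As λ_p ≥ 2λ_q, the interval I_p takes up at most a quarter of I_q.
  have hLq : 3 / 4 ≤ lam q ^ 2 * L := by
    have h1 : (lam q / lam p) ^ 2 ≤ (1 / 2) ^ 2 := by
      refine pow_le_pow_left₀ (by positivity) ?_ 2
      rw [div_le_div_iff₀ hlp two_pos]
      linarith
    have h2 : lam q ^ 2 * L = 1 - (lam q / lam p) ^ 2 := by
      rw [hL]; field_simp
    rw [h2]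
    norm_num at h1 ⊢
    linarith
  have hL0 : 0 < L := by
    by_contra! hneg
    nlinarith [sq_nonneg (lam q)]
  have htS : t ∈ Set.Icc 0 S := by
    refine ⟨?_, ht.2.trans hTS⟩
    have : T - (lam q ^ 2)⁻¹ ≤ a := by rw [ha]; linarith
    linarith [ht.1]
  set J := Set.Ico (T - (lam q ^ 2)⁻¹) a with hJ
  have hJt : J ⊆ Set.Icc 0 t := fun s hs => ⟨h0.trans hs.1, hs.2.le.trans ht.1⟩
  have hJq : J ⊆ timeI T q := fun s hs => ⟨hs.1, hs.2.trans_le (by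
    rw [ha]; have : 0 < (lam p ^ 2)⁻¹ := by positivity
    linarith)⟩
  -- The left side does not depend on t₀, because the dissipation is counted only from the start of
  -- I_p. One may therefore average over admissible initial times in I_q∖I_p.
  have hae : ∀ᵐ t₀ ∂(volume.restrict J), Y ≤ ENNReal.ofReal (((lam p)⁻¹ * c) ^ 2) *
      Ω.gradNormSq (above χ q (u t₀)) + 2 * (K * w * X) := by
    have h1 := ae_mono (Measure.restrict_mono hJt le_rfl) (hu.energy_ae t htS)
    filter_upwards [h1, ae_restrict_mem measurableSet_Ico] with t₀ he ht₀
    have ht₀S : t₀ ∈ Set.Icc 0 S := ⟨(hJt ht₀).1, (hJt ht₀).2.trans htS.2⟩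
    have ht₀t := (hJt ht₀).2
    have hu0 := hu.l2On ht₀S
    have h2 := hu.energy_above hχ p ht₀S htS ht₀t he
    have h3 : Y ≤ Ω.normSq (above χ p (u t)) +
        2 * ∫⁻ s in Set.Icc t₀ t, Ω.gradNormSq (above χ p (u s)) := by
      rw [hY]
      gcongr
      exact ht₀.2.le
    refine h3.trans (h2.trans (add_le_add ?_ ?_))
    · rw [← above_above hχ (show q < p by omega) hu0]
      exact normSq_above_le hχ p (hu0.above hχ q)
    · gcongr
      refine le_trans ?_ (lintegral_flux_le hu hχ hTS hqr h0 hfin)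
      calc _ ≤ ∫⁻ s in Set.Icc t₀ T, ENNReal.ofReal |flux χ Ω p (u s)| :=
            lintegral_mono_set (Set.Icc_subset_Icc_right ht.2)
        _ = ∫⁻ s in Set.Ico t₀ T, ENNReal.ofReal |flux χ Ω p (u s)| :=
            (setLIntegral_congr Ico_ae_eq_Icc).symm
        _ ≤ _ := lintegral_mono_set (Set.Ico_subset_Ico_left ht₀.1)
  have hJvol : volume J = ENNReal.ofReal L := by
    rw [hJ, Real.volume_Ico, ha, hL]
    congr 1; ring
  have hint : Y * ENNReal.ofReal L ≤ ENNReal.ofReal (((lam p)⁻¹ * c) ^ 2) * X +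
      2 * (K * w * X) * ENNReal.ofReal L := by
    have h1 := lintegral_mono_ae hae
    rw [lintegral_const, Measure.restrict_apply_univ, hJvol,
      lintegral_add_right _ measurable_const, lintegral_const, Measure.restrict_apply_univ, hJvol,
      lintegral_const_mul' _ _ ENNReal.ofReal_ne_top] at h1
    refine h1.trans ?_
    gcongr
    exact (lintegral_mono_set hJq).trans (le_max_left _ _)
  -- Dividing the Poincaré factor c²λ_p^{-2} by L ≥ ¾λ_q^{-2} yields the gain (λ_q/λ_p)² with the
  -- constant 4/3.
  have hA : ENNReal.ofReal (((lam p)⁻¹ * c) ^ 2) ≤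
      ENNReal.ofReal (4 / 3 * c ^ 2 * (lam q / lam p) ^ 2) * ENNReal.ofReal L := by
    rw [← ENNReal.ofReal_mul (by positivity)]
    refine ENNReal.ofReal_le_ofReal ?_
    have h1 : 4 / 3 * c ^ 2 * (lam q / lam p) ^ 2 * L =
        ((lam p)⁻¹ * c) ^ 2 * (4 / 3 * (lam q ^ 2 * L)) := by
      field_simp
    rw [h1]
    refine le_mul_of_one_le_right (sq_nonneg _) ?_
    linarith
  have hL1 : ENNReal.ofReal L ≠ 0 := (ENNReal.ofReal_pos.2 hL0).ne'
  rw [← ENNReal.mul_le_mul_iff_left hL1 ENNReal.ofReal_ne_top]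
  refine hint.trans ((add_le_add_left (mul_le_mul_left hA X) _).trans (le_of_eq ?_))
  ring

/-- One step of the iteration. -/
theorem cutoffMax_le (hu : IsLerayHopf Ω S u) (hχ : IsLPProfile χ) (hTS : T ≤ S)
    {q r : ℕ} (hqr : q < r) (h0 : 0 ≤ T - (lam q ^ 2)⁻¹) (hfin : cutoffMax χ Ω u T q ≠ ⊤) :
    cutoffMax χ Ω u T (r + 2) ≤
      (ENNReal.ofReal (4 / 3 * poincareC χ ^ 2 * (lam q / lam (r + 2 : ℕ)) ^ 2) +
        2 * ENNReal.ofReal (fluxC χ (sqProfile χ) * (1 + lpC χ) ^ 2) *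
          ∫⁻ s in timeI T q, eLpNorm (grad (upTo χ (r + 2) (u s))) ⊤ Ω.measure) *
        cutoffMax χ Ω u T q := by
  have hlp := lam_pos (r + 2 : ℕ)
  have hstep := fun {t : ℝ} => energy_dissipation_le (t := t) hu hχ hTS hqr h0 hfin
  refine max_le ?_ (iSup₂_le fun t ht => ?_)
  -- The dissipation is read off at the final time `T`, the energy at each time of I_p.
  · have hT : T ∈ Set.Icc (T - (lam (r + 2 : ℕ) ^ 2)⁻¹) T :=
      ⟨by have : 0 < (lam (r + 2 : ℕ) ^ 2)⁻¹ := by positivity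
          linarith, le_rfl⟩
    refine le_trans ?_ (hstep hT)
    refine le_trans ?_ le_add_self
    refine le_trans ?_ (le_mul_of_one_le_left' one_le_two)
    exact lintegral_mono_set Set.Ico_subset_Icc_self
  · exact le_self_add.trans (hstep ⟨ht.1, ht.2.le⟩)

/-- After division by ρ^p the sequence does not increase along steps of length `b`, so each residue
class is bounded by its first term; the constant adds up these `b` terms. -/
theorem exists_geometric_bound {x : ℕ → ℝ} {ρ : ℝ} {b P : ℕ} (hρ : 0 < ρ) (hb : 0 < b)
    (hx : ∀ p, 0 ≤ x p) (h : ∀ p ≥ P, x (p + b) ≤ ρ ^ b * x p) :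
    ∃ K, 0 ≤ K ∧ ∀ p ≥ P, x p ≤ K * ρ ^ p := by
  set y : ℕ → ℝ := fun p => x p / ρ ^ p with hy
  have hy0 : ∀ p, 0 ≤ y p := fun p => div_nonneg (hx p) (pow_pos hρ p).le
  have hstep : ∀ p ≥ P, y (p + b) ≤ y p := by
    intro p hp
    simp only [hy]
    rw [div_le_div_iff₀ (pow_pos hρ _) (pow_pos hρ _), pow_add]
    have := mul_le_mul_of_nonneg_right (h p hp) (pow_pos hρ p).le
    calc _ ≤ _ := this
      _ = _ := by ring
  have hiter : ∀ m p, P ≤ p → y (p + b * m) ≤ y p := by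
    intro m
    induction m with
    | zero => intro p _; simp
    | succ m ih =>
      intro p hp
      rw [show p + b * (m + 1) = (p + b * m) + b by ring]
      exact (hstep _ (hp.trans (Nat.le_add_right _ _))).trans (ih p hp)
  refine ⟨∑ i ∈ Finset.range b, y (P + i), Finset.sum_nonneg fun i _ => hy0 _, fun p hp => ?_⟩
  rw [← div_le_iff₀ (pow_pos hρ p)]
  have h1 : p = P + (p - P) % b + b * ((p - P) / b) := by
    have := Nat.mod_add_div (p - P) b
    omega
  have h2 : y p ≤ y (P + (p - P) % b) := by
    conv_lhs => rw [h1]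
    exact hiter _ _ (Nat.le_add_right _ _)
  refine h2.trans ?_
  exact Finset.single_le_sum (f := fun i => y (P + i)) (fun i _ => hy0 _)
    (Finset.mem_range.2 (Nat.mod_lt _ hb))

theorem lam_rpow (p : ℕ) (α : ℝ) : lam p ^ (-α) = ((2 : ℝ) ^ (-α)) ^ p := by
  rw [lam, zpow_natCast, ← Real.rpow_natCast, ← Real.rpow_natCast, ← Real.rpow_mul (by norm_num),
    ← Real.rpow_mul (by norm_num), mul_comm]

/-- Iterated decay of a sequence along a fixed step beats a slightly larger geometric rate. -/
theorem eventually_le_lam_rpow {X : ℕ → ℝ≥0∞} {α β : ℝ} (hαβ : α < β) {b P : ℕ} (hb : 0 < b)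
    (hfin : ∀ p ≥ P, X p < ⊤)
    (h : ∀ p ≥ P, X (p + b) ≤ ENNReal.ofReal (((2 : ℝ) ^ (-β)) ^ b) * X p) :
    ∃ p₀, ∀ p ≥ p₀, X p ≤ ENNReal.ofReal (lam p ^ (-α)) := by
  have hρ : (0 : ℝ) < (2 : ℝ) ^ (-β) := by positivity
  have hσ : (0 : ℝ) < (2 : ℝ) ^ (-α) := by positivity
  obtain ⟨K, hK0, hK⟩ := exists_geometric_bound (x := fun p => (X p).toReal) (P := P) hρ hb
    (fun _ => ENNReal.toReal_nonneg) fun p hp => by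
      have h1 := ENNReal.toReal_mono (ENNReal.mul_ne_top ENNReal.ofReal_ne_top (hfin p hp).ne)
        (h p hp)
      rwa [ENNReal.toReal_mul, ENNReal.toReal_ofReal (by positivity)] at h1
  -- The strict inequality between the exponents absorbs the constant `K` for large `p`.
  have hlt : (2 : ℝ) ^ (-β) / (2 : ℝ) ^ (-α) < 1 := by
    rw [div_lt_one hσ]
    exact Real.rpow_lt_rpow_of_exponent_lt one_lt_two (by linarith)
  have hlim := (tendsto_pow_atTop_nhds_zero_of_lt_one (by positivity) hlt).const_mul K
  rw [mul_zero] at hlim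
  obtain ⟨Q, hQ⟩ := eventually_atTop.1 (hlim.eventually (ge_mem_nhds one_pos))
  refine ⟨max P Q, fun p hp => ?_⟩
  rw [← ENNReal.ofReal_toReal (hfin p (le_of_max_le_left hp)).ne, lam_rpow]
  refine ENNReal.ofReal_le_ofReal ((hK p (le_of_max_le_left hp)).trans ?_)
  have h1 := hQ p (le_of_max_le_right hp)
  rw [div_pow, ← mul_div_assoc, div_le_one (pow_pos hσ p)] at h1
  exact h1

end Iteration

end NSE

end

/-! ### Choice of parameters and conclusion -/

theorem mainTheorem5 (χ : ℝ → ℝ) (hχ : NSE.IsLPProfile χ) :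
    ∃ C : ℝ, 0 < C ∧ ∀ α : ℝ, 0 < α → α < 2 → ∃ δ : ℝ, 0 < δ ∧ ∃ b : ℕ,
      ∀ (Ω : NSE.Dom) (u : ℝ → NSE.E3 → NSE.E3) (S T' T : ℝ),
        0 ≤ T' → T' < T → T ≤ S →
        NSE.IsLerayHopf Ω S u → NSE.IsRegularOn Ω u T' T →
        limsup (fun p : ℕ => ∫⁻ t in NSE.timeI T ((p : ℤ) - b),
          eLpNorm (NSE.grad (NSE.upTo χ p (u t))) ⊤ Ω.measure) atTop ≤ ENNReal.ofReal δ →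
        ∃ p₀ : ℕ, ∀ p ≥ p₀,
          max (NSE.cutoffDissipation χ Ω u T p) (NSE.cutoffEnergy χ Ω u T p) ≤
            ENNReal.ofReal (C * NSE.lam p ^ (-α)) := by
  refine ⟨1, one_pos, fun α hα hα2 => ?_⟩
  -- Any exponent strictly between α and 2 serves: β > α absorbs constants, and β < 2 makes 2^{-β}
  -- exceed the Poincaré gain 1/4 per scale.
  set β := (α + 2) / 2 with hβ
  set ρ : ℝ := (2 : ℝ) ^ (-β) with hρ
  have hρ0 : 0 < ρ := by positivity
  have hρ4 : 1 / 4 < ρ := by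
    have h1 : (2 : ℝ) ^ (-2 : ℝ) < ρ :=
      Real.rpow_lt_rpow_of_exponent_lt one_lt_two (by rw [hβ]; linarith)
    have h2 : (2 : ℝ) ^ (-2 : ℝ) = 1 / 4 := by
      rw [Real.rpow_neg (by norm_num), Real.rpow_two]; norm_num
    rwa [h2] at h1
  set A := 4 / 3 * NSE.poincareC χ ^ 2 with hA
  set K := NSE.fluxC χ (NSE.sqProfile χ) * (1 + NSE.lpC χ) ^ 2 with hK
  have hK0 : 0 ≤ K := mul_nonneg (NSE.fluxC_nonneg _ _) (sq_nonneg _)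
  have hA0 : 0 ≤ A := by positivity
  -- The bound `3 ≤ b` leaves room for q < r when r + 2 = q + b, as the flux estimate requires.
  obtain ⟨b, hb3, hbA⟩ : ∃ b : ℕ, 3 ≤ b ∧ A * (1 / 4) ^ b ≤ 1 / 2 * ρ ^ b := by
    have hlt : 1 / 4 / ρ < 1 := (div_lt_one hρ0).2 hρ4
    have hlim := (tendsto_pow_atTop_nhds_zero_of_lt_one (by positivity) hlt).const_mul A
    rw [mul_zero] at hlim
    have h1 := hlim.eventually (ge_mem_nhds (show (0 : ℝ) < 1 / 2 by norm_num))
    obtain ⟨b, hb, hb3⟩ := (h1.and (eventually_ge_atTop 3)).exists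
    refine ⟨b, hb3, ?_⟩
    rwa [div_pow, ← mul_div_assoc, div_le_iff₀ (pow_pos hρ0 b)] at hb
  -- The flux term will enter as 2K·2δ, a limsup at most δ giving values eventually below 2δ; K + 1
  -- avoids division by zero.
  set δ := ρ ^ b / (8 * (K + 1)) with hδ
  have hδ0 : 0 < δ := by positivity
  have hKδ : 2 * K * (2 * δ) ≤ 1 / 2 * ρ ^ b := by
    rw [hδ, show 2 * K * (2 * (ρ ^ b / (8 * (K + 1)))) = K / (K + 1) * (1 / 2 * ρ ^ b) by
      field_simp; ring]
    refine mul_le_of_le_one_left (by positivity) ((div_le_one (by positivity)).2 (by linarith))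
  refine ⟨δ, hδ0, b, fun Ω u S T' T hT' hT'T hTS hu _ hlimsup => ?_⟩
  have hT : 0 < T := hT'.trans_lt hT'T
  have hev := eventually_lt_of_limsup_lt (hlimsup.trans_lt
    ((ENNReal.ofReal_lt_ofReal_iff (by positivity)).2 (show δ < 2 * δ by linarith)))
  obtain ⟨P₁, hP₁⟩ := eventually_atTop.1 hev
  -- From here on the time intervals lie inside [0, S]; this uses T > 0.
  obtain ⟨P₂, hP₂⟩ : ∃ P : ℕ, ∀ p ≥ P, 0 ≤ T - (NSE.lam p ^ 2)⁻¹ := by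
    have hlim := tendsto_pow_atTop_nhds_zero_of_lt_one (r := (1 / 4 : ℝ)) (by norm_num)
      (by norm_num)
    obtain ⟨P, hP⟩ := eventually_atTop.1 (hlim.eventually (ge_mem_nhds hT))
    refine ⟨P, fun p hp => ?_⟩
    have h1 : (NSE.lam p ^ 2)⁻¹ = (1 / 4 : ℝ) ^ p := by
      rw [NSE.lam, zpow_natCast, ← pow_mul, mul_comm, pow_mul, ← inv_pow]
      norm_num
    rw [h1]
    linarith [hP p hp]
  have hfin : ∀ p ≥ max P₁ P₂, NSE.cutoffMax χ Ω u T p < ⊤ := fun p hp =>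
    NSE.cutoffMax_lt_top hu hχ hTS (hP₂ p (le_of_max_le_right hp))
  have hmain := NSE.eventually_le_lam_rpow (X := NSE.cutoffMax χ Ω u T) (α := α) (β := β)
    (P := max P₁ P₂) (b := b) (by rw [hβ]; linarith) (by omega) hfin fun q hq => by
      -- The step goes from q to p = q + b, so that the interval I_{p-b} of the hypothesis is I_q.
      obtain ⟨r, hr⟩ : ∃ r, q + b = r + 2 := ⟨q + b - 2, by omega⟩
      have h1 := NSE.cutoffMax_le hu hχ hTS (show q < r by omega) (hP₂ q (le_of_max_le_right hq))
        (hfin q hq).ne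
      have h2 := hP₁ (q + b) (by have := le_of_max_le_left hq; omega)
      rw [show ((q + b : ℕ) : ℤ) - b = q by push_cast; ring] at h2
      rw [← hr] at h1
      refine h1.trans (mul_le_mul_left ?_ _)
      have h3 : (NSE.lam q / NSE.lam (q + b : ℕ)) ^ 2 = (1 / 4 : ℝ) ^ b := by
        have := NSE.lam_pos q
        rw [NSE.lam_add, div_mul_cancel_right₀ this.ne', ← inv_pow, ← pow_mul, mul_comm, pow_mul]
        norm_num
      rw [h3]
      have h4 : 2 * ENNReal.ofReal K * ENNReal.ofReal (2 * δ) =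
          ENNReal.ofReal (2 * K * (2 * δ)) := by
        rw [ENNReal.ofReal_mul (p := 2 * K) (by positivity), ENNReal.ofReal_mul (p := 2)
          (q := K) (by norm_num), ENNReal.ofReal_ofNat]
      refine (add_le_add_right (mul_le_mul_right h2.le _) _).trans ?_
      rw [h4, ← ENNReal.ofReal_add (by positivity) (by positivity)]
      refine ENNReal.ofReal_le_ofReal ((add_le_add hbA hKδ).trans (le_of_eq ?_))
      ring
  obtain ⟨p₀, hp₀⟩ := hmain
  refine ⟨p₀, fun p hp => ?_⟩
  rw [one_mul]
  exact hp₀ p hp
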